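/- Let $d\ge 1$, let $D\subset\mathbb R^d$ be a bounded open set, let $V=H^1_0(D)$ with $\|v\|_V=\|\nabla v\|_{L^2(D)}$, let $f\in H^{-1}(D)=V^*$, and let $(\psi_j)_{j\ge1}$ be a sequence of real functions in $L^\infty(D)$. Let $\gamma$ be the product measure on $U=\mathbb R^{\mathbb N}$ of standard Gaussian measures on $\mathbb R$. For $y\in U$ such that the series $b(y)=\sum_{j\ge1}y_j\psi_j$ converges in $L^\infty(D)$ (as the limit of its partial sums), let $u(y)\in V$ be the weak solution of $-\operatorname{div}(e^{b(y)}\nabla u(y))=f$, that is, $\int_D e^{b(y)}\nabla u(y)\cdot\nabla v\,dx=f(v)$ for all $v\in V$. Let $\mathcal F$ be the set of finitely supported sequences $\nu=(\nu_j)_{j\ge1}$ of nonnegative integers, let $H_\nu(y)=\prod_{j\ge1}H_{\nu_j}(y_j)$, where $H_k$ is the Hermite polynomial of degree $k$ normalized in $L^2$ of the standard Gaussian measure, and let $u_\nu=\int_U u(y)H_\nu(y)\,d\gamma(y)\in V$. Suppose that there is an integer $M$ such that $\#\{j:\psi_j(x)\ne0\}\le M$ for almost every $x\in D$. Let $0<p<2$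 and $q=\frac{2p}{2-p}$, and suppose that $(\|\psi_j\|_{L^\infty(D)})_{j\ge1}\in\ell^q(\mathbb N)$. Then for $\gamma$-almost every $y$ the series $b(y)$ converges in $L^\infty(D)$ and the weak solution $u(y)$ exists and is unique; the map $u$ belongs to $L^2(U,V,\gamma)$; and $(\|u_\nu\|_V)_{\nu\in\mathcal F}\in\ell^p(\mathcal F)$. Moreover, best $n$-term Hermite approximations converge in $L^2(U,V,\gamma)$ with rate $n^{-s}$, where $s=\frac1p-\frac12=\frac1q$: for every $n$ there is a set $\Lambda_n\subset\mathcal F$ of $n$ indices that correspond to $n$ largest values of $\|u_\nu\|_V$, and there is a constant $C$ such that for all $n\ge1$ and every such $\Lambda_n$, $$\Big\|u-\sum_{\nu\in\Lambda_n}u_\nu H_\nu\Big\|_{L^2(U,V,\gamma)}\le C\,n^{-1/q}.$$ -/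

import Mathlib

open MeasureTheory ProbabilityTheory Filter Topology
open scoped ENNReal ContDiff

noncomputable section

namespace Lognormal

/-- Euclidean space `ℝᵈ`. -/
abbrev Space (d : ℕ) : Type := EuclideanSpace ℝ (Fin d)

/-- Lebesgue measure on `D ⊆ ℝᵈ`. -/
abbrev vol {d : ℕ} (D : Set (Space d)) : Measure (Space d) := volume.restrict D

/-- The real Banach space `L^∞(D)`. -/
abbrev LInfty {d : ℕ} (D : Set (Space d)) : Type := Lp ℝ ∞ (vol D)

/-- The Hilbert space `L²(D) × L²(D; ℝᵈ)` in which `v ∈ H¹(D)` is represented by `(v, ∇v)`;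
its norm is the full `H¹` norm `(‖v‖² + ‖∇v‖²)^(1/2)`. -/
abbrev H1Ambient {d : ℕ} (D : Set (Space d)) : Type :=
  WithLp 2 (Lp ℝ 2 (vol D) × Lp (Space d) 2 (vol D))

/-- The pairs `(φ, ∇φ)` with `φ ∈ C_c^∞(D)`. -/
def testPairs {d : ℕ} (D : Set (Space d)) : Set (H1Ambient D) :=
  {w | ∃ φ : Space d → ℝ, ContDiff ℝ ∞ φ ∧ HasCompactSupport φ ∧ tsupport φ ⊆ D ∧
    (w.fst : Space d → ℝ) =ᵐ[vol D] φ ∧ (w.snd : Space d → Space d) =ᵐ[vol D] gradient φ}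

/-- `V = H¹₀(D)`, the closure of `C_c^∞(D)` in `H¹(D)`. -/
def H10 {d : ℕ} (D : Set (Space d)) : Submodule ℝ (H1Ambient D) :=
  (Submodule.span ℝ (testPairs D)).topologicalClosure

/-- The weak gradient of an element of `H¹₀(D)`. -/
def grad {d : ℕ} {D : Set (Space d)} (v : H10 D) : Lp (Space d) 2 (vol D) :=
  (v : H1Ambient D).snd

/-- The norm `‖v‖_V = ‖∇v‖_{L²(D)}` of `V = H¹₀(D)`.  On a bounded `D` it is equivalent, by the
Poincaré inequality, to the `H¹` norm, which is the norm instance of `H10 D`; in particular both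
norms give the same dual `H⁻¹(D)` and the same Bochner integrals. -/
def normV {d : ℕ} {D : Set (Space d)} (v : H10 D) : ℝ := ‖grad v‖

/-- `u ∈ H¹₀(D)` is the weak solution of `-div (exp(b) ∇u) = f` with homogeneous Dirichlet
boundary values: `∫_D exp(b) ∇u · ∇v = f(v)` for all `v ∈ H¹₀(D)`. -/
def IsWeakSolution {d : ℕ} {D : Set (Space d)} (b : LInfty D) (f : StrongDual ℝ (H10 D))
    (u : H10 D) : Prop :=
  ∀ v : H10 D, ∫ x, Real.exp (b x) * inner ℝ (grad u x) (grad v x) ∂(vol D) = f v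

/-- `b` is the sum in `L^∞(D)` of the series `∑_j y_j ψ_j`. -/
def IsLogCoefficient {d : ℕ} {D : Set (Space d)} (ψ : ℕ → LInfty D) (y : ℕ → ℝ)
    (b : LInfty D) : Prop :=
  Tendsto (fun J : ℕ => ∑ j ∈ Finset.range J, y j • ψ j) atTop (𝓝 b)

/-- The standard Gaussian product measure `γ` on `U = ℝ^ℕ`. -/
def gammaU : Measure (ℕ → ℝ) := Measure.infinitePi fun _ : ℕ => gaussianReal 0 1

/-- `u : U → V` is the solution map of `-div (a(y) ∇u(y)) = f`, `a(y) = exp (∑_j y_j ψ_j)`,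
defined for `γ`-almost every `y`. -/
def IsSolutionMap {d : ℕ} {D : Set (Space d)} (ψ : ℕ → LInfty D) (f : StrongDual ℝ (H10 D))
    (u : (ℕ → ℝ) → H10 D) : Prop :=
  ∀ᵐ y ∂gammaU, ∃ b : LInfty D, IsLogCoefficient ψ y b ∧ IsWeakSolution b f (u y)

/-- The univariate Hermite polynomial of degree `k`, normalized in `L²(ℝ, dg)` for the standard
Gaussian `g` (`Polynomial.hermite` is the monic probabilists' Hermite polynomial). -/
def hermiteN (k : ℕ) (t : ℝ) : ℝ :=
  Polynomial.aeval t (Polynomial.hermite k) / Real.sqrt (k.factorial : ℝ)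

/-- The tensorized Hermite polynomial `H_ν(y) = ∏_j H_{ν_j}(y_j)`, for `ν` in the set `ℱ` of
finitely supported sequences of nonnegative integers (the factors with `ν_j = 0` are `1`). -/
def hermiteT (ν : ℕ →₀ ℕ) (y : ℕ → ℝ) : ℝ := ∏ j ∈ ν.support, hermiteN (ν j) (y j)

/-- The Hermite coefficient `u_ν = ∫_U u(y) H_ν(y) dγ(y) ∈ V`. -/
def hermiteCoeff {d : ℕ} {D : Set (Space d)} (u : (ℕ → ℝ) → H10 D) (ν : ℕ →₀ ℕ) : H10 D :=
  ∫ y, hermiteT ν y • u y ∂gammaU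

/-- The truncated Hermite expansion `u_Λ = ∑_{ν ∈ Λ} u_ν H_ν`. -/
def hermiteTrunc {d : ℕ} {D : Set (Space d)} (u : (ℕ → ℝ) → H10 D) (Λ : Finset (ℕ →₀ ℕ))
    (y : ℕ → ℝ) : H10 D :=
  ∑ ν ∈ Λ, hermiteT ν y • hermiteCoeff u ν

/-- `Λ` is a set of `n` indices that correspond to the `n` largest values of `‖u_ν‖_V`
(ties are broken arbitrarily). -/
def IsBestIndexSet {d : ℕ} {D : Set (Space d)} (u : (ℕ → ℝ) → H10 D) (n : ℕ)
    (Λ : Finset (ℕ →₀ ℕ)) : Prop :=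
  Λ.card = n ∧ ∀ ν ∈ Λ, ∀ μ ∉ Λ, normV (hermiteCoeff u μ) ≤ normV (hermiteCoeff u ν)

/-- The norm of `L²(U, V, γ)`, with values in `[0, ∞]`. -/
def normL2UV {d : ℕ} {D : Set (Space d)} (w : (ℕ → ℝ) → H10 D) : ℝ≥0∞ :=
  eLpNorm (fun y => normV (w y)) 2 gammaU

/-- The family `ψ` has finitely overlapping supports: for some `M`, (almost) every `x ∈ D`
satisfies `#{j : ψ_j(x) ≠ 0} ≤ M`. -/
def FinitelyOverlapping {d : ℕ} {D : Set (Space d)} (ψ : ℕ → LInfty D) : Prop :=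
  ∃ M : ℕ, ∀ᵐ x ∂(vol D), {j : ℕ | ψ j x ≠ 0}.encard ≤ (M : ℕ∞)

end Lognormal

end

/-! The plan is to bound a weighted sum `∑ w_ν ‖u_ν‖²` and then use Hölder (in Young form) with `∑
w_ν^(-q/2) < ∞`.

Pick scalings `τ_j` with `∑_j τ_j |ψ_j| ≤ 1/2` almost everywhere and `(1/τ_j) ∈ ℓ^q`; finite overlap
allows `τ_j` of order `1/‖ψ_j‖` (`exists_scaling`). The scaled Taylor coefficients `t_μ = τ^μ ∂^μ u
/ μ!` solve the triangular system `∑_{α+ν=μ} A_α t_ν = δ_{μ0} F`, where `A_α` is the elliptic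
operator with coefficient `e^b (τψ)^α/α!`. Test the equation for `μ` with `t_μ` and sum over a
downward closed set. The off-diagonal coefficients have absolute sum at most `e^(1/2) - 1 < 1` at
almost every `x`, so a pointwise Schur test keeps the system coercive and gives `∑_μ ‖t_μ(y)‖² ≤ C
e^(2‖b(y)‖)` (`sum_norm_sq_taylorCoeff_le`).

Finite overlap also gives `‖b(y)‖ ≤ M sup_j |y_j| ‖ψ_j‖`, and `ℓ^q` summability of `‖ψ_j‖` makes
every exponential moment of this supremum finite (`integrable_exp_norm_logField`). Hence `∑_μ
‖t_μ‖²` in `L²(U, V, γ)` is finite.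

Gaussian integration by parts moves `μ` derivatives from `u` onto the Hermite polynomial. With `μ =
min(ν, r)` componentwise, `w_ν ‖u_ν‖²` is exactly the squared Hermite coefficient of `t_μ` at `ν -
μ` (`weight_mul_norm_sq_eq`). For fixed `μ` the map `ν ↦ ν - μ` is injective, so Parseval bounds the
sum over these `ν` by `‖t_μ‖²`, and summing over `μ` bounds `∑ w_ν ‖u_ν‖²`
(`summable_weight_mul_norm_sq`).

The weight is a product over `j` whose factor at `ν_j = k ≥ 1` is at least a constant times `k^r
τ_j²`. Thus `∑ w_ν^(-q/2)` is dominated by an infinite product that converges once `rq/2 > 1`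
(`summable_weight_rpow`). The capping at `r` keeps the factorials in the denominator bounded while
the binomials still grow polynomially. The rate is Stechkin's estimate combined with Parseval for
the remainder. The norm `‖∇v‖` and the full `H¹` norm are exchanged through the Poincaré inequality.
-/

noncomputable section

namespace Lognormal

/-! ### Poincaré inequality on `H¹₀(D)`. -/

section Poincare

variable {d : ℕ}

/-- Integration by parts of `φ² = ∂₀(x₀) φ²` leaves `-∫ 2 x₀ φ ∂₀φ`, where `|x₀| ≤ R` on the
support. Young's inequality with weight `1/2` on `φ²` allows that term to be absorbed on the left.
-/
theorem integral_sq_le_of_support_subset_ball (hd : 1 ≤ d) {R : ℝ} (hR : 0 ≤ R)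
    {φ : Space d → ℝ} (hφ : ContDiff ℝ ∞ φ) (hc : HasCompactSupport φ)
    (hs : ∀ x, φ x ≠ 0 → ‖x‖ ≤ R) :
    ∫ x, φ x ^ 2 ≤ 4 * R ^ 2 * ∫ x, ‖gradient φ x‖ ^ 2 := by
  let i : Fin d := ⟨0, hd⟩
  let e : Space d := EuclideanSpace.single i 1
  let f : Space d → ℝ := fun x => x i
  have hfd : ∀ x, HasFDerivAt f (EuclideanSpace.proj i : Space d →L[ℝ] ℝ) x := fun x =>
    (EuclideanSpace.proj i : Space d →L[ℝ] ℝ).hasFDerivAt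
  have hfc : Continuous f := (EuclideanSpace.proj i : Space d →L[ℝ] ℝ).continuous
  have hφd : Differentiable ℝ φ := hφ.differentiable (by simp)
  have hφ1 : Continuous (fderiv ℝ φ) := hφ.continuous_fderiv (by simp)
  have hφc : Continuous φ := hφ.continuous
  let g : Space d → ℝ := fun x => φ x ^ 2
  have hgd : ∀ x, fderiv ℝ g x e = 2 * φ x * fderiv ℝ φ x e := fun x => by
    have h := ((hφd x).hasFDerivAt.pow 2).fderiv
    have h2 : fderiv ℝ g x = fderiv ℝ (fun x => φ x ^ 2) x := rfl
    rw [h2, h]; simp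
  have hgc : HasCompactSupport g := by
    have : g = (fun t : ℝ => t ^ 2) ∘ φ := rfl
    rw [this]; exact hc.comp_left (by simp)
  have i1 : Integrable (fun x => fderiv ℝ f x e * g x) := by
    have : (fun x => fderiv ℝ f x e * g x) = g := by
      funext x; rw [(hfd x).fderiv]; simp [e]
    rw [this]
    exact (by fun_prop : Continuous g).integrable_of_hasCompactSupport hgc
  have hci : Continuous fun x => f x * (2 * φ x * fderiv ℝ φ x e) := by fun_prop
  have hcs : HasCompactSupport fun x => f x * (2 * φ x * fderiv ℝ φ x e) := by
    refine hc.mono fun x hx => ?_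
    contrapose! hx
    simp only [Function.mem_support, ne_eq, not_not] at hx ⊢
    simp [hx]
  have i2 : Integrable (fun x => f x * fderiv ℝ g x e) := by
    simp only [hgd]
    exact hci.integrable_of_hasCompactSupport hcs
  have i3 : Integrable (fun x => f x * g x) :=
    (by fun_prop : Continuous fun x => f x * g x).integrable_of_hasCompactSupport hgc.mul_left
  have key := integral_mul_fderiv_eq_neg_fderiv_mul_of_integrable (μ := (volume : Measure (Space d)))
    i1 i2 i3 (fun x _ => (hfd x).differentiableAt) (fun x _ => (hφd x).pow 2)
  have e1 : ∀ x, fderiv ℝ f x e * g x = φ x ^ 2 := fun x => by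
    rw [(hfd x).fderiv]; simp [e, g]
  simp only [e1, hgd] at key
  have hgrad : ∀ x, |fderiv ℝ φ x e| ≤ ‖gradient φ x‖ := fun x => by
    have h := (fderiv ℝ φ x).le_opNorm e
    have h2 : ‖gradient φ x‖ = ‖fderiv ℝ φ x‖ := by
      simp [gradient]
    have h3 : ‖e‖ = 1 := by simp [e]
    rw [h3, mul_one, Real.norm_eq_abs] at h
    rw [h2]; exact h
  have hgradc : Continuous fun x => ‖gradient φ x‖ ^ 2 := by
    have : (fun x => ‖gradient φ x‖ ^ 2) = fun x => ‖fderiv ℝ φ x‖ ^ 2 := by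
      funext x; simp [gradient]
    rw [this]; fun_prop
  have hgrads : HasCompactSupport fun x => ‖gradient φ x‖ ^ 2 := by
    have : (fun x => ‖gradient φ x‖ ^ 2) = fun x => ‖fderiv ℝ φ x‖ ^ 2 := by
      funext x; simp [gradient]
    rw [this]
    exact (hc.fderiv ℝ).comp_left (g := fun t => ‖t‖ ^ 2) (by simp)
  have igr : Integrable fun x => ‖gradient φ x‖ ^ 2 := hgradc.integrable_of_hasCompactSupport hgrads
  have ig : Integrable fun x => φ x ^ 2 :=
    (by fun_prop : Continuous fun x => φ x ^ 2).integrable_of_hasCompactSupport hgc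
  have hpt : ∀ x, -(f x * (2 * φ x * fderiv ℝ φ x e)) ≤
      φ x ^ 2 / 2 + 2 * R ^ 2 * ‖gradient φ x‖ ^ 2 := fun x => by
    by_cases h0 : φ x = 0
    · simp only [h0]; simp; positivity
    have hx : |f x| ≤ R := (PiLp.norm_apply_le x i).trans (hs x h0)
    have h1 : |f x * fderiv ℝ φ x e| ≤ R * ‖gradient φ x‖ := by
      rw [abs_mul]; exact mul_le_mul hx (hgrad x) (abs_nonneg _) hR
    have h2 : (f x * fderiv ℝ φ x e) ^ 2 ≤ (R * ‖gradient φ x‖) ^ 2 := sq_le_sq' (by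
      linarith [neg_abs_le (f x * fderiv ℝ φ x e)]) ((le_abs_self _).trans h1)
    nlinarith [sq_nonneg (φ x + 2 * (f x * fderiv ℝ φ x e))]
  have := integral_mono (hci.integrable_of_hasCompactSupport hcs).neg
    ((ig.div_const 2).add (igr.const_mul (2 * R ^ 2))) hpt
  simp only [Pi.neg_apply, Pi.add_apply] at this
  rw [integral_neg, key, neg_neg, integral_add (ig.div_const 2) (igr.const_mul _),
    integral_div, integral_const_mul] at this
  linarith

/-- The pairs `(φ, ∇φ)` with `φ ∈ C_c^∞(D)` form a linear subspace. -/
def testSubmodule (D : Set (Space d)) : Submodule ℝ (H1Ambient D) where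
  carrier := testPairs D
  zero_mem' := by
    refine ⟨0, contDiff_const, HasCompactSupport.zero, by simp [tsupport], ?_, ?_⟩
    · exact Lp.coeFn_zero _ _ _
    · have : gradient (0 : Space d → ℝ) = 0 := by
        funext x; simp [gradient]
      rw [this]; exact Lp.coeFn_zero _ _ _
  add_mem' := by
    rintro v w ⟨φ, h1, h2, h3, h4, h5⟩ ⟨χ, k1, k2, k3, k4, k5⟩
    refine ⟨φ + χ, h1.add k1, h2.add k2, (tsupport_add _ _).trans (Set.union_subset h3 k3), ?_, ?_⟩
    · rw [WithLp.add_fst]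
      filter_upwards [Lp.coeFn_add v.fst w.fst, h4, k4] with x hx hx1 hx2
      rw [hx, Pi.add_apply, hx1, hx2, Pi.add_apply]
    · rw [WithLp.add_snd]
      filter_upwards [Lp.coeFn_add v.snd w.snd, h5, k5] with x hx hx1 hx2
      have hφ := h1.differentiable (by simp) x
      have hχ := k1.differentiable (by simp) x
      rw [hx, Pi.add_apply, hx1, hx2]
      simp [gradient, fderiv_add hφ hχ]
  smul_mem' := by
    rintro c v ⟨φ, h1, h2, h3, h4, h5⟩
    refine ⟨c • φ, contDiff_const.smul h1, h2.smul_left, ?_, ?_, ?_⟩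
    · exact (tsupport_smul_subset_right (fun _ => c) φ).trans h3
    · rw [WithLp.smul_fst]
      filter_upwards [Lp.coeFn_smul c v.fst, h4] with x hx hx1
      simp [hx, hx1]
    · rw [WithLp.smul_snd]
      filter_upwards [Lp.coeFn_smul c v.snd, h5] with x hx hx1
      have hφ := h1.differentiable (by simp) x
      simp [hx, hx1, gradient, fderiv_const_smul hφ]

theorem norm_sq_eq_integral {E : Type*} [NormedAddCommGroup E] [InnerProductSpace ℝ E]
    {α : Type*} [MeasurableSpace α] {m : Measure α} (g : Lp E 2 m) :
    ‖g‖ ^ 2 = ∫ x, ‖g x‖ ^ 2 ∂m := by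
  rw [← real_inner_self_eq_norm_sq, L2.inner_def]
  simp

/-- The inequality between the two components is a closed condition, and the span of the test pairs
contains nothing but test pairs, so it passes to the closure. -/
theorem exists_poincare_const (hd : 1 ≤ d) {D : Set (Space d)} (hD : Bornology.IsBounded D) :
    ∃ C : ℝ, 0 < C ∧ ∀ v : H10 D, ‖v‖ ≤ C * normV v := by
  obtain ⟨R, hR0, hR⟩ : ∃ R : ℝ, 0 < R ∧ ∀ x ∈ D, ‖x‖ ≤ R := hD.exists_pos_norm_le
  have test : ∀ w ∈ testPairs D, ‖w.fst‖ ≤ 2 * R * ‖w.snd‖ := by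
    rintro w ⟨φ, h1, h2, h3, h4, h5⟩
    have hsup : ∀ x, φ x ≠ 0 → x ∈ D := fun x hx => h3 (subset_tsupport _ hx)
    have hP := integral_sq_le_of_support_subset_ball hd hR0.le h1 h2 fun x hx => hR x (hsup x hx)
    have e1 : ‖w.fst‖ ^ 2 = ∫ x, φ x ^ 2 := by
      have hset : ∫ x in D, φ x ^ 2 = ∫ x, φ x ^ 2 := by
        refine setIntegral_eq_integral_of_forall_compl_eq_zero fun x hx => ?_
        have : φ x = 0 := by by_contra h; exact hx (hsup x h)
        simp [this]
      rw [norm_sq_eq_integral, ← hset]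
      exact integral_congr_ae (h4.mono fun x hx => by simp only [hx]; simp)
    have e2 : ‖w.snd‖ ^ 2 = ∫ x, ‖gradient φ x‖ ^ 2 := by
      have hset : ∫ x in D, ‖gradient φ x‖ ^ 2 = ∫ x, ‖gradient φ x‖ ^ 2 := by
        refine setIntegral_eq_integral_of_forall_compl_eq_zero fun x hx => ?_
        have : x ∉ tsupport φ := fun h => hx (h3 h)
        have h0 : fderiv ℝ φ x = 0 := by
          by_contra h
          exact this (support_fderiv_subset ℝ (f := φ) h)
        simp [gradient, h0]
      rw [norm_sq_eq_integral, ← hset]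
      exact integral_congr_ae (h5.mono fun x hx => by simp only [hx])
    rw [← e1, ← e2] at hP
    refine abs_le_of_sq_le_sq' ?_ (by positivity) |>.2
    rw [mul_pow]; linarith
  have closed : ∀ w ∈ H10 D, ‖w.fst‖ ≤ 2 * R * ‖w.snd‖ := by
    intro w hw
    have hcl : IsClosed {w : H1Ambient D | ‖w.fst‖ ≤ 2 * R * ‖w.snd‖} := by
      refine isClosed_le ?_ ?_
      · exact ((WithLp.fstL 2 ℝ _ _).continuous).norm
      · exact continuous_const.mul ((WithLp.sndL 2 ℝ _ _).continuous).norm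
    have hsub : (Submodule.span ℝ (testPairs D) : Set (H1Ambient D)) ⊆
        {w : H1Ambient D | ‖w.fst‖ ≤ 2 * R * ‖w.snd‖} := by
      have : Submodule.span ℝ (testPairs D) ≤ testSubmodule D := Submodule.span_le.2 fun _ h => h
      exact fun w hw => test w (this hw)
    exact closure_minimal hsub hcl hw
  refine ⟨1 + 2 * R, by positivity, fun v => ?_⟩
  have h1 := closed v v.2
  have h2 : ‖v‖ ^ 2 = ‖(v : H1Ambient D).fst‖ ^ 2 + ‖(v : H1Ambient D).snd‖ ^ 2 :=
    WithLp.prod_norm_sq_eq_of_L2 _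
  refine abs_le_of_sq_le_sq' ?_ (by unfold normV; positivity) |>.2
  rw [h2]
  unfold normV grad
  have := norm_nonneg (v : H1Ambient D).snd
  have h3 := norm_nonneg (v : H1Ambient D).fst
  have h4 : ‖(v : H1Ambient D).fst‖ ^ 2 ≤ (2 * R * ‖(v : H1Ambient D).snd‖) ^ 2 := by gcongr
  nlinarith [mul_nonneg hR0.le (sq_nonneg ‖(v : H1Ambient D).snd‖)]

theorem normV_le_norm {D : Set (Space d)} (v : H10 D) : normV v ≤ ‖v‖ := by
  have h2 : ‖v‖ ^ 2 = ‖(v : H1Ambient D).fst‖ ^ 2 + ‖(v : H1Ambient D).snd‖ ^ 2 :=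
    WithLp.prod_norm_sq_eq_of_L2 _
  refine abs_le_of_sq_le_sq' ?_ (norm_nonneg _) |>.2
  rw [h2]; unfold normV grad
  nlinarith [sq_nonneg ‖(v : H1Ambient D).fst‖]

end Poincare

/-! ### Sums over finitely supported multi-indices. -/

section MultiIndex

theorem sum_finsupp_prod {R : Type*} [CommSemiring R] (S : Finset ℕ) (t : ℕ → Finset ℕ)
    (g : ℕ → ℕ → R) (hg : ∀ j, g j 0 = 1) :
    ∑ α ∈ S.finsupp t, α.prod g = ∏ j ∈ S, ∑ k ∈ t j, g j k := by
  classical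
  rw [Finset.prod_sum, Finset.finsupp, Finset.sum_map]
  refine Finset.sum_congr (by congr!) fun p _ => ?_
  change (Finsupp.indicator S p).prod g = _
  rw [Finsupp.prod_of_support_subset _ (s := S) (Finsupp.support_indicator_subset _ _) _ (fun j _ => hg j),
    ← Finset.prod_attach]
  refine Finset.prod_congr rfl fun j _ => ?_
  simp

theorem subset_finsupp_range (T : Finset (ℕ →₀ ℕ)) :
    ∃ N : ℕ, T ⊆ (Finset.range N).finsupp fun _ => Finset.range N := by
  -- This number exceeds every index in a support and every entry of every member of `T`.
  refine ⟨T.sum (fun α => α.support.sup id + α.sum (fun _ k => k) + 1), fun α hα => ?_⟩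
  have h1 : α.support.sup id + α.sum (fun _ k => k) + 1 ≤
      T.sum (fun α => α.support.sup id + α.sum (fun _ k => k) + 1) :=
    Finset.single_le_sum (f := fun α : ℕ →₀ ℕ => α.support.sup id + α.sum (fun _ k => k) + 1)
      (fun _ _ => Nat.zero_le _) hα
  rw [Finset.mem_finsupp_iff]
  constructor
  · intro j hj
    have : j ≤ α.support.sup id := Finset.le_sup (f := id) hj
    rw [Finset.mem_range]; omega
  · intro j hj
    rw [Finset.mem_range]
    by_cases h0 : j ∈ α.support
    · have : α j ≤ α.sum (fun _ k => k) :=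
        Finset.single_le_sum (f := fun j => α j) (fun _ _ => Nat.zero_le _) h0
      omega
    · rw [Finsupp.notMem_support_iff.1 h0]; omega

/-- Sums of products over finitely supported multi-indices are bounded by the product of sums. -/
theorem sum_prod_le_of_sum_range_le (T : Finset (ℕ →₀ ℕ)) (g : ℕ → ℕ → ℝ) (hg : ∀ j, g j 0 = 1)
    (hg0 : ∀ j k, 0 ≤ g j k) (s : ℕ → ℝ) {K : ℝ}
    (hs : ∀ j N, ∑ k ∈ Finset.range N, g j k ≤ Real.exp (s j))
    (hK : ∀ N, ∑ j ∈ Finset.range N, s j ≤ K) :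
    ∑ α ∈ T, α.prod g ≤ Real.exp K := by
  obtain ⟨N, hN⟩ := subset_finsupp_range T
  calc ∑ α ∈ T, α.prod g ≤ ∑ α ∈ (Finset.range N).finsupp fun _ => Finset.range N, α.prod g :=
        Finset.sum_le_sum_of_subset_of_nonneg hN
          fun α _ _ => Finset.prod_nonneg fun j _ => hg0 _ _
    _ = ∏ j ∈ Finset.range N, ∑ k ∈ Finset.range N, g j k := sum_finsupp_prod _ _ _ hg
    _ ≤ ∏ j ∈ Finset.range N, Real.exp (s j) :=
        Finset.prod_le_prod (fun j _ => Finset.sum_nonneg fun k _ => hg0 _ _) fun j _ => hs j N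
    _ = Real.exp (∑ j ∈ Finset.range N, s j) := (Real.exp_sum _ _).symm
    _ ≤ Real.exp K := Real.exp_le_exp.2 (hK N)

/-- The divided power `c^α / α!`. -/
def dividedPow (c : ℕ → ℝ) (α : ℕ →₀ ℕ) : ℝ := α.prod fun j k => c j ^ k / k.factorial

theorem dividedPow_zero (c : ℕ → ℝ) : dividedPow c 0 = 1 := Finsupp.prod_zero_index

/-- Isolates the factor of coordinate `j` with a common cofactor `P`, so that recursions for powers
and factorials of multi-indices reduce to one coordinate. -/
theorem prod_add_single_eq {R : Type*} [CommMonoid R] (g : ℕ → ℕ → R) (hg : ∀ j, g j 0 = 1)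
    (α : ℕ →₀ ℕ) (j : ℕ) :
    ∃ P : R, α.prod g = g j (α j) * P ∧ (α + Finsupp.single j 1).prod g = g j (α j + 1) * P := by
  classical
  refine ⟨∏ i ∈ (insert j α.support).erase j, g i (α i), ?_, ?_⟩
  · rw [Finsupp.prod_of_support_subset α (Finset.subset_insert j α.support) g fun i _ => hg i,
      Finset.mul_prod_erase _ (fun i => g i (α i)) (Finset.mem_insert_self _ _)]
  · rw [Finsupp.prod_of_support_subset (s := insert j α.support) _ _ g fun i _ => hg i,
      ← Finset.mul_prod_erase _ _ (Finset.mem_insert_self j _)]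
    · congr 1
      · simp
      · refine Finset.prod_congr rfl fun i hi => ?_
        have : i ≠ j := Finset.ne_of_mem_erase hi
        simp [this.symm]
    · refine Finsupp.support_add.trans ?_
      intro i hi
      rcases Finset.mem_union.1 hi with h | h
      · exact Finset.mem_insert_of_mem h
      · have := Finsupp.support_single_subset h
        rw [Finset.mem_singleton.1 this]; exact Finset.mem_insert_self _ _

theorem dividedPow_add_single (c : ℕ → ℝ) (α : ℕ →₀ ℕ) (j : ℕ) :
    ((α j : ℝ) + 1) * dividedPow c (α + Finsupp.single j 1) = c j * dividedPow c α := by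
  obtain ⟨P, h1, h2⟩ := prod_add_single_eq (fun j k => c j ^ k / (k.factorial : ℝ)) (by simp) α j
  unfold dividedPow
  rw [h1, h2, Nat.factorial_succ]
  push_cast
  have := Nat.factorial_ne_zero (α j)
  field_simp
  ring

theorem abs_dividedPow (c : ℕ → ℝ) (α : ℕ →₀ ℕ) : |dividedPow c α| = dividedPow (fun j => |c j|) α := by
  unfold dividedPow Finsupp.prod
  rw [Finset.abs_prod]
  refine Finset.prod_congr rfl fun j _ => ?_
  rw [abs_div, abs_pow, Nat.abs_cast]

theorem sum_abs_dividedPow_le (c : ℕ → ℝ) {K : ℝ} (hK : ∀ N, ∑ j ∈ Finset.range N, |c j| ≤ K)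
    (T : Finset (ℕ →₀ ℕ)) : ∑ α ∈ T, |dividedPow c α| ≤ Real.exp K := by
  simp only [abs_dividedPow]
  exact sum_prod_le_of_sum_range_le T (fun j k => |c j| ^ k / k.factorial) (by simp)
    (fun j k => by positivity) (fun j => |c j|)
    (fun j N => Real.sum_le_exp_of_nonneg (abs_nonneg _) N) hK

/-- Dropping the index `0` removes exactly `1` from the exponential bound; `e^K - 1` is the
off-diagonal mass in the Schur test. -/
theorem sum_abs_dividedPow_erase_le (c : ℕ → ℝ) {K : ℝ}
    (hK : ∀ N, ∑ j ∈ Finset.range N, |c j| ≤ K) (T : Finset (ℕ →₀ ℕ)) (hT : 0 ∉ T) :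
    ∑ α ∈ T, |dividedPow c α| ≤ Real.exp K - 1 := by
  have := sum_abs_dividedPow_le c hK (insert 0 T)
  rw [Finset.sum_insert hT, dividedPow_zero, abs_one] at this
  linarith

/-- The Leibniz rule for the number operator in the coordinate `j`. -/
theorem sum_antidiagonal_add_single {M : Type*} [AddCommGroup M] [Module ℝ M]
    (f : (ℕ →₀ ℕ) → (ℕ →₀ ℕ) → M) (μ : ℕ →₀ ℕ) (j : ℕ) :
    ((μ j : ℝ) + 1) • ∑ p ∈ (Finset.HasAntidiagonal.antidiagonal (μ + Finsupp.single j 1) :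
        Finset ((ℕ →₀ ℕ) × (ℕ →₀ ℕ))), f p.1 p.2 =
      ∑ p ∈ Finset.HasAntidiagonal.antidiagonal μ, ((((p.1 j : ℕ) : ℝ) + 1) • f (p.1 + Finsupp.single j 1) p.2 +
        (((p.2 j : ℕ) : ℝ) + 1) • f p.1 (p.2 + Finsupp.single j 1)) := by
  classical
  have left : ∀ f : (ℕ →₀ ℕ) → (ℕ →₀ ℕ) → M,
      ∑ p ∈ (Finset.HasAntidiagonal.antidiagonal (μ + Finsupp.single j 1) :
        Finset ((ℕ →₀ ℕ) × (ℕ →₀ ℕ))), ((p.1 j : ℕ) : ℝ) • f p.1 p.2 =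
      ∑ p ∈ Finset.HasAntidiagonal.antidiagonal μ, (((p.1 j : ℕ) : ℝ) + 1) • f (p.1 + Finsupp.single j 1) p.2 := by
    intro f
    symm
    -- Pairs whose first entry vanishes at `j` are not in the image of the shift, but the factor
    -- `p.1 j` kills them.
    refine Finset.sum_bij_ne_zero (fun p _ _ => (p.1 + Finsupp.single j 1, p.2)) ?_ ?_ ?_ ?_
    · intro p hp _
      rw [Finset.HasAntidiagonal.mem_antidiagonal] at hp ⊢
      rw [← hp]; simp only; abel
    · rintro ⟨a, b⟩ _ _ ⟨a', b'⟩ _ _ h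
      simp only [Prod.mk.injEq, add_left_inj] at h
      exact Prod.ext h.1 h.2
    · rintro ⟨a, b⟩ hp h0
      have ha : a j ≠ 0 := fun h => h0 (by simp [h])
      have hle : Finsupp.single j 1 ≤ a := by
        rw [Finsupp.single_le_iff]; omega
      have hs : a - Finsupp.single j 1 + Finsupp.single j 1 = a := tsub_add_cancel_of_le hle
      refine ⟨(a - Finsupp.single j 1, b), ?_, ?_, ?_⟩
      · rw [Finset.HasAntidiagonal.mem_antidiagonal] at hp ⊢
        simp only at hp ⊢
        have : a - Finsupp.single j 1 + b + Finsupp.single j 1 = μ + Finsupp.single j 1 := by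
          rw [← hp, add_right_comm, hs]
        exact add_right_cancel this
      · intro h
        apply h0
        simp only [hs] at h ⊢
        rw [show ((a j : ℕ) : ℝ) = (((a - Finsupp.single j 1 : ℕ →₀ ℕ) j : ℕ) : ℝ) + 1 by
          conv_lhs => rw [← hs]
          simp]
        exact h
      · simp only [hs]
    · intro p _ _
      simp
  have right : ∑ p ∈ (Finset.HasAntidiagonal.antidiagonal (μ + Finsupp.single j 1) :
        Finset ((ℕ →₀ ℕ) × (ℕ →₀ ℕ))), ((p.2 j : ℕ) : ℝ) • f p.1 p.2 =
      ∑ p ∈ Finset.HasAntidiagonal.antidiagonal μ, (((p.2 j : ℕ) : ℝ) + 1) • f p.1 (p.2 + Finsupp.single j 1) := by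
    rw [← Finset.HasAntidiagonal.map_swap_antidiagonal, Finset.sum_map, ← Finset.HasAntidiagonal.map_swap_antidiagonal (n := μ),
      Finset.sum_map]
    exact left fun a b => f b a
  -- The prefactor splits as `μ_j + 1 = p.1 j + p.2 j` on the antidiagonal.
  rw [Finset.sum_add_distrib, ← left, ← right, ← Finset.sum_add_distrib, Finset.smul_sum]
  refine Finset.sum_congr rfl fun p hp => ?_
  rw [← add_smul]
  congr 1
  rw [Finset.HasAntidiagonal.mem_antidiagonal] at hp
  have := DFunLike.congr_fun hp j
  simp at this
  exact_mod_cast this.symm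

end MultiIndex

/-! ### The triangular system for the Taylor coefficients. -/

section Recursion

theorem lt_of_mem_filter_antidiagonal {μ : ℕ →₀ ℕ} {p : (ℕ →₀ ℕ) × (ℕ →₀ ℕ)}
    (hp : p ∈ (Finset.HasAntidiagonal.antidiagonal μ).filter fun p => p.1 ≠ 0) : p.2 < μ := by
  have h := Finset.mem_filter.1 hp
  rw [← Finset.HasAntidiagonal.mem_antidiagonal.1 h.1]
  exact lt_add_of_pos_left _ (pos_iff_ne_zero.2 h.2)

variable {X V : Type*} [NormedAddCommGroup V] [NormedSpace ℝ V]

/-- The solution `(t_μ)` of the triangular system `∑_{α + ν = μ} A_α(b) t_ν = δ_{μ,0} F`. -/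
def taylorCoeff (A : (ℕ →₀ ℕ) → X → V →L[ℝ] V) (F : V) (μ : ℕ →₀ ℕ) (b : X) : V :=
  Ring.inverse (A 0 b) ((if μ = 0 then F else 0) -
    ∑ p ∈ ((Finset.HasAntidiagonal.antidiagonal μ).filter fun p => p.1 ≠ 0).attach,
      A p.1.1 b (taylorCoeff A F p.1.2 b))
termination_by μ
decreasing_by exact lt_of_mem_filter_antidiagonal p.2

variable {A : (ℕ →₀ ℕ) → X → V →L[ℝ] V} {F : V}

theorem taylorCoeff_eq (μ : ℕ →₀ ℕ) (b : X) :
    taylorCoeff A F μ b = Ring.inverse (A 0 b) ((if μ = 0 then F else 0) -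
      ∑ p ∈ (Finset.HasAntidiagonal.antidiagonal μ).filter fun p => p.1 ≠ 0, A p.1 b (taylorCoeff A F p.2 b)) := by
  conv_lhs => rw [taylorCoeff.eq_def]
  rw [Finset.sum_attach _ (fun p : (ℕ →₀ ℕ) × (ℕ →₀ ℕ) => A p.1 b (taylorCoeff A F p.2 b))]

theorem sum_antidiagonal_eq_add_filter {M : Type*} [AddCommMonoid M] (μ : ℕ →₀ ℕ)
    (f : (ℕ →₀ ℕ) × (ℕ →₀ ℕ) → M) :
    ∑ p ∈ Finset.HasAntidiagonal.antidiagonal μ, f p =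
      f (0, μ) + ∑ p ∈ (Finset.HasAntidiagonal.antidiagonal μ).filter fun p => p.1 ≠ 0, f p := by
  rw [← Finset.sum_filter_add_sum_filter_not _ (fun p : (ℕ →₀ ℕ) × (ℕ →₀ ℕ) => p.1 = 0)]
  congr 1
  rw [Finset.sum_eq_single (0, μ)]
  · rintro ⟨a, c⟩ hb h
    simp only [Finset.mem_filter, Finset.HasAntidiagonal.mem_antidiagonal] at hb
    obtain ⟨h1, rfl⟩ := hb
    simp at h1; simp [h1] at h
  · intro h; simp at h

theorem sum_taylorCoeff {b : X} (hU : IsUnit (A 0 b)) (μ : ℕ →₀ ℕ) :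
    ∑ p ∈ Finset.HasAntidiagonal.antidiagonal μ, A p.1 b (taylorCoeff A F p.2 b) = if μ = 0 then F else 0 := by
  rw [sum_antidiagonal_eq_add_filter]
  simp only
  rw [taylorCoeff_eq (μ := μ), ← mul_apply_eq_comp,
    Ring.mul_inverse_cancel _ hU]
  simp

variable [NormedAddCommGroup X] [NormedSpace ℝ X]

theorem differentiable_taylorCoeff [CompleteSpace V] (hA : ∀ α, Differentiable ℝ (A α))
    (hU : ∀ b, IsUnit (A 0 b)) (μ : ℕ →₀ ℕ) : Differentiable ℝ (taylorCoeff A F μ) := by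
  induction μ using WellFoundedLT.induction with
  | ind μ ih =>
    have h : taylorCoeff A F μ = fun b => Ring.inverse (A 0 b) ((if μ = 0 then F else 0) -
      ∑ p ∈ (Finset.HasAntidiagonal.antidiagonal μ).filter fun p => p.1 ≠ 0, A p.1 b (taylorCoeff A F p.2 b)) :=
      funext fun b => taylorCoeff_eq μ b
    rw [h]
    have hinv : Differentiable ℝ fun b => Ring.inverse (A 0 b) := fun b => by
      obtain ⟨u, hu⟩ := hU b
      have h1 : DifferentiableAt ℝ (Ring.inverse : (V →L[ℝ] V) → _) (A 0 b) := by
        rw [← hu]; exact differentiableAt_inverse u.isUnit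
      exact h1.comp b (hA 0 b)
    refine hinv.clm_apply ((differentiable_const _).sub ?_)
    refine Differentiable.fun_sum fun p hp => ?_
    exact (hA _).clm_apply (ih p.2 (lt_of_mem_filter_antidiagonal hp))

/-- Implicit differentiation: the derivative of the system for `μ` in the direction `h` is compared
with `μ_j + 1` times the system for `μ + e_j`, expanded by the Leibniz rule. By induction on `μ` all
terms agree except those where `A 0 b` acts on the two candidates, and `A 0 b` is injective. -/
theorem hasDerivAt_taylorCoeff [CompleteSpace V] (hA : ∀ α, Differentiable ℝ (A α))
    (hU : ∀ b, IsUnit (A 0 b)) {h : X} {j : ℕ}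
    (hdir : ∀ α b, HasDerivAt (fun s : ℝ => A α (b + s • h))
      (((α j : ℝ) + 1) • A (α + Finsupp.single j 1) b) 0) (μ : ℕ →₀ ℕ) (b : X) :
    HasDerivAt (fun s : ℝ => taylorCoeff A F μ (b + s • h))
      (((μ j : ℝ) + 1) • taylorCoeff A F (μ + Finsupp.single j 1) b) 0 := by
  have hd : ∀ ν, HasDerivAt (fun s : ℝ => taylorCoeff A F ν (b + s • h))
      (fderiv ℝ (taylorCoeff A F ν) b h) 0 := fun ν => by
    have h1 := (differentiable_taylorCoeff (F := F) hA hU ν b).hasFDerivAt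
    have h2 : HasDerivAt (fun s : ℝ => b + s • h) h 0 := by
      simpa using ((hasDerivAt_id (0 : ℝ)).smul_const h).const_add b
    have h3 : HasFDerivAt (taylorCoeff A F ν) (fderiv ℝ (taylorCoeff A F ν) b)
        ((fun s : ℝ => b + s • h) 0) := by simpa using h1
    exact h3.comp_hasDerivAt (0 : ℝ) h2
  suffices H : ∀ μ, fderiv ℝ (taylorCoeff A F μ) b h =
      ((μ j : ℝ) + 1) • taylorCoeff A F (μ + Finsupp.single j 1) b by
    rw [← H]; exact hd μ
  intro μ
  induction μ using WellFoundedLT.induction with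
  | ind μ ih =>
    have e1 : ∑ p ∈ Finset.HasAntidiagonal.antidiagonal μ,
        ((((p.1 j : ℕ) : ℝ) + 1) • A (p.1 + Finsupp.single j 1) b (taylorCoeff A F p.2 b) +
          A p.1 b (fderiv ℝ (taylorCoeff A F p.2) b h)) = 0 := by
      have h1 : HasDerivAt (fun s : ℝ => ∑ p ∈ Finset.HasAntidiagonal.antidiagonal μ,
          A p.1 (b + s • h) (taylorCoeff A F p.2 (b + s • h))) (∑ p ∈ Finset.HasAntidiagonal.antidiagonal μ,
        ((((p.1 j : ℕ) : ℝ) + 1) • A (p.1 + Finsupp.single j 1) b (taylorCoeff A F p.2 b) +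
          A p.1 b (fderiv ℝ (taylorCoeff A F p.2) b h))) 0 := by
        refine HasDerivAt.fun_sum fun p _ => ?_
        simpa using (hdir p.1 b).clm_apply (hd p.2)
      have h2 : HasDerivAt (fun s : ℝ => ∑ p ∈ Finset.HasAntidiagonal.antidiagonal μ,
          A p.1 (b + s • h) (taylorCoeff A F p.2 (b + s • h))) 0 0 := by
        -- The right-hand side of the system does not depend on `b`.
        simp only [sum_taylorCoeff (hU _)]
        exact hasDerivAt_const _ _
      exact h1.unique h2
    have e2 := sum_antidiagonal_add_single (fun α ν => A α b (taylorCoeff A F ν b)) μ j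
    rw [sum_taylorCoeff (hU b), if_neg (by simp), smul_zero] at e2
    rw [sum_antidiagonal_eq_add_filter] at e1 e2
    have e3 : ∀ p ∈ (Finset.HasAntidiagonal.antidiagonal μ).filter fun p => p.1 ≠ 0,
        ((((p.1 j : ℕ) : ℝ) + 1) • A (p.1 + Finsupp.single j 1) b (taylorCoeff A F p.2 b) +
          A p.1 b (fderiv ℝ (taylorCoeff A F p.2) b h)) =
        ((((p.1 j : ℕ) : ℝ) + 1) • A (p.1 + Finsupp.single j 1) b (taylorCoeff A F p.2 b) +
          (((p.2 j : ℕ) : ℝ) + 1) • A p.1 b (taylorCoeff A F (p.2 + Finsupp.single j 1) b)) := by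
      intro p hp
      rw [ih p.2 (lt_of_mem_filter_antidiagonal hp), map_smul]
    rw [Finset.sum_congr rfl e3, e2] at e1
    have e4 := add_right_cancel e1
    have e5 := add_left_cancel e4
    rw [← map_smul] at e5
    obtain ⟨u, hu⟩ := hU b
    have inj : Function.Injective (A 0 b) := by
      rw [← hu]
      intro x y hxy
      have := congrArg (fun z => (↑u⁻¹ : V →L[ℝ] V) z) hxy
      simpa [← mul_apply_eq_comp] using this
    exact inj e5

end Recursion

/-! ### Schur test for the convolution form on multi-indices. -/

section Schur

open Finset.HasAntidiagonal

/-- Each off-diagonal term is at least `-|k α| (‖z ν‖² + ‖z μ‖²)/2`. For fixed `μ`, and likewise for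
fixed `ν`, the index `α` determines the pair, so both halves sum to at most `κ ∑ ‖z μ‖²`. Downward
closedness keeps every `ν` inside `Λ`. -/
theorem schur_lower_bound {E : Type*} [NormedAddCommGroup E] [InnerProductSpace ℝ E]
    (Λ : Finset (ℕ →₀ ℕ)) (hΛ : ∀ μ ∈ Λ, ∀ ν ≤ μ, ν ∈ Λ) (z : (ℕ →₀ ℕ) → E)
    (k : (ℕ →₀ ℕ) → ℝ) (hk : k 0 = 1) {κ : ℝ}
    (hκ : ∀ T : Finset (ℕ →₀ ℕ), 0 ∉ T → ∑ α ∈ T, |k α| ≤ κ) :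
    (1 - κ) * ∑ μ ∈ Λ, ‖z μ‖ ^ 2 ≤
      ∑ μ ∈ Λ, ∑ p ∈ antidiagonal μ, k p.1 * inner ℝ (z p.2) (z μ) := by
  classical
  let s : (ℕ →₀ ℕ) → Finset ((ℕ →₀ ℕ) × (ℕ →₀ ℕ)) := fun μ =>
    (antidiagonal μ).filter fun p => p.1 ≠ 0
  have hs : ∀ μ, ∀ p ∈ s μ, p.1 + p.2 = μ ∧ p.1 ≠ 0 := fun μ p hp => by
    have := Finset.mem_filter.1 hp
    exact ⟨mem_antidiagonal.1 this.1, this.2⟩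
  have h1 : ∀ μ, ‖z μ‖ ^ 2 - (∑ p ∈ s μ, |k p.1| * ‖z p.2‖ ^ 2 + κ * ‖z μ‖ ^ 2) / 2 ≤
      ∑ p ∈ antidiagonal μ, k p.1 * inner ℝ (z p.2) (z μ) := by
    intro μ
    rw [sum_antidiagonal_eq_add_filter, hk, one_mul, real_inner_self_eq_norm_sq]
    have hsum : ∑ p ∈ s μ, |k p.1| ≤ κ := by
      have hinj : Set.InjOn (Prod.fst : (ℕ →₀ ℕ) × (ℕ →₀ ℕ) → _) (s μ) := by
        rintro ⟨a, b⟩ hp ⟨a', b'⟩ hq (rfl : a = a')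
        have e1 := (hs μ _ hp).1
        have e2 := (hs μ _ hq).1
        simp only at e1 e2
        rw [← e2] at e1
        rw [add_left_cancel e1]
      rw [← Finset.sum_image (f := fun a => |k a|) hinj]
      refine hκ _ fun h => ?_
      obtain ⟨p, hp, h0⟩ := Finset.mem_image.1 h
      exact (hs μ p hp).2 h0
    have hpt : ∀ p ∈ s μ, -(|k p.1| * ‖z p.2‖ ^ 2 + |k p.1| * ‖z μ‖ ^ 2) / 2 ≤
        k p.1 * inner ℝ (z p.2) (z μ) := by
      intro p _
      have e1 : |k p.1 * inner ℝ (z p.2) (z μ)| ≤ |k p.1| * (‖z p.2‖ * ‖z μ‖) := by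
        rw [abs_mul]
        exact mul_le_mul_of_nonneg_left (abs_real_inner_le_norm _ _) (abs_nonneg _)
      have e2 := neg_abs_le (k p.1 * inner ℝ (z p.2) (z μ))
      nlinarith [mul_nonneg (abs_nonneg (k p.1)) (sq_nonneg (‖z p.2‖ - ‖z μ‖))]
    have := Finset.sum_le_sum hpt
    rw [← Finset.sum_div, Finset.sum_neg_distrib, Finset.sum_add_distrib, ← Finset.sum_mul] at this
    have e3 := mul_le_mul_of_nonneg_right hsum (sq_nonneg ‖z μ‖)
    change _ ≤ ‖z μ‖ ^ 2 + ∑ p ∈ s μ, _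
    linarith
  have h2 : ∑ μ ∈ Λ, ∑ p ∈ s μ, |k p.1| * ‖z p.2‖ ^ 2 ≤ κ * ∑ μ ∈ Λ, ‖z μ‖ ^ 2 := by
    rw [← Finset.sum_biUnion]
    · let T := (Λ.biUnion s).image Prod.fst
      have hT : 0 ∉ T := fun h => by
        obtain ⟨p, hp, h0⟩ := Finset.mem_image.1 h
        obtain ⟨μ, _, hμ⟩ := Finset.mem_biUnion.1 hp
        exact (hs μ p hμ).2 h0
      -- The antidiagonals are disjoint, so their union embeds in a product set on which the double
      -- sum factorizes.
      have hsub : Λ.biUnion s ⊆ T ×ˢ Λ := by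
        intro p hp
        refine Finset.mem_product.2 ⟨Finset.mem_image_of_mem _ hp, ?_⟩
        obtain ⟨μ, hμ, hpμ⟩ := Finset.mem_biUnion.1 hp
        exact hΛ μ hμ _ (by rw [← (hs μ p hpμ).1]; exact le_add_self)
      refine (Finset.sum_le_sum_of_subset_of_nonneg hsub fun p _ _ => by positivity).trans ?_
      rw [Finset.sum_product]
      simp only
      rw [← Finset.sum_mul_sum]
      exact mul_le_mul_of_nonneg_right (hκ T hT) (Finset.sum_nonneg fun _ _ => sq_nonneg _)
    · intro μ _ μ' _ hne
      refine Finset.disjoint_left.2 fun p hp hp' => hne ?_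
      rw [← (hs μ p hp).1, ← (hs μ' p hp').1]
  have := Finset.sum_le_sum fun μ (_ : μ ∈ Λ) => h1 μ
  rw [Finset.sum_sub_distrib, ← Finset.sum_div, Finset.sum_add_distrib, ← Finset.mul_sum] at this
  linarith

end Schur

/-! ### Exponential and monomial coefficients in `L^∞`. -/

section LInfty

variable {α : Type*} [MeasurableSpace α] {m : Measure α}

theorem ae_abs_le_norm (f : Lp ℝ ∞ m) : ∀ᵐ x ∂m, |f x| ≤ ‖f‖ := by
  have h := ae_le_eLpNormEssSup (f := f) (μ := m)
  filter_upwards [h] with x hx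
  have h2 : eLpNormEssSup f m ≠ ⊤ := by
    have := Lp.eLpNorm_ne_top f
    rwa [eLpNorm_exponent_top] at this
  rw [Lp.norm_def, eLpNorm_exponent_top, ← Real.norm_eq_abs, ← toReal_enorm]
  exact ENNReal.toReal_mono h2 hx

theorem norm_le_of_ae_abs_le {f : Lp ℝ ∞ m} {C : ℝ} (hC : 0 ≤ C) (h : ∀ᵐ x ∂m, |f x| ≤ C) :
    ‖f‖ ≤ C := by
  rw [Lp.norm_def, eLpNorm_exponent_top]
  refine ENNReal.toReal_le_of_le_ofReal hC (eLpNormEssSup_le_of_ae_bound (h.mono fun x hx => ?_))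
  rwa [Real.norm_eq_abs]

theorem memLp_top_of_ae_abs_le {f : α → ℝ} (hf : AEStronglyMeasurable f m) {C : ℝ}
    (h : ∀ᵐ x ∂m, |f x| ≤ C) : MemLp f ∞ m :=
  memLp_top_of_bound hf C (h.mono fun x hx => by rwa [Real.norm_eq_abs])

/-- Multiplication in `L^∞`. -/
def mulInf : Lp ℝ ∞ m →L[ℝ] Lp ℝ ∞ m →L[ℝ] Lp ℝ ∞ m :=
  (ContinuousLinearMap.mul ℝ ℝ).holderL m ∞ ∞ ∞

theorem coeFn_mulInf (f g : Lp ℝ ∞ m) : mulInf f g =ᵐ[m] fun x => f x * g x :=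
  (ContinuousLinearMap.mul ℝ ℝ).coeFn_holder f g

theorem memLp_exp (b : Lp ℝ ∞ m) : MemLp (fun x => Real.exp (b x)) ∞ m :=
  memLp_top_of_ae_abs_le (C := Real.exp ‖b‖)
    (Real.continuous_exp.comp_aestronglyMeasurable (Lp.aestronglyMeasurable b)) <|
    (ae_abs_le_norm b).mono fun x hx => by
      rw [Real.abs_exp]; exact Real.exp_le_exp.2 ((le_abs_self _).trans hx)

/-- The exponential in `L^∞`. -/
def expInf (b : Lp ℝ ∞ m) : Lp ℝ ∞ m := (memLp_exp b).toLp _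

theorem coeFn_expInf (b : Lp ℝ ∞ m) : expInf b =ᵐ[m] fun x => Real.exp (b x) :=
  (memLp_exp b).coeFn_toLp

/-- The pointwise bound `|e^h - 1 - h| ≤ h²` for `|h| ≤ 1` makes the remainder `O(‖h‖²)` in `L^∞`.
-/
theorem hasFDerivAt_expInf (b : Lp ℝ ∞ m) :
    HasFDerivAt (expInf : Lp ℝ ∞ m → Lp ℝ ∞ m) (mulInf (expInf b)) b := by
  rw [hasFDerivAt_iff_isLittleO_nhds_zero]
  have hO : (fun h : Lp ℝ ∞ m => expInf (b + h) - expInf b - mulInf (expInf b) h) =O[𝓝 0]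
      fun h => ‖h‖ ^ 2 := by
    refine Asymptotics.IsBigO.of_bound (Real.exp ‖b‖) ?_
    have hball : Metric.ball (0 : Lp ℝ ∞ m) 1 ∈ 𝓝 0 := Metric.ball_mem_nhds _ one_pos
    filter_upwards [hball] with h hh
    have hh1 : ‖h‖ ≤ 1 := by simpa using (mem_ball_zero_iff.1 hh).le
    rw [norm_pow, norm_norm]
    refine norm_le_of_ae_abs_le (by positivity) ?_
    filter_upwards [Lp.coeFn_sub (expInf (b + h) - expInf b) (mulInf (expInf b) h),
      Lp.coeFn_sub (expInf (b + h)) (expInf b), coeFn_expInf (b + h), coeFn_expInf b,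
      coeFn_mulInf (expInf b) h, Lp.coeFn_add b h, ae_abs_le_norm b, ae_abs_le_norm h]
      with x e1 e2 e3 e4 e5 e6 e7 e8
    rw [e1, Pi.sub_apply, e2, Pi.sub_apply, e3, e4, e5, e4, e6, Pi.add_apply, Real.exp_add]
    have h1 := Real.abs_exp_sub_one_sub_id_le (e8.trans hh1)
    have : Real.exp (b x) * Real.exp (h x) - Real.exp (b x) - Real.exp (b x) * h x =
      Real.exp (b x) * (Real.exp (h x) - 1 - h x) := by ring
    rw [this, abs_mul, Real.abs_exp]
    refine mul_le_mul (Real.exp_le_exp.2 ((le_abs_self _).trans e7)) (h1.trans ?_) (abs_nonneg _)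
      (Real.exp_pos _).le
    rw [← sq_abs]; gcongr
  exact hO.trans_isLittleO (Asymptotics.isLittleO_norm_pow_id one_lt_two)

theorem memLp_dividedPow (ψ : ℕ → Lp ℝ ∞ m) (β : ℕ →₀ ℕ) :
    MemLp (fun x => dividedPow (fun j => ψ j x) β) ∞ m := by
  refine memLp_top_of_ae_abs_le (C := dividedPow (fun j => ‖ψ j‖) β) ?_ ?_
  · unfold dividedPow Finsupp.prod
    refine Finset.aestronglyMeasurable_fun_prod _ fun j _ => ?_
    exact ((Lp.aestronglyMeasurable (ψ j)).pow _).mul aestronglyMeasurable_const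
  · filter_upwards [ae_all_iff.2 fun j => ae_abs_le_norm (ψ j)] with x hx
    rw [abs_dividedPow]
    refine Finset.prod_le_prod (fun j _ => by positivity) fun j _ => ?_
    have := hx j
    simp only
    gcongr

/-- The divided power `ψ^β / β!` in `L^∞`. -/
def powInf (ψ : ℕ → Lp ℝ ∞ m) (β : ℕ →₀ ℕ) : Lp ℝ ∞ m := (memLp_dividedPow ψ β).toLp _

theorem coeFn_powInf (ψ : ℕ → Lp ℝ ∞ m) (β : ℕ →₀ ℕ) :
    powInf ψ β =ᵐ[m] fun x => dividedPow (fun j => ψ j x) β :=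
  (memLp_dividedPow ψ β).coeFn_toLp

/-- The coefficient `exp(b) ψ^β / β!` in `L^∞`. -/
def coeffInf (ψ : ℕ → Lp ℝ ∞ m) (β : ℕ →₀ ℕ) (b : Lp ℝ ∞ m) : Lp ℝ ∞ m :=
  mulInf (expInf b) (powInf ψ β)

theorem coeFn_coeffInf (ψ : ℕ → Lp ℝ ∞ m) (β : ℕ →₀ ℕ) (b : Lp ℝ ∞ m) :
    coeffInf ψ β b =ᵐ[m] fun x => Real.exp (b x) * dividedPow (fun j => ψ j x) β := by
  filter_upwards [coeFn_mulInf (expInf b) (powInf ψ β), coeFn_expInf b, coeFn_powInf ψ β]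
    with x h1 h2 h3
  rw [coeffInf, h1, h2, h3]

theorem differentiable_coeffInf (ψ : ℕ → Lp ℝ ∞ m) (β : ℕ →₀ ℕ) :
    Differentiable ℝ (coeffInf ψ β) := fun b =>
  (((mulInf (m := m)).hasFDerivAt.comp b (hasFDerivAt_expInf b)).clm_apply
    (hasFDerivAt_const (powInf ψ β) b)).differentiableAt

/-- Differentiating `e^b` along `ψ_j` produces one more factor `ψ_j`, and `ψ_j ψ^β/β! = (β_j + 1)
ψ^(β+e_j)/(β+e_j)!`. This is the directional hypothesis of `hasDerivAt_taylorCoeff`. -/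
theorem hasDerivAt_coeffInf (ψ : ℕ → Lp ℝ ∞ m) (β : ℕ →₀ ℕ) (b : Lp ℝ ∞ m) (j : ℕ) :
    HasDerivAt (fun s : ℝ => coeffInf ψ β (b + s • ψ j))
      (((β j : ℝ) + 1) • coeffInf ψ (β + Finsupp.single j 1) b) 0 := by
  have h2 : HasDerivAt (fun s : ℝ => b + s • ψ j) (ψ j) 0 := by
    simpa using ((hasDerivAt_id (0 : ℝ)).smul_const (ψ j)).const_add b
  have h3 : HasFDerivAt (expInf : Lp ℝ ∞ m → Lp ℝ ∞ m) (mulInf (expInf b))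
      ((fun s : ℝ => b + s • ψ j) 0) := by simpa using hasFDerivAt_expInf b
  have h4 := h3.comp_hasDerivAt (0 : ℝ) h2
  have h5 := ((mulInf (m := m)).hasFDerivAt.comp_hasDerivAt (0 : ℝ) h4).clm_apply
    (hasDerivAt_const (0 : ℝ) (powInf ψ β))
  have e : mulInf (mulInf (expInf b) (ψ j)) (powInf ψ β) =
      ((β j : ℝ) + 1) • coeffInf ψ (β + Finsupp.single j 1) b := by
    refine Lp.ext ?_
    filter_upwards [coeFn_mulInf (mulInf (expInf b) (ψ j)) (powInf ψ β),
      coeFn_mulInf (expInf b) (ψ j), coeFn_expInf b, coeFn_powInf ψ β,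
      Lp.coeFn_smul ((β j : ℝ) + 1) (coeffInf ψ (β + Finsupp.single j 1) b),
      coeFn_coeffInf ψ (β + Finsupp.single j 1) b] with x e1 e2 e3 e4 e5 e6
    rw [e1, e2, e3, e4, e5, Pi.smul_apply, e6, smul_eq_mul]
    have := dividedPow_add_single (fun j => ψ j x) β j
    linear_combination -(Real.exp (b x)) * this
  rw [← e]
  rw [map_zero, add_zero] at h5
  exact h5

end LInfty

/-! ### Elliptic operators and the square-sum bound for Taylor coefficients. -/

section Operators

variable {α : Type*} [MeasurableSpace α] {m : Measure α} {E V : Type*} [NormedAddCommGroup E]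
  [InnerProductSpace ℝ E] [CompleteSpace E] [NormedAddCommGroup V] [InnerProductSpace ℝ V]
  [CompleteSpace V] (G : V →L[ℝ] Lp E 2 m)

/-- Multiplication of `L²` functions by `L^∞` functions. -/
def mulTwo : Lp ℝ ∞ m →L[ℝ] Lp E 2 m →L[ℝ] Lp E 2 m :=
  (ContinuousLinearMap.lsmul ℝ ℝ).holderL m ∞ 2 2

omit [CompleteSpace E] in
theorem coeFn_mulTwo (f : Lp ℝ ∞ m) (g : Lp E 2 m) : mulTwo f g =ᵐ[m] fun x => f x • g x :=
  (ContinuousLinearMap.lsmul ℝ ℝ).coeFn_holder f g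

/-- The operator on `V` of the bilinear form `(u, v) ↦ ∫ g ⟪G u, G v⟫`. -/
def formOp : Lp ℝ ∞ m →L[ℝ] V →L[ℝ] V :=
  ((ContinuousLinearMap.compL ℝ V (Lp E 2 m) V) (ContinuousLinearMap.adjoint G)) ∘L
    (((ContinuousLinearMap.compL ℝ V (Lp E 2 m) (Lp E 2 m)).flip G) ∘L mulTwo)

theorem inner_formOp (g : Lp ℝ ∞ m) (u v : V) :
    inner ℝ (formOp G g u) v = ∫ x, g x * inner ℝ (G u x) (G v x) ∂m := by
  have : formOp G g u = ContinuousLinearMap.adjoint G (mulTwo g (G u)) := rfl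
  rw [this, ContinuousLinearMap.adjoint_inner_left, L2.inner_def]
  refine integral_congr_ae ((coeFn_mulTwo g (G u)).mono fun x hx => ?_)
  simp only [hx, inner_smul_left]; simp

theorem integrable_mul_inner (g : Lp ℝ ∞ m) (u v : Lp E 2 m) :
    Integrable (fun x => g x * inner ℝ (u x) (v x)) m := by
  refine (L2.integrable_inner (𝕜 := ℝ) (mulTwo g u) v).congr
    ((coeFn_mulTwo g u).mono fun x hx => ?_)
  simp only [hx, inner_smul_left]; simp

/-- The operators `A_β(b)` with coefficient `exp(b) ψ^β / β!`. -/
def coeffOp (ψ : ℕ → Lp ℝ ∞ m) (β : ℕ →₀ ℕ) (b : Lp ℝ ∞ m) : V →L[ℝ] V :=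
  formOp G (coeffInf ψ β b)

theorem differentiable_coeffOp (ψ : ℕ → Lp ℝ ∞ m) (β : ℕ →₀ ℕ) :
    Differentiable ℝ (coeffOp G ψ β) :=
  (formOp G).differentiable.comp (differentiable_coeffInf ψ β)

theorem hasDerivAt_coeffOp (ψ : ℕ → Lp ℝ ∞ m) (β : ℕ →₀ ℕ) (b : Lp ℝ ∞ m) (j : ℕ) :
    HasDerivAt (fun s : ℝ => coeffOp G ψ β (b + s • ψ j))
      (((β j : ℝ) + 1) • coeffOp G ψ (β + Finsupp.single j 1) b) 0 := by
  have := (formOp G).hasFDerivAt.comp_hasDerivAt (0 : ℝ) (hasDerivAt_coeffInf ψ β b j)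
  rw [map_smul] at this
  exact this

theorem inner_coeffOp_zero (ψ : ℕ → Lp ℝ ∞ m) (b : Lp ℝ ∞ m) (u v : V) :
    inner ℝ (coeffOp G ψ 0 b u) v = ∫ x, Real.exp (b x) * inner ℝ (G u x) (G v x) ∂m := by
  rw [coeffOp, inner_formOp]
  refine integral_congr_ae ((coeFn_coeffInf ψ 0 b).mono fun x hx => ?_)
  simp only [hx, dividedPow_zero, mul_one]

/-- Lax–Milgram, phrased in the ring of operators so that `Ring.inverse` is a genuine inverse,
differentiable at `A`. -/
theorem isUnit_of_coercive {A : V →L[ℝ] V} {c : ℝ} (hc : 0 < c)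
    (h : ∀ u, c * ‖u‖ ^ 2 ≤ inner ℝ (A u) u) : IsUnit A := by
  let B : V →L[ℝ] V →L[ℝ] ℝ := (innerSL ℝ).comp A
  have hB : IsCoercive B := ⟨c, hc, fun u => by
    have := h u
    simp only [B, ContinuousLinearMap.comp_apply, innerSL_apply_apply]
    linarith [sq ‖u‖, mul_assoc c ‖u‖ ‖u‖, congrArg (c * ·) (sq ‖u‖)]⟩
  have : (hB.continuousLinearEquivOfBilin : V →L[ℝ] V) = A := by
    ext v
    refine ext_inner_right ℝ fun w => ?_
    exact hB.continuousLinearEquivOfBilin_apply v w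
  rw [← this]
  exact ⟨ContinuousLinearEquiv.toUnit hB.continuousLinearEquivOfBilin, rfl⟩

omit [CompleteSpace V] in
theorem energy_lower_bound {Cp : ℝ} (hCp : 0 < Cp) (hG : ∀ v, ‖v‖ ≤ Cp * ‖G v‖) (b : Lp ℝ ∞ m)
    (u : V) : ‖u‖ ^ 2 ≤
      Cp ^ 2 * Real.exp ‖b‖ * ∫ x, Real.exp (b x) * ‖G u x‖ ^ 2 ∂m := by
  have h1 : ‖u‖ ^ 2 ≤ Cp ^ 2 * ‖G u‖ ^ 2 := by
    rw [← mul_pow]; exact pow_le_pow_left₀ (norm_nonneg _) (hG u) 2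
  have hint : Integrable (fun x => ‖G u x‖ ^ 2) m := by
    simpa using L2.integrable_inner (𝕜 := ℝ) (G u) (G u)
  have hint2 : Integrable (fun x => Real.exp (b x) * ‖G u x‖ ^ 2) m := by
    refine (integrable_mul_inner (expInf b) (G u) (G u)).congr
      ((coeFn_expInf b).mono fun x hx => ?_)
    simp only [hx, real_inner_self_eq_norm_sq]
  have h2 : Real.exp (-‖b‖) * ‖G u‖ ^ 2 ≤ ∫ x, Real.exp (b x) * ‖G u x‖ ^ 2 ∂m := by
    rw [norm_sq_eq_integral, ← integral_const_mul]
    refine integral_mono_ae (hint.const_mul _) hint2 ((ae_abs_le_norm b).mono fun x hx => ?_)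
    have : Real.exp (-‖b‖) ≤ Real.exp (b x) := Real.exp_le_exp.2 (by linarith [neg_abs_le (b x)])
    exact mul_le_mul_of_nonneg_right this (sq_nonneg _)
  have h3 : ‖G u‖ ^ 2 ≤ Real.exp ‖b‖ * ∫ x, Real.exp (b x) * ‖G u x‖ ^ 2 ∂m := by
    have := mul_le_mul_of_nonneg_left h2 (Real.exp_pos ‖b‖).le
    rwa [← mul_assoc, ← Real.exp_add, add_neg_cancel, Real.exp_zero, one_mul] at this
  calc ‖u‖ ^ 2 ≤ Cp ^ 2 * ‖G u‖ ^ 2 := h1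
    _ ≤ Cp ^ 2 * (Real.exp ‖b‖ * ∫ x, Real.exp (b x) * ‖G u x‖ ^ 2 ∂m) := by gcongr
    _ = _ := by ring

theorem isUnit_coeffOp_zero {Cp : ℝ} (hCp : 0 < Cp) (hG : ∀ v, ‖v‖ ≤ Cp * ‖G v‖)
    (ψ : ℕ → Lp ℝ ∞ m) (b : Lp ℝ ∞ m) : IsUnit (coeffOp G ψ 0 b) := by
  refine isUnit_of_coercive (c := (Cp ^ 2 * Real.exp ‖b‖)⁻¹) (by positivity) fun u => ?_
  rw [inner_coeffOp_zero, inv_mul_le_iff₀ (by positivity)]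
  simpa using energy_lower_bound G hCp hG b u

/-- The central estimate. Testing with `t μ` and summing leaves only `⟪F, t 0⟫` on the right. On the
left the Schur test is applied pointwise in `x`, before integration, with `κ = e^K - 1`, which gives
the coercivity constant `2 - e^K`. -/
theorem sum_norm_sq_taylorCoeff_le {Cp : ℝ} (hCp : 0 < Cp) (hG : ∀ v, ‖v‖ ≤ Cp * ‖G v‖)
    (ψ : ℕ → Lp ℝ ∞ m) {K : ℝ} (hK : Real.exp K < 2)
    (hψ : ∀ᵐ x ∂m, ∀ N, ∑ j ∈ Finset.range N, |ψ j x| ≤ K) (F : V) (b : Lp ℝ ∞ m)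
    (Λ : Finset (ℕ →₀ ℕ)) (hΛ : ∀ μ ∈ Λ, ∀ ν ≤ μ, ν ∈ Λ) :
    ∑ μ ∈ Λ, ‖taylorCoeff (coeffOp G ψ) F μ b‖ ^ 2 ≤
      (Cp ^ 2 * ‖F‖ / (2 - Real.exp K)) ^ 2 * Real.exp (2 * ‖b‖) := by
  rcases Λ.eq_empty_or_nonempty with rfl | ⟨μ₀, hμ₀⟩
  · simp; positivity
  have h0 : (0 : ℕ →₀ ℕ) ∈ Λ := hΛ μ₀ hμ₀ 0 (zero_le)
  set t : (ℕ →₀ ℕ) → V := fun μ => taylorCoeff (coeffOp G ψ) F μ b with ht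
  have hU := isUnit_coeffOp_zero G hCp hG ψ b
  have hid : ∑ μ ∈ Λ, ∑ p ∈ Finset.HasAntidiagonal.antidiagonal μ,
      inner ℝ (coeffOp G ψ p.1 b (t p.2)) (t μ) = inner ℝ F (t 0) := by
    have : ∀ μ ∈ Λ, ∑ p ∈ Finset.HasAntidiagonal.antidiagonal μ,
        inner ℝ (coeffOp G ψ p.1 b (t p.2)) (t μ) = if μ = 0 then inner ℝ F (t 0) else 0 := by
      intro μ _
      rw [← sum_inner, sum_taylorCoeff hU]
      split_ifs with h
      · rw [h]
      · simp
    rw [Finset.sum_congr rfl this, Finset.sum_ite_eq' _ _ _, if_pos h0]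
  have hint : ∀ β μ ν, Integrable (fun x => coeffInf ψ β b x * inner ℝ (G (t ν) x) (G (t μ) x)) m :=
    fun β μ ν => integrable_mul_inner _ _ _
  simp only [coeffOp, inner_formOp] at hid
  have hid2 : ∑ μ ∈ Λ, ∑ p ∈ Finset.HasAntidiagonal.antidiagonal μ,
      ∫ x, coeffInf ψ p.1 b x * inner ℝ (G (t p.2) x) (G (t μ) x) ∂m =
      ∫ x, ∑ μ ∈ Λ, ∑ p ∈ Finset.HasAntidiagonal.antidiagonal μ,
        coeffInf ψ p.1 b x * inner ℝ (G (t p.2) x) (G (t μ) x) ∂m := by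
    rw [integral_finsetSum _ fun μ _ => integrable_finsetSum _ fun p _ => hint _ _ _]
    refine Finset.sum_congr rfl fun μ _ => ?_
    rw [integral_finsetSum _ fun p _ => hint _ _ _]
  have hint2 : ∀ u : V, Integrable (fun x => Real.exp (b x) * ‖G u x‖ ^ 2) m := fun u => by
    refine (integrable_mul_inner (expInf b) (G u) (G u)).congr
      ((coeFn_expInf b).mono fun x hx => ?_)
    simp only [hx, real_inner_self_eq_norm_sq]
  have hlow : (2 - Real.exp K) * ∑ μ ∈ Λ, ∫ x, Real.exp (b x) * ‖G (t μ) x‖ ^ 2 ∂m ≤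
      inner ℝ F (t 0) := by
    rw [← hid, hid2, ← integral_finsetSum _ fun μ _ => hint2 _, ← integral_const_mul]
    refine integral_mono_ae ((integrable_finsetSum _ fun μ _ => hint2 _).const_mul _)
      (integrable_finsetSum _ fun μ _ => integrable_finsetSum _ fun p _ => hint _ _ _) ?_
    filter_upwards [hψ, ae_all_iff.2 fun β => coeFn_coeffInf ψ β b] with x hx hc
    have := schur_lower_bound Λ hΛ (fun μ => G (t μ) x) (dividedPow fun j => ψ j x)
      (dividedPow_zero _) (κ := Real.exp K - 1)
      (fun T hT => sum_abs_dividedPow_erase_le _ hx T hT)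
    have := mul_le_mul_of_nonneg_left this (Real.exp_pos (b x)).le
    simp only [hc]
    rw [Finset.mul_sum] at this
    simp only [Finset.mul_sum] at this ⊢
    simp only [mul_assoc]
    refine le_trans (le_of_eq ?_) this
    refine Finset.sum_congr rfl fun μ _ => ?_
    ring
  set S := ∑ μ ∈ Λ, ‖t μ‖ ^ 2 with hS
  have hS1 : S ≤ Cp ^ 2 * Real.exp ‖b‖ * ∑ μ ∈ Λ, ∫ x, Real.exp (b x) * ‖G (t μ) x‖ ^ 2 ∂m := by
    rw [Finset.mul_sum]
    exact Finset.sum_le_sum fun μ _ => energy_lower_bound G hCp hG b (t μ)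
  have hpos : 0 < 2 - Real.exp K := by linarith
  set Q := Cp ^ 2 * ‖F‖ / (2 - Real.exp K) with hQ
  have hQ0 : 0 ≤ Q := by positivity
  have hS2 : S ≤ Q * Real.exp ‖b‖ * ‖t 0‖ := by
    have e1 : ∑ μ ∈ Λ, ∫ x, Real.exp (b x) * ‖G (t μ) x‖ ^ 2 ∂m ≤
        ‖F‖ * ‖t 0‖ / (2 - Real.exp K) := by
      rw [le_div_iff₀ hpos, mul_comm]
      exact hlow.trans (real_inner_le_norm _ _)
    refine hS1.trans ((mul_le_mul_of_nonneg_left e1 (by positivity)).trans (le_of_eq ?_))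
    rw [hQ]; ring
  have hS3 : ‖t 0‖ ^ 2 ≤ S := Finset.single_le_sum (f := fun μ => ‖t μ‖ ^ 2)
    (fun _ _ => sq_nonneg _) h0
  have e4 : Real.exp (2 * ‖b‖) = Real.exp ‖b‖ ^ 2 := by rw [sq, ← Real.exp_add]; ring_nf
  rw [e4, ← mul_pow]
  have : 0 ≤ Q * Real.exp ‖b‖ := by positivity
  -- From `S ≤ a ‖t 0‖` and `‖t 0‖² ≤ S` follows `S ≤ a²`, with `a = Q e^‖b‖`.
  nlinarith [sq_nonneg (Q * Real.exp ‖b‖ - ‖t 0‖)]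

end Operators

instance : IsProbabilityMeasure gammaU := by unfold gammaU; infer_instance

/-! ### The random field `b(y)`: convergence and exponential moments. -/

section Overlap

variable {α : Type*} [MeasurableSpace α] {m : Measure α} {ψ : ℕ → Lp ℝ ∞ m} {M : ℕ}

/-- At most `M` summands survive at a given `x`. The quantifiers over `c`, `T`, `B` stand inside the
almost-everywhere statement, so one null set serves all of them. -/
theorem ae_sum_abs_le (hM : ∀ᵐ x ∂m, {j : ℕ | ψ j x ≠ 0}.encard ≤ (M : ℕ∞)) :
    ∀ᵐ x ∂m, ∀ (c : ℕ → ℝ) (T : Finset ℕ) (B : ℝ), 0 ≤ B → (∀ j ∈ T, |c j| * ‖ψ j‖ ≤ B) →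
      ∑ j ∈ T, |c j * ψ j x| ≤ M * B := by
  filter_upwards [hM, ae_all_iff.2 fun j => ae_abs_le_norm (ψ j)] with x hx hn c T B hB hc
  have h1 : ∑ j ∈ T, |c j * ψ j x| = ∑ j ∈ T.filter (fun j => ψ j x ≠ 0), |c j * ψ j x| := by
    symm
    refine Finset.sum_filter_of_ne fun j _ hj h0 => hj ?_
    simp only [h0, mul_zero, abs_zero]
  have h2 : (T.filter (fun j => ψ j x ≠ 0)).card ≤ M := by
    have : ((T.filter (fun j => ψ j x ≠ 0) : Finset ℕ) : Set ℕ).encard ≤ (M : ℕ∞) :=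
      by
        refine (Set.encard_le_encard ?_).trans hx
        intro j hj
        exact (Finset.mem_filter.1 (Finset.mem_coe.1 hj)).2
    rw [Set.encard_coe_eq_coe_finsetCard] at this
    exact_mod_cast this
  rw [h1]
  calc _ ≤ ∑ j ∈ T.filter (fun j => ψ j x ≠ 0), B := by
        refine Finset.sum_le_sum fun j hj => ?_
        rw [abs_mul]
        exact (mul_le_mul_of_nonneg_left (hn j) (abs_nonneg _)).trans
          (hc j (Finset.mem_filter.1 hj).1)
    _ = (T.filter (fun j => ψ j x ≠ 0)).card * B := by rw [Finset.sum_const, nsmul_eq_mul]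
    _ ≤ M * B := by gcongr

theorem coeFn_sum_smul (c : ℕ → ℝ) (T : Finset ℕ) :
    ⇑(∑ j ∈ T, c j • ψ j) =ᵐ[m] fun x => ∑ j ∈ T, c j * ψ j x := by
  have h1 := Lp.coeFn_finsetSum T (fun j => c j • ψ j)
  filter_upwards [h1, ae_all_iff.2 fun j => Lp.coeFn_smul (c j) (ψ j)] with x hx h2
  rw [hx, Finset.sum_apply]
  exact Finset.sum_congr rfl fun j _ => by rw [h2]; simp

theorem norm_sum_smul_le (hM : ∀ᵐ x ∂m, {j : ℕ | ψ j x ≠ 0}.encard ≤ (M : ℕ∞)) (c : ℕ → ℝ)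
    (T : Finset ℕ) {B : ℝ} (hB : 0 ≤ B) (hc : ∀ j ∈ T, |c j| * ‖ψ j‖ ≤ B) :
    ‖∑ j ∈ T, c j • ψ j‖ ≤ M * B := by
  refine norm_le_of_ae_abs_le (by positivity) ?_
  filter_upwards [ae_sum_abs_le hM, coeFn_sum_smul c T] with x hx h2
  rw [h2]
  exact (Finset.abs_sum_le_sum_abs _ _).trans (hx c T B hB hc)

/-- The parameters for which `|y_j| ‖ψ_j‖` is `q`-summable. -/
def goodSet (ψ : ℕ → Lp ℝ ∞ m) (q : ℝ) : Set (ℕ → ℝ) :=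
  {y | Summable fun j => (|y j| * ‖ψ j‖) ^ q}

/-- The logarithm `∑_j y_j ψ_j` of the diffusion coefficient. -/
def logField (ψ : ℕ → Lp ℝ ∞ m) (y : ℕ → ℝ) : Lp ℝ ∞ m := ∑' j, y j • ψ j

variable {q : ℝ}

theorem finite_le_of_mem_goodSet (hq : 0 < q) {y : ℕ → ℝ} (hy : y ∈ goodSet ψ q) {ε : ℝ}
    (hε : 0 < ε) : {j | ε ≤ |y j| * ‖ψ j‖}.Finite := by
  have h1 := hy.tendsto_cofinite_zero
  have h2 := h1.eventually (gt_mem_nhds (show (0 : ℝ) < ε ^ q by positivity))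
  rw [Filter.eventually_cofinite] at h2
  refine h2.subset fun j hj => ?_
  simp only [Set.mem_ofPred_eq, not_lt] at hj ⊢
  exact Real.rpow_le_rpow hε.le hj hq.le

/-- With finite overlap a partial sum has norm at most `M` times its largest term, so terms tending
to zero already suffice for convergence. -/
theorem summable_of_mem_goodSet (hM : ∀ᵐ x ∂m, {j : ℕ | ψ j x ≠ 0}.encard ≤ (M : ℕ∞)) (hq : 0 < q)
    {y : ℕ → ℝ} (hy : y ∈ goodSet ψ q) : Summable fun j => y j • ψ j := by
  rw [summable_iff_vanishing_norm]
  intro ε hε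
  have hδ : 0 < ε / (M + 1) := by positivity
  refine ⟨(finite_le_of_mem_goodSet hq hy hδ).toFinset, fun t ht => ?_⟩
  have : ‖∑ j ∈ t, y j • ψ j‖ ≤ M * (ε / (M + 1)) := by
    refine norm_sum_smul_le hM y t hδ.le fun j hj => ?_
    have := Finset.disjoint_left.1 ht hj
    simp only [Set.Finite.mem_toFinset, Set.mem_ofPred_eq, not_le] at this
    exact this.le
  refine this.trans_lt ?_
  rw [mul_div_assoc', div_lt_iff₀ (by positivity)]
  nlinarith

theorem norm_logField_le (hM : ∀ᵐ x ∂m, {j : ℕ | ψ j x ≠ 0}.encard ≤ (M : ℕ∞)) (hq : 0 < q)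
    {y : ℕ → ℝ} (hy : y ∈ goodSet ψ q) {B : ℝ} (hB : 0 ≤ B) (h : ∀ j, |y j| * ‖ψ j‖ ≤ B) :
    ‖logField ψ y‖ ≤ M * B := by
  have h1 := (summable_of_mem_goodSet hM hq hy).hasSum.norm
  exact le_of_tendsto h1 (Eventually.of_forall fun T => norm_sum_smul_le hM y T hB fun j _ => h j)

theorem logField_update (hM : ∀ᵐ x ∂m, {j : ℕ | ψ j x ≠ 0}.encard ≤ (M : ℕ∞)) (hq : 0 < q)
    {y : ℕ → ℝ} (hy : y ∈ goodSet ψ q) (j : ℕ) (s : ℝ) :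
    logField ψ (Function.update y j s) = logField ψ y + (s - y j) • ψ j := by
  have h1 := (summable_of_mem_goodSet hM hq hy).hasSum
  have h2 : HasSum (fun i => if i = j then (s - y j) • ψ j else 0) ((s - y j) • ψ j) :=
    hasSum_ite_eq j _
  have h3 := h1.add h2
  rw [logField, logField, ← h3.tsum_eq]
  refine tsum_congr fun i => ?_
  by_cases hi : i = j
  · subst hi; simp [sub_smul]
  · simp [hi]

/-- Replaces the exponential of a supremum by a sum that integrates coordinate by coordinate. If
some `|y_j| ‖ψ_j‖` exceeds `1`, the supremum is attained, since only finitely many terms reach `1`;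
at the maximizer the factor `(·)^q` is at least `1`, so that single summand dominates. -/
theorem ofReal_exp_norm_logField_le (hM : ∀ᵐ x ∂m, {j : ℕ | ψ j x ≠ 0}.encard ≤ (M : ℕ∞))
    (hq : 0 < q) {y : ℕ → ℝ} (hy : y ∈ goodSet ψ q) {c : ℝ} (hc : 0 ≤ c) :
    ENNReal.ofReal (Real.exp (c * ‖logField ψ y‖)) ≤ ENNReal.ofReal (Real.exp (c * M)) +
      ∑' j, ENNReal.ofReal ((|y j| * ‖ψ j‖) ^ q * Real.exp (c * M * (|y j| * ‖ψ j‖))) := by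
  by_cases h : ∀ j, |y j| * ‖ψ j‖ ≤ 1
  · refine le_trans (ENNReal.ofReal_le_ofReal (Real.exp_le_exp.2 ?_)) le_self_add
    have := norm_logField_le hM hq hy zero_le_one h
    rw [mul_one] at this
    gcongr
  · push Not at h
    obtain ⟨j₁, hj₁⟩ := h
    have hfin := finite_le_of_mem_goodSet hq hy one_pos
    obtain ⟨j₀, hj₀, hmax⟩ := hfin.exists_maximalFor (fun j => |y j| * ‖ψ j‖) _ ⟨j₁, hj₁.le⟩
    simp only [Set.mem_ofPred_eq] at hj₀
    have hall : ∀ j, |y j| * ‖ψ j‖ ≤ |y j₀| * ‖ψ j₀‖ := fun j => by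
      rcases le_total 1 (|y j| * ‖ψ j‖) with h1 | h1
      · by_contra h2
        exact h2 (hmax h1 (not_le.1 h2).le)
      · exact h1.trans hj₀
    have hn := norm_logField_le hM hq hy (by positivity) hall
    refine le_trans (ENNReal.ofReal_le_ofReal ?_) ((ENNReal.le_tsum j₀).trans le_add_self)
    have h1 : 1 ≤ (|y j₀| * ‖ψ j₀‖) ^ q := Real.one_le_rpow hj₀ hq.le
    calc Real.exp (c * ‖logField ψ y‖) ≤ Real.exp (c * M * (|y j₀| * ‖ψ j₀‖)) := by
          rw [mul_assoc]; gcongr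
      _ ≤ _ := le_mul_of_one_le_left (Real.exp_pos _).le h1

theorem lintegral_rpow_mul_exp_lt_top (hq : 0 < q) (L : ℝ) :
    ∫⁻ t, ENNReal.ofReal (|t| ^ q * Real.exp (L * |t|)) ∂(gaussianReal 0 1) < ⊤ := by
  have hint : Integrable (fun t : ℝ => |t| ^ q * Real.exp (L * |t|)) (gaussianReal 0 1) := by
    have h1 : ∀ v : ℝ, Integrable (fun t : ℝ => |t| ^ q * Real.exp (v * t)) (gaussianReal 0 1) :=
      fun v => integrable_rpow_abs_mul_exp_of_mem_interior_integrableExpSet (X := id)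
        (by rw [integrableExpSet_id_gaussianReal]; simp) hq.le
    refine ((h1 L).add (h1 (-L))).mono' ?_ (ae_of_all _ fun t => ?_)
    · exact (Measurable.aestronglyMeasurable (by fun_prop))
    · rw [Real.norm_of_nonneg (by positivity), Pi.add_apply, ← mul_add]
      refine mul_le_mul_of_nonneg_left ?_ (by positivity)
      rcases abs_cases t with ⟨h, _⟩ | ⟨h, _⟩ <;> rw [h]
      · linarith [Real.exp_pos (-L * t)]
      · have : L * -t = -L * t := by ring
        rw [this]; linarith [Real.exp_pos (L * t)]
  have := hint.hasFiniteIntegral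
  rw [hasFiniteIntegral_iff_ofReal (ae_of_all _ fun t => by positivity)] at this
  exact this

/-- Since `‖ψ_j‖` is bounded by some `L`, each term integrates to at most `‖ψ_j‖^q` times one
Gaussian moment independent of `j`. -/
theorem lintegral_tsum_lt_top (hq : 0 < q) (hψ : Summable fun j => ‖ψ j‖ ^ q) {c : ℝ}
    (hc : 0 ≤ c) :
    ∫⁻ y, ∑' j, ENNReal.ofReal ((|y j| * ‖ψ j‖) ^ q * Real.exp (c * (|y j| * ‖ψ j‖))) ∂gammaU
      < ⊤ := by
  obtain ⟨L, hL⟩ : ∃ L, ∀ j, ‖ψ j‖ ≤ L := by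
    have h1 := hψ.tendsto_cofinite_zero
    obtain ⟨B, hB⟩ := h1.bddAbove_range_of_cofinite
    refine ⟨B ^ q⁻¹, fun j => ?_⟩
    have := hB ⟨j, rfl⟩
    calc ‖ψ j‖ = (‖ψ j‖ ^ q) ^ q⁻¹ := (Real.rpow_rpow_inv (norm_nonneg _) hq.ne').symm
      _ ≤ B ^ q⁻¹ := Real.rpow_le_rpow (by positivity) this (by positivity)
  have hmeas : ∀ j, Measurable fun t : ℝ =>
      ENNReal.ofReal ((|t| * ‖ψ j‖) ^ q * Real.exp (c * (|t| * ‖ψ j‖))) := fun j => by fun_prop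
  have hmeas' : ∀ j, AEMeasurable (fun y : ℕ → ℝ =>
      ENNReal.ofReal ((|y j| * ‖ψ j‖) ^ q * Real.exp (c * (|y j| * ‖ψ j‖)))) gammaU := fun j =>
    ((hmeas j).comp (measurable_pi_apply j)).aemeasurable
  rw [lintegral_tsum hmeas']
  have h1 : ∀ j, ∫⁻ y, ENNReal.ofReal ((|y j| * ‖ψ j‖) ^ q * Real.exp (c * (|y j| * ‖ψ j‖))) ∂gammaU
      ≤ ENNReal.ofReal (‖ψ j‖ ^ q) *
        ∫⁻ t, ENNReal.ofReal (|t| ^ q * Real.exp (c * L * |t|)) ∂(gaussianReal 0 1) := fun j => by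
    have hmp := measurePreserving_eval_infinitePi (fun _ : ℕ => gaussianReal 0 1) j
    have := hmp.lintegral_comp (hmeas j)
    change ∫⁻ y, _ ∂gammaU = _ at this
    simp only [Function.eval] at this
    rw [this, ← lintegral_const_mul _ (by fun_prop)]
    refine lintegral_mono fun t => ?_
    rw [← ENNReal.ofReal_mul (by positivity), Real.mul_rpow (abs_nonneg _) (norm_nonneg _)]
    refine ENNReal.ofReal_le_ofReal ?_
    have : Real.exp (c * (|t| * ‖ψ j‖)) ≤ Real.exp (c * L * |t|) := by
      rw [mul_assoc, mul_comm L]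
      gcongr
      exact hL j
    calc _ ≤ |t| ^ q * ‖ψ j‖ ^ q * Real.exp (c * L * |t|) := by gcongr
      _ = _ := by ring
  refine (ENNReal.tsum_le_tsum h1).trans_lt ?_
  rw [ENNReal.tsum_mul_right]
  refine ENNReal.mul_lt_top ?_ (lintegral_rpow_mul_exp_lt_top hq _)
  rw [← ENNReal.ofReal_tsum_of_nonneg (fun j => by positivity) hψ]
  exact ENNReal.ofReal_lt_top

theorem ae_mem_goodSet (hq : 0 < q) (hψ : Summable fun j => ‖ψ j‖ ^ q) :
    ∀ᵐ y ∂gammaU, y ∈ goodSet ψ q := by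
  -- The case `c = 0`: the defining series of `goodSet` has finite expectation.
  have h1 := lintegral_tsum_lt_top hq hψ le_rfl
  simp only [zero_mul, Real.exp_zero, mul_one] at h1
  have hmeas : Measurable fun y : ℕ → ℝ => ∑' j, ENNReal.ofReal ((|y j| * ‖ψ j‖) ^ q) :=
    Measurable.tsum fun j => by fun_prop
  have h2 := ae_lt_top hmeas h1.ne
  filter_upwards [h2] with y hy
  have := ENNReal.summable_toReal hy.ne
  refine this.congr fun j => ?_
  rw [ENNReal.toReal_ofReal (by positivity)]

theorem aestronglyMeasurable_logField (hM : ∀ᵐ x ∂m, {j : ℕ | ψ j x ≠ 0}.encard ≤ (M : ℕ∞))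
    (hq : 0 < q) (hψ : Summable fun j => ‖ψ j‖ ^ q) :
    AEStronglyMeasurable (logField ψ) gammaU := by
  refine aestronglyMeasurable_of_tendsto_ae (u := atTop)
    (f := fun (N : ℕ) (y : ℕ → ℝ) => ∑ j ∈ Finset.range N, y j • ψ j) (fun N => ?_) ?_
  · refine Finset.aestronglyMeasurable_fun_sum _ fun j _ => ?_
    exact ((measurable_pi_apply j).stronglyMeasurable.smul_const (ψ j)).aestronglyMeasurable
  · filter_upwards [ae_mem_goodSet hq hψ] with y hy
    exact (summable_of_mem_goodSet hM hq hy).hasSum.tendsto_sum_nat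

theorem integrable_exp_norm_logField (hM : ∀ᵐ x ∂m, {j : ℕ | ψ j x ≠ 0}.encard ≤ (M : ℕ∞))
    (hq : 0 < q) (hψ : Summable fun j => ‖ψ j‖ ^ q) {c : ℝ} (hc : 0 ≤ c) :
    Integrable (fun y => Real.exp (c * ‖logField ψ y‖)) gammaU := by
  refine ⟨?_, ?_⟩
  · exact Real.continuous_exp.comp_aestronglyMeasurable
      ((aestronglyMeasurable_logField hM hq hψ).norm.const_mul c)
  · rw [hasFiniteIntegral_iff_ofReal (ae_of_all _ fun y => (Real.exp_pos _).le)]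
    have h1 : ∀ᵐ y ∂gammaU, _ := (ae_mem_goodSet hq hψ).mono
      fun y hy => ofReal_exp_norm_logField_le hM hq hy hc
    refine (lintegral_mono_ae h1).trans_lt ?_
    rw [lintegral_add_left measurable_const]
    refine ENNReal.add_lt_top.2 ⟨?_, lintegral_tsum_lt_top hq hψ (by positivity)⟩
    simp

end Overlap

/-! ### Hermite polynomials and integration by parts in one variable. -/

section OneDim

/-- The monic probabilists' Hermite polynomial as a function. -/
def hermiteFun (k : ℕ) (t : ℝ) : ℝ := Polynomial.aeval t (Polynomial.hermite k)

theorem hermiteFun_zero (t : ℝ) : hermiteFun 0 t = 1 := by simp [hermiteFun]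

theorem hermiteFun_succ (k : ℕ) (t : ℝ) :
    hermiteFun (k + 1) t = t * hermiteFun k t - deriv (hermiteFun k) t := by
  unfold hermiteFun
  rw [Polynomial.hermite_succ, map_sub, map_mul, Polynomial.aeval_X, Polynomial.deriv_aeval]

theorem derivative_hermite_succ (k : ℕ) :
    Polynomial.derivative (Polynomial.hermite (k + 1)) =
      ((k : Polynomial ℤ) + 1) * Polynomial.hermite k := by
  induction k with
  | zero => simp
  | succ k ih =>
    rw [Polynomial.hermite_succ (k + 1), Polynomial.derivative_sub, Polynomial.derivative_mul, ih,
      Polynomial.derivative_mul]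
    have : Polynomial.derivative ((k : Polynomial ℤ) + 1) = 0 := by simp
    rw [this, Polynomial.hermite_succ k]
    simp
    ring

theorem hasDerivAt_hermiteFun (k : ℕ) (t : ℝ) :
    HasDerivAt (hermiteFun k) (k * hermiteFun (k - 1) t) t := by
  have h := Polynomial.hasDerivAt_aeval (Polynomial.hermite k) t
  rcases k with _ | k
  · exact h.congr_deriv (by simp)
  · rw [derivative_hermite_succ] at h
    exact h.congr_deriv (by simp [hermiteFun])

theorem hermiteFun_succ' (k : ℕ) (t : ℝ) :
    hermiteFun (k + 1) t = t * hermiteFun k t - k * hermiteFun (k - 1) t := by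
  rw [hermiteFun_succ, (hasDerivAt_hermiteFun k t).deriv]

theorem memLp_hermiteFun (k : ℕ) {r : ℝ≥0∞} (hr : r ≠ ⊤) :
    MemLp (hermiteFun k) r (gaussianReal 0 1) := by
  -- All finite exponents are treated together, because Hölder for `t * hermiteFun k t` in `L^r`
  -- needs `L^(2r)`.
  induction k using Nat.strong_induction_on generalizing r with
  | _ k ih =>
    rcases k with _ | k
    · have : hermiteFun 0 = fun _ => (1 : ℝ) := funext hermiteFun_zero
      rw [this]; exact memLp_const _
    · have : hermiteFun (k + 1) = (id * hermiteFun k) - fun t => (k : ℝ) * hermiteFun (k - 1) t :=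
        funext fun t => hermiteFun_succ' k t
      rw [this]
      refine MemLp.sub ?_ ((ih (k - 1) (by omega) hr).const_mul _)
      have h2 : r * 2 ≠ ⊤ := ENNReal.mul_ne_top hr (by simp)
      have : ENNReal.HolderTriple (r * 2) (r * 2) r := ⟨by
        rw [ENNReal.mul_inv (by simp) (by simp), ← mul_add, ENNReal.inv_two_add_inv_two, mul_one]⟩
      exact (ih k (by omega) h2).mul (memLp_id_gaussianReal' (r * 2) h2)

variable {W : Type*} [NormedAddCommGroup W] [NormedSpace ℝ W]

theorem integrable_gaussianReal_iff {f : ℝ → W} :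
    Integrable f (gaussianReal 0 1) ↔ Integrable fun t => gaussianPDFReal 0 1 t • f t := by
  rw [gaussianReal_of_var_ne_zero _ one_ne_zero, integrable_withDensity_iff_integrable_smul'
    (measurable_gaussianPDF _ _) (ae_of_all _ fun _ => gaussianPDF_lt_top)]
  simp only [toReal_gaussianPDF]

theorem hasDerivAt_gaussianPDFReal_mul_hermiteFun (k : ℕ) (t : ℝ) :
    HasDerivAt (fun t => gaussianPDFReal 0 1 t * hermiteFun k t)
      (-(gaussianPDFReal 0 1 t * hermiteFun (k + 1) t)) t := by
  have h1 : HasDerivAt (gaussianPDFReal 0 1) (-t * gaussianPDFReal 0 1 t) t := by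
    have : gaussianPDFReal 0 1 = fun x : ℝ => (Real.sqrt (2 * Real.pi))⁻¹ * Real.exp (-x ^ 2 / 2) := by
      funext x; simp [gaussianPDFReal]
    rw [this]
    have h2 : HasDerivAt (fun x : ℝ => -x ^ 2 / 2) (-t) t := by
      convert! ((hasDerivAt_pow 2 t).neg.div_const 2) using 1
      simp only [Nat.cast_ofNat, Nat.add_one_sub_one, pow_one]
      ring
    convert! (h2.exp.const_mul (Real.sqrt (2 * Real.pi))⁻¹) using 1
    ring
  convert! h1.mul (hasDerivAt_hermiteFun k t) using 1
  rw [hermiteFun_succ']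
  ring

/-- Gaussian integration by parts against a Hermite polynomial. -/
theorem integral_hermiteFun_smul_deriv {φ φ' : ℝ → W} (k : ℕ) (hφ : ∀ t, HasDerivAt φ (φ' t) t)
    (h1 : Integrable (fun t => hermiteFun k t • φ' t) (gaussianReal 0 1))
    (h2 : Integrable (fun t => hermiteFun (k + 1) t • φ t) (gaussianReal 0 1))
    (h3 : Integrable (fun t => hermiteFun k t • φ t) (gaussianReal 0 1)) :
    ∫ t, hermiteFun k t • φ' t ∂(gaussianReal 0 1) =
      ∫ t, hermiteFun (k + 1) t • φ t ∂(gaussianReal 0 1) := by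
  rw [integrable_gaussianReal_iff] at h1 h2 h3
  rw [integral_gaussianReal_eq_integral_smul one_ne_zero,
    integral_gaussianReal_eq_integral_smul one_ne_zero]
  have := integral_bilinear_hasDerivAt_right_eq_neg_left_of_integrable
    (L := ContinuousLinearMap.lsmul ℝ ℝ)
    (u := fun t => gaussianPDFReal 0 1 t * hermiteFun k t) (v := φ)
    (u' := fun t => -(gaussianPDFReal 0 1 t * hermiteFun (k + 1) t)) (v' := φ')
    (fun t _ => hasDerivAt_gaussianPDFReal_mul_hermiteFun k t) (fun t _ => hφ t)
    (by simpa [mul_smul] using h1) (by simpa [mul_smul] using h2.neg) (by simpa [mul_smul] using h3)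
  simp only [ContinuousLinearMap.lsmul_apply, neg_smul, integral_neg, neg_neg, mul_smul] at this
  exact this

end OneDim

/-! ### Tensorized Hermite polynomials, integration by parts and orthogonality. -/

section Product

/-- Resampling one coordinate preserves the Gaussian product measure. -/
theorem measurePreserving_update (j : ℕ) :
    MeasurePreserving (fun p : (ℕ → ℝ) × ℝ => Function.update p.1 j p.2)
      (gammaU.prod (gaussianReal 0 1)) gammaU := by
  classical
  have hm : Measurable fun p : (ℕ → ℝ) × ℝ => Function.update p.1 j p.2 := by
    refine measurable_pi_lambda _ fun i => ?_
    by_cases hi : i = j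
    · subst hi; simpa using measurable_snd
    · simp only [Function.update_of_ne hi]
      exact (measurable_pi_apply i).comp measurable_fst
  refine ⟨hm, ?_⟩
  refine Measure.eq_infinitePi _ fun s t ht => ?_
  rw [Measure.map_apply hm (MeasurableSet.pi s.countable_toSet fun i _ => ht i)]
  have : (fun p : (ℕ → ℝ) × ℝ => Function.update p.1 j p.2) ⁻¹' (Set.pi s t) =
      (Set.pi (s.erase j : Finset ℕ) t) ×ˢ (if j ∈ s then t j else Set.univ) := by
    ext ⟨y, r⟩
    simp only [Set.mem_preimage, Set.mem_pi, Set.mem_prod, Finset.mem_coe, Finset.mem_erase]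
    constructor
    · intro h
      refine ⟨fun i hi => by simpa [Function.update_of_ne hi.1] using h i hi.2, ?_⟩
      split_ifs with hj
      · simpa using h j hj
      · trivial
    · rintro ⟨h1, h2⟩ i hi
      by_cases hij : i = j
      · subst hij; rw [if_pos hi] at h2; simpa using h2
      · simpa [Function.update_of_ne hij] using h1 i ⟨hij, hi⟩
  rw [this, Measure.prod_prod, gammaU, Measure.infinitePi_pi _ fun i _ => ht i]
  by_cases hj : j ∈ s
  · rw [if_pos hj, Finset.prod_erase_mul s (fun i => gaussianReal 0 1 (t i)) hj]
  · rw [if_neg hj, measure_univ, mul_one, Finset.erase_eq_of_notMem hj]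

/-- The tensorized monic Hermite polynomial. -/
def hermiteProd (κ : ℕ →₀ ℕ) (y : ℕ → ℝ) : ℝ := κ.prod fun j k => hermiteFun k (y j)

theorem hermiteProd_zero (y : ℕ → ℝ) : hermiteProd 0 y = 1 := Finsupp.prod_zero_index

/-- The factors of the tensorized Hermite polynomial outside of the coordinate `j`. -/
def hermiteProdErase (κ : ℕ →₀ ℕ) (j : ℕ) (y : ℕ → ℝ) : ℝ :=
  ∏ i ∈ κ.support.erase j, hermiteFun (κ i) (y i)

theorem hermiteProd_eq (κ : ℕ →₀ ℕ) (j : ℕ) (y : ℕ → ℝ) :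
    hermiteProd κ y = hermiteFun (κ j) (y j) * hermiteProdErase κ j y := by
  unfold hermiteProd hermiteProdErase Finsupp.prod
  by_cases hj : j ∈ κ.support
  · rw [Finset.mul_prod_erase _ (fun i => hermiteFun (κ i) (y i)) hj]
  · rw [Finset.erase_eq_of_notMem hj, Finsupp.notMem_support_iff.1 hj, hermiteFun_zero, one_mul]

theorem hermiteProdErase_congr {κ κ' : ℕ →₀ ℕ} {j : ℕ} (h : ∀ i, i ≠ j → κ i = κ' i)
    (y : ℕ → ℝ) : hermiteProdErase κ j y = hermiteProdErase κ' j y := by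
  unfold hermiteProdErase
  refine Finset.prod_congr ?_ fun i hi => by rw [h i (Finset.ne_of_mem_erase hi)]
  ext i
  simp only [Finset.mem_erase, Finsupp.mem_support_iff]
  constructor <;> rintro ⟨h1, h2⟩
  · exact ⟨h1, by rwa [← h i h1]⟩
  · exact ⟨h1, by rwa [h i h1]⟩

theorem hermiteProdErase_update (κ : ℕ →₀ ℕ) (j : ℕ) (y : ℕ → ℝ) (s : ℝ) :
    hermiteProdErase κ j (Function.update y j s) = hermiteProdErase κ j y := by
  unfold hermiteProdErase
  refine Finset.prod_congr rfl fun i hi => ?_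
  rw [Function.update_of_ne (Finset.ne_of_mem_erase hi)]

theorem hermiteProd_update (κ : ℕ →₀ ℕ) (j : ℕ) (y : ℕ → ℝ) (s : ℝ) :
    hermiteProd κ (Function.update y j s) = hermiteFun (κ j) s * hermiteProdErase κ j y := by
  rw [hermiteProd_eq κ j, Function.update_self, hermiteProdErase_update]

theorem hermiteProd_add_single_update (κ : ℕ →₀ ℕ) (j : ℕ) (y : ℕ → ℝ) (s : ℝ) :
    hermiteProd (κ + Finsupp.single j 1) (Function.update y j s) =
      hermiteFun (κ j + 1) s * hermiteProdErase κ j y := by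
  rw [hermiteProd_update, hermiteProdErase_congr (κ' := κ)]
  · simp
  · intro i hi; simp [hi.symm]

/-- If `κ j = 0`, the truncated difference `κ - e_j` is harmless because its coefficient vanishes.
-/
theorem hermiteProd_add_single (κ : ℕ →₀ ℕ) (j : ℕ) (y : ℕ → ℝ) :
    hermiteProd (κ + Finsupp.single j 1) y =
      y j * hermiteProd κ y - κ j * hermiteProd (κ - Finsupp.single j 1) y := by
  rw [hermiteProd_eq (κ + Finsupp.single j 1) j, hermiteProd_eq κ j,
    hermiteProd_eq (κ - Finsupp.single j 1) j,
    hermiteProdErase_congr (κ := κ + Finsupp.single j 1) (κ' := κ) (fun i hi => by simp [hi.symm]),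
    hermiteProdErase_congr (κ := κ - Finsupp.single j 1) (κ' := κ) (fun i hi => by simp [hi.symm])]
  simp only [Finsupp.add_apply, Finsupp.single_eq_same, hermiteFun_succ', Finsupp.tsub_apply]
  ring

theorem memLp_finset_prod (S : Finset ℕ) (f : ℕ → ℝ → ℝ)
    (hf : ∀ j, ∀ r : ℝ≥0∞, r ≠ ⊤ → MemLp (f j) r (gaussianReal 0 1)) {r : ℝ≥0∞} (hr : r ≠ ⊤) :
    MemLp (fun y : ℕ → ℝ => ∏ j ∈ S, f j (y j)) r gammaU := by
  classical
  induction S using Finset.induction_on generalizing r with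
  | empty => simpa using memLp_const (1 : ℝ)
  | insert j S hj ih =>
    simp only [Finset.prod_insert hj]
    have h2 : r * 2 ≠ ⊤ := ENNReal.mul_ne_top hr (by simp)
    have : ENNReal.HolderTriple (r * 2) (r * 2) r := ⟨by
      rw [ENNReal.mul_inv (by simp) (by simp), ← mul_add, ENNReal.inv_two_add_inv_two, mul_one]⟩
    exact (ih h2).mul ((hf j _ h2).comp_measurePreserving
      (measurePreserving_eval_infinitePi (fun _ : ℕ => gaussianReal 0 1) j))

theorem memLp_hermiteProd (κ : ℕ →₀ ℕ) {r : ℝ≥0∞} (hr : r ≠ ⊤) :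
    MemLp (hermiteProd κ) r gammaU :=
  memLp_finset_prod κ.support (fun j => hermiteFun (κ j)) (fun _ _ h => memLp_hermiteFun _ h) hr

variable {W : Type*} [NormedAddCommGroup W] [NormedSpace ℝ W]

theorem integrable_hermiteProd_smul (κ : ℕ →₀ ℕ) {F : (ℕ → ℝ) → W} (hF : MemLp F 2 gammaU) :
    Integrable (fun y => hermiteProd κ y • F y) gammaU :=
  (hF.smul (memLp_hermiteProd κ (r := 2) (by simp))).integrable le_rfl

/-- Gaussian integration by parts in one coordinate. -/
theorem integral_hermiteProd_smul_deriv (κ : ℕ →₀ ℕ) (j : ℕ) {F F' : (ℕ → ℝ) → W}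
    (hF : MemLp F 2 gammaU) (hF' : MemLp F' 2 gammaU)
    (hd : ∀ᵐ y ∂gammaU, ∀ s, HasDerivAt (fun s => F (Function.update y j s))
      (F' (Function.update y j s)) s) :
    ∫ y, hermiteProd κ y • F' y ∂gammaU =
      ∫ y, hermiteProd (κ + Finsupp.single j 1) y • F y ∂gammaU := by
  have hmp := measurePreserving_update j
  -- Resampling coordinate `j` and Fubini reduce the claim to the one-dimensional formula for almost
  -- every `y`.
  have key : ∀ Φ : (ℕ → ℝ) → W, Integrable Φ gammaU →
      Integrable (fun p : (ℕ → ℝ) × ℝ => Φ (Function.update p.1 j p.2))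
        (gammaU.prod (gaussianReal 0 1)) ∧
      ∫ y, Φ y ∂gammaU = ∫ y, ∫ s, Φ (Function.update y j s) ∂(gaussianReal 0 1) ∂gammaU := by
    intro Φ hΦ
    have h1 : Integrable (fun p : (ℕ → ℝ) × ℝ => Φ (Function.update p.1 j p.2))
        (gammaU.prod (gaussianReal 0 1)) := hmp.integrable_comp_of_integrable hΦ
    refine ⟨h1, ?_⟩
    rw [← integral_prod (fun p : (ℕ → ℝ) × ℝ => Φ (Function.update p.1 j p.2)) h1,
      ← hmp.map_eq, integral_map hmp.measurable.aemeasurable (by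
        rw [hmp.map_eq]; exact hΦ.aestronglyMeasurable), hmp.map_eq]
  obtain ⟨i1, e1⟩ := key _ (integrable_hermiteProd_smul κ hF')
  obtain ⟨i2, e2⟩ := key _ (integrable_hermiteProd_smul (κ + Finsupp.single j 1) hF)
  obtain ⟨i3, e3⟩ := key _ (integrable_hermiteProd_smul κ hF)
  rw [e1, e2]
  refine integral_congr_ae ?_
  filter_upwards [hd, i1.prod_right_ae, i2.prod_right_ae, i3.prod_right_ae] with y hy h1 h2 h3
  simp only [hermiteProd_add_single_update] at h2 ⊢
  simp only [hermiteProd_update, mul_smul] at h1 h2 h3 ⊢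
  exact integral_hermiteFun_smul_deriv (κ j)
    (φ := fun s => hermiteProdErase κ j y • F (Function.update y j s))
    (fun s => (hy s).const_smul _) h1 h2 h3

theorem hasDerivAt_hermiteProd_update (κ : ℕ →₀ ℕ) (j : ℕ) (y : ℕ → ℝ) (s : ℝ) :
    HasDerivAt (fun s => hermiteProd κ (Function.update y j s))
      (κ j * hermiteProd (κ - Finsupp.single j 1) (Function.update y j s)) s := by
  simp only [hermiteProd_update]
  rw [hermiteProdErase_congr (κ := κ - Finsupp.single j 1) (κ' := κ)
    (fun i hi => by simp [hi.symm]), ← mul_assoc]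
  refine (hasDerivAt_hermiteFun (κ j) s).mul_const _ |>.congr_deriv ?_
  simp

/-- `κ! = ∏_j κ_j!`. -/
def multiFactorial (κ : ℕ →₀ ℕ) : ℝ := κ.prod fun _ k => (k.factorial : ℝ)

theorem multiFactorial_pos (κ : ℕ →₀ ℕ) : 0 < multiFactorial κ :=
  Finset.prod_pos fun j _ => by positivity

theorem multiFactorial_add_single (κ : ℕ →₀ ℕ) (j : ℕ) :
    multiFactorial (κ + Finsupp.single j 1) = (κ j + 1) * multiFactorial κ := by
  obtain ⟨P, h1, h2⟩ := prod_add_single_eq (fun _ k => (k.factorial : ℝ)) (by simp) κ j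
  unfold multiFactorial
  rw [h1, h2, Nat.factorial_succ]
  push_cast; ring

theorem exists_eq_add_single {κ : ℕ →₀ ℕ} (h : κ ≠ 0) :
    ∃ (κ' : ℕ →₀ ℕ) (j : ℕ), κ = κ' + Finsupp.single j 1 := by
  obtain ⟨j, hj⟩ := Finsupp.support_nonempty_iff.2 h
  refine ⟨κ - Finsupp.single j 1, j, (tsub_add_cancel_of_le ?_).symm⟩
  rw [Finsupp.single_le_iff]
  exact Nat.one_le_iff_ne_zero.2 (Finsupp.mem_support_iff.1 hj)

theorem multiIndex_induction {P : (ℕ →₀ ℕ) → Prop} (h0 : P 0)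
    (h1 : ∀ κ j, P κ → P (κ + Finsupp.single j 1)) (κ : ℕ →₀ ℕ) : P κ := by
  induction κ using WellFoundedLT.induction with
  | ind κ ih =>
    by_cases hκ : κ = 0
    · rw [hκ]; exact h0
    · obtain ⟨κ', j, rfl⟩ := exists_eq_add_single hκ
      refine h1 _ _ (ih κ' ?_)
      exact lt_add_of_pos_right _ (pos_iff_ne_zero.2 (by simp))

theorem integral_hermiteProd_succ_mul (κ l : ℕ →₀ ℕ) (j : ℕ) :
    ∫ y, hermiteProd (κ + Finsupp.single j 1) y * hermiteProd l y ∂gammaU =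
      l j * ∫ y, hermiteProd κ y * hermiteProd (l - Finsupp.single j 1) y ∂gammaU := by
  have := integral_hermiteProd_smul_deriv κ j (F := hermiteProd l)
    (F' := fun y => l j * hermiteProd (l - Finsupp.single j 1) y)
    (memLp_hermiteProd _ (by simp)) ((memLp_hermiteProd _ (by simp)).const_mul _)
    (ae_of_all _ fun y s => hasDerivAt_hermiteProd_update l j y s)
  simp only [smul_eq_mul] at this
  rw [← this, ← integral_const_mul]
  exact integral_congr_ae (ae_of_all _ fun y => by ring)

/-- Integration by parts lowers `κ` and `l` together in one coordinate, producing the factor `l j`;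
iteration gives the factorial on the diagonal and zero elsewhere. -/
theorem integral_hermiteProd_mul (κ l : ℕ →₀ ℕ) :
    ∫ y, hermiteProd κ y * hermiteProd l y ∂gammaU = if κ = l then multiFactorial κ else 0 := by
  induction κ using multiIndex_induction generalizing l with
  | h0 =>
    by_cases hl : l = 0
    · subst hl; simp [hermiteProd_zero, multiFactorial]
    · rw [if_neg (Ne.symm hl)]
      obtain ⟨l', j, rfl⟩ := exists_eq_add_single hl
      have := integral_hermiteProd_succ_mul l' 0 j
      simp only [Finsupp.coe_zero, Pi.zero_apply, Nat.cast_zero, zero_mul] at this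
      rw [← this]
      exact integral_congr_ae (ae_of_all _ fun y => mul_comm _ _)
  | h1 κ j ih =>
    rw [integral_hermiteProd_succ_mul, ih]
    by_cases hl : l j = 0
    · rw [hl, Nat.cast_zero, zero_mul, if_neg]
      rintro rfl
      simp at hl
    · have hle : Finsupp.single j 1 ≤ l := by
        rw [Finsupp.single_le_iff]; omega
      by_cases h : κ = l - Finsupp.single j 1
      · have h' : κ + Finsupp.single j 1 = l := by rw [h]; exact tsub_add_cancel_of_le hle
        rw [if_pos h, if_pos h', multiFactorial_add_single, ← h']
        simp
      · rw [if_neg h, if_neg, mul_zero]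
        rintro rfl
        simp at h

end Product

/-! ### Completeness of the Hermite system in `L²(γ)`. -/

section Completeness

/-- The linear span of the tensorized Hermite polynomials. -/
def hermiteSpan : Submodule ℝ ((ℕ → ℝ) → ℝ) := Submodule.span ℝ (Set.range hermiteProd)

theorem coord_mul_mem_hermiteSpan {f : (ℕ → ℝ) → ℝ} (hf : f ∈ hermiteSpan) (j : ℕ) :
    (fun y => y j * f y) ∈ hermiteSpan := by
  let T : ((ℕ → ℝ) → ℝ) →ₗ[ℝ] ((ℕ → ℝ) → ℝ) :=
    { toFun := fun f y => y j * f y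
      map_add' := fun f g => by funext y; simp [mul_add]
      map_smul' := fun c f => by funext y; simp; ring }
  have : hermiteSpan ≤ hermiteSpan.comap T := by
    refine Submodule.span_le.2 ?_
    rintro _ ⟨κ, rfl⟩
    have h : T (hermiteProd κ) = hermiteProd (κ + Finsupp.single j 1) +
        (κ j : ℝ) • hermiteProd (κ - Finsupp.single j 1) := by
      funext y
      simp [T, hermiteProd_add_single]
    change T (hermiteProd κ) ∈ hermiteSpan
    rw [h]
    exact add_mem (Submodule.subset_span ⟨_, rfl⟩)
      (Submodule.smul_mem _ _ (Submodule.subset_span ⟨_, rfl⟩))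
  exact this hf

theorem linear_pow_mem_hermiteSpan (S : Finset ℕ) (c : ℕ → ℝ) (n : ℕ) :
    (fun y : ℕ → ℝ => (∑ j ∈ S, c j * y j) ^ n) ∈ hermiteSpan := by
  induction n with
  | zero =>
    refine Submodule.subset_span ⟨0, ?_⟩
    funext y; simp [hermiteProd_zero]
  | succ n ih =>
    have : (fun y : ℕ → ℝ => (∑ j ∈ S, c j * y j) ^ (n + 1)) =
        ∑ j ∈ S, c j • fun y : ℕ → ℝ => y j * (∑ j ∈ S, c j * y j) ^ n := by
      funext y
      simp only [pow_succ', Finset.sum_apply, Pi.smul_apply, smul_eq_mul, Finset.sum_mul]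
      refine Finset.sum_congr rfl fun j _ => ?_
      ring
    rw [this]
    exact Submodule.sum_mem _ fun j _ => Submodule.smul_mem _ _ (coord_mul_mem_hermiteSpan ih j)

theorem memLp_of_mem_hermiteSpan {f : (ℕ → ℝ) → ℝ} (hf : f ∈ hermiteSpan) : MemLp f 2 gammaU := by
  refine Submodule.span_induction (p := fun f _ => MemLp f 2 gammaU) ?_ ?_ ?_ ?_ hf
  · rintro _ ⟨κ, rfl⟩; exact memLp_hermiteProd κ (by simp)
  · exact MemLp.zero
  · intro f g _ _ hf hg; exact hf.add hg
  · intro c f _ hf; exact hf.const_smul c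

variable {g : (ℕ → ℝ) → ℝ}

theorem integral_mul_eq_zero_of_mem_hermiteSpan (hg : MemLp g 2 gammaU)
    (h : ∀ κ, ∫ y, hermiteProd κ y * g y ∂gammaU = 0) {f : (ℕ → ℝ) → ℝ} (hf : f ∈ hermiteSpan) :
    ∫ y, f y * g y ∂gammaU = 0 := by
  refine Submodule.span_induction (p := fun f _ => ∫ y, f y * g y ∂gammaU = 0) ?_ ?_ ?_ ?_ hf
  · rintro _ ⟨κ, rfl⟩; exact h κ
  · simp
  · intro f₁ f₂ h₁ h₂ e₁ e₂
    have i₁ : Integrable (fun y => f₁ y * g y) gammaU :=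
      (memLp_of_mem_hermiteSpan h₁).integrable_mul hg
    have i₂ : Integrable (fun y => f₂ y * g y) gammaU :=
      (memLp_of_mem_hermiteSpan h₂).integrable_mul hg
    simp only [Pi.add_apply, add_mul]
    rw [integral_add i₁ i₂, e₁, e₂, add_zero]
  · intro c f _ e
    simp only [Pi.smul_apply, smul_eq_mul, mul_assoc]
    rw [integral_const_mul, e, mul_zero]

theorem memLp_exp_mul_abs (c : ℝ) {r : ℝ≥0∞} (hr : r ≠ ⊤) :
    MemLp (fun t : ℝ => Real.exp (c * |t|)) r (gaussianReal 0 1) := by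
  have hm : AEStronglyMeasurable (fun t : ℝ => Real.exp (c * |t|)) (gaussianReal 0 1) :=
    (by fun_prop : Continuous fun t : ℝ => Real.exp (c * |t|)).aestronglyMeasurable
  by_cases h0 : r = 0
  · rw [h0]; exact memLp_zero_iff_aestronglyMeasurable.2 hm
  rw [← integrable_norm_rpow_iff hm h0 hr]
  have : (fun t : ℝ => ‖Real.exp (c * |t|)‖ ^ r.toReal) =
      fun t : ℝ => Real.exp ((c * r.toReal) * |t|) := by
    funext t
    rw [Real.norm_of_nonneg (Real.exp_pos _).le, ← Real.exp_mul]
    ring_nf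
  rw [this]
  exact integrable_exp_mul_abs (X := fun t : ℝ => t) (integrable_exp_mul_gaussianReal _)
    (integrable_exp_mul_gaussianReal _)

theorem memLp_exp_abs_linear (S : Finset ℕ) (c : ℕ → ℝ) :
    MemLp (fun y : ℕ → ℝ => Real.exp |∑ j ∈ S, c j * y j|) 2 gammaU := by
  have h := memLp_finset_prod S (fun j t => Real.exp (|c j| * |t|))
    (fun j r hr => memLp_exp_mul_abs _ hr) (r := 2) (by simp)
  have hm : Measurable fun y : ℕ → ℝ => ∑ j ∈ S, c j * y j := by fun_prop
  have hm' : Measurable fun y : ℕ → ℝ => Real.exp |∑ j ∈ S, c j * y j| :=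
    Real.measurable_exp.comp (measurable_norm.comp hm)
  refine h.mono hm'.aestronglyMeasurable (ae_of_all _ fun y => ?_)
  rw [Real.norm_of_nonneg (Real.exp_pos _).le, ← Real.exp_sum,
    Real.norm_of_nonneg (Real.exp_pos _).le]
  refine Real.exp_le_exp.2 ((Finset.abs_sum_le_sum_abs _ _).trans (le_of_eq ?_))
  simp only [abs_mul]

/-- The exponential series is integrated term by term, with dominating function `e^|l| |g|`; each
power of `l` lies in the Hermite span. -/
theorem integral_cexp_linear_mul_eq_zero (hg : MemLp g 2 gammaU)
    (h : ∀ κ, ∫ y, hermiteProd κ y * g y ∂gammaU = 0) (S : Finset ℕ) (c : ℕ → ℝ) :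
    ∫ y, Complex.exp ((∑ j ∈ S, c j * y j : ℝ) * Complex.I) * (g y : ℂ) ∂gammaU = 0 := by
  set l : (ℕ → ℝ) → ℝ := fun y => ∑ j ∈ S, c j * y j with hl
  have hln : ∀ n : ℕ, Integrable (fun y => l y ^ n * g y) gammaU := fun n =>
    (memLp_of_mem_hermiteSpan (linear_pow_mem_hermiteSpan S c n)).integrable_mul hg
  let F : ℕ → (ℕ → ℝ) → ℂ := fun n y =>
    (Complex.I ^ n / (n.factorial : ℂ)) * ((l y ^ n * g y : ℝ) : ℂ)
  have hFi : ∀ n, Integrable (F n) gammaU := fun n => (hln n).ofReal.const_mul _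
  have hFn : ∀ n y, ‖F n y‖ = |l y| ^ n / n.factorial * |g y| := fun n y => by
    simp only [F, norm_mul, norm_div, norm_pow, Complex.norm_I, one_pow, Complex.norm_natCast,
      Complex.norm_real, Real.norm_eq_abs]
    ring
  have hdom : Integrable (fun y => Real.exp |l y| * |g y|) gammaU :=
    (memLp_exp_abs_linear S c).integrable_mul hg.abs
  have hsum : Summable fun n => ∫ y, ‖F n y‖ ∂gammaU := by
    refine summable_of_sum_range_le (c := ∫ y, Real.exp |l y| * |g y| ∂gammaU)
      (fun n => integral_nonneg fun y => norm_nonneg _) fun N => ?_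
    rw [← integral_finsetSum _ fun n _ => (hFi n).norm]
    refine integral_mono (integrable_finsetSum _ fun n _ => (hFi n).norm) hdom fun y => ?_
    simp only [hFn, ← Finset.sum_mul]
    exact mul_le_mul_of_nonneg_right (Real.sum_le_exp_of_nonneg (abs_nonneg _) N) (abs_nonneg _)
  have h1 := hasSum_integral_of_summable_integral_norm hFi hsum
  have h2 : ∀ n, ∫ y, F n y ∂gammaU = 0 := fun n => by
    have : ∫ y, ((l y ^ n * g y : ℝ) : ℂ) ∂gammaU = 0 := by
      have e := integral_mul_eq_zero_of_mem_hermiteSpan hg h (linear_pow_mem_hermiteSpan S c n)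
      rw [integral_complex_ofReal, e, Complex.ofReal_zero]
    simp only [F]
    rw [integral_const_mul, this, mul_zero]
  have h3 : ∀ y, ∑' n, F n y = Complex.exp (l y * Complex.I) * (g y : ℂ) := fun y => by
    have e1 := (NormedSpace.expSeries_div_hasSum_exp ((l y : ℂ) * Complex.I)).mul_right (g y : ℂ)
    rw [← Complex.exp_eq_exp_ℂ] at e1
    rw [← e1.tsum_eq]
    refine tsum_congr fun n => ?_
    simp only [F]
    push_cast
    rw [mul_pow]; ring
  simp only [h2, h3] at h1
  exact h1.unique hasSum_zero

/-- The finite measures with densities `g⁺` and `g⁻` have equal characteristic functions on all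
finite sets of coordinates. Hence their marginals agree, the measures agree, and `g⁺ = g⁻` almost
everywhere. -/
theorem ae_eq_zero_of_integral_hermiteProd_mul_eq_zero (hg : MemLp g 2 gammaU)
    (h : ∀ κ, ∫ y, hermiteProd κ y * g y ∂gammaU = 0) : g =ᵐ[gammaU] 0 := by
  have hgi : Integrable g gammaU := hg.integrable one_le_two
  let P : Measure (ℕ → ℝ) := gammaU.withDensity fun y => ENNReal.ofReal (g y)
  let N : Measure (ℕ → ℝ) := gammaU.withDensity fun y => ENNReal.ofReal (-g y)
  have hPf : IsFiniteMeasure P := isFiniteMeasure_withDensity_ofReal hgi.2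
  have hNf : IsFiniteMeasure N := isFiniteMeasure_withDensity_ofReal hgi.neg.2
  have hPN : P = N := by
    have key : ∀ S : Finset ℕ, P.map S.restrict = N.map S.restrict := by
      intro S
      refine Measure.ext_of_charFunDual (funext fun L => ?_)
      let c : ℕ → ℝ := fun j => if hj : j ∈ S then L (Pi.single ⟨j, hj⟩ 1) else 0
      have hL : ∀ y : ℕ → ℝ, L (S.restrict y) = ∑ j ∈ S, c j * y j := fun y => by
        have e1 : S.restrict y = ∑ j : S, (y j) • (Pi.single j (1 : ℝ) : S → ℝ) := by
          funext i
          simp [Pi.single_apply]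
        rw [e1, map_sum, ← Finset.sum_coe_sort S]
        refine Finset.sum_congr rfl fun j _ => ?_
        simp [c, mul_comm]
      have hmeas : AEStronglyMeasurable
          (fun v : S → ℝ => Complex.exp ((L v : ℂ) * Complex.I)) (P.map S.restrict) :=
        (by fun_prop : Continuous fun v : S → ℝ =>
          Complex.exp ((L v : ℂ) * Complex.I)).aestronglyMeasurable
      have hmeas' : AEStronglyMeasurable
          (fun v : S → ℝ => Complex.exp ((L v : ℂ) * Complex.I)) (N.map S.restrict) :=
        (by fun_prop : Continuous fun v : S → ℝ =>
          Complex.exp ((L v : ℂ) * Complex.I)).aestronglyMeasurable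
      have hr : Measurable (S.restrict : (ℕ → ℝ) → (S → ℝ)) := Finset.measurable_restrict S
      rw [charFunDual_apply, charFunDual_apply, integral_map hr.aemeasurable hmeas,
        integral_map hr.aemeasurable hmeas']
      simp only [hL]
      have hE : Measurable fun y : ℕ → ℝ =>
          Complex.exp (((∑ j ∈ S, c j * y j : ℝ) : ℂ) * Complex.I) := by fun_prop
      have hgm : AEMeasurable g gammaU := hgi.aestronglyMeasurable.aemeasurable
      have hgm' : AEMeasurable (fun y => -g y) gammaU := hgm.neg
      rw [integral_withDensity_eq_integral_toReal_smul₀ hgm.ennreal_ofReal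
          (ae_of_all _ fun _ => ENNReal.ofReal_lt_top),
        integral_withDensity_eq_integral_toReal_smul₀ hgm'.ennreal_ofReal
          (ae_of_all _ fun _ => ENNReal.ofReal_lt_top), ← sub_eq_zero, ← integral_sub]
      · rw [← integral_cexp_linear_mul_eq_zero hg h S c]
        refine integral_congr_ae (ae_of_all _ fun y => ?_)
        simp only [ENNReal.toReal_ofReal', ← sub_smul]
        have : max (g y) 0 - max (-g y) 0 = g y := by
          rcases le_total 0 (g y) with h | h
          · rw [max_eq_left h, max_eq_right (by linarith), sub_zero]
          · rw [max_eq_right h, max_eq_left (by linarith)]; ring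
        rw [this, Complex.real_smul, mul_comm]
      · refine (hgi.pos_part).smul_bdd 1 hE.aestronglyMeasurable (ae_of_all _ fun y => ?_) |>.congr ?_
        · rw [Complex.norm_exp_ofReal_mul_I]
        · exact ae_of_all _ fun y => by simp [ENNReal.toReal_ofReal']
      · refine (hgi.neg_part).smul_bdd 1 hE.aestronglyMeasurable (ae_of_all _ fun y => ?_) |>.congr ?_
        · rw [Complex.norm_exp_ofReal_mul_I]
        · exact ae_of_all _ fun y => by simp [ENNReal.toReal_ofReal']
    have h1 : IsProjectiveLimit P fun S : Finset ℕ => N.map S.restrict := fun S => key S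
    have h2 : IsProjectiveLimit N fun S : Finset ℕ => N.map S.restrict := fun S => rfl
    exact h1.unique h2
  have hgm : AEMeasurable g gammaU := hgi.aestronglyMeasurable.aemeasurable
  have hgm' : AEMeasurable (fun y => -g y) gammaU := hgm.neg
  have := (withDensity_eq_iff hgm.ennreal_ofReal hgm'.ennreal_ofReal (by
    have := hPf.measure_univ_lt_top
    rw [withDensity_apply _ MeasurableSet.univ, Measure.restrict_univ] at this
    exact this.ne)).1 hPN
  filter_upwards [this] with y hy
  simp only [Pi.zero_apply]
  rcases lt_trichotomy (g y) 0 with h | h | h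
  · simp only [ENNReal.ofReal_of_nonpos h.le] at hy
    have := ENNReal.ofReal_eq_zero.1 hy.symm
    linarith
  · exact h
  · have h2 : ENNReal.ofReal (-g y) = 0 := ENNReal.ofReal_of_nonpos (by linarith)
    exact (ENNReal.ofReal_eq_zero.1 (hy.trans h2)).antisymm h.le

end Completeness

/-! ### Parseval's identity for `V`-valued functions. -/

section Parseval

theorem hermiteT_eq (ν : ℕ →₀ ℕ) (y : ℕ → ℝ) :
    hermiteT ν y = (Real.sqrt (multiFactorial ν))⁻¹ * hermiteProd ν y := by
  unfold hermiteT hermiteProd multiFactorial Finsupp.prod hermiteN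
  rw [Finset.prod_div_distrib, Real.sqrt_prod _ fun j _ => by positivity, inv_mul_eq_div]
  rfl

theorem memLp_hermiteT (ν : ℕ →₀ ℕ) {r : ℝ≥0∞} (hr : r ≠ ⊤) : MemLp (hermiteT ν) r gammaU := by
  have : hermiteT ν = fun y => (Real.sqrt (multiFactorial ν))⁻¹ * hermiteProd ν y :=
    funext (hermiteT_eq ν)
  rw [this]; exact (memLp_hermiteProd ν hr).const_mul _

theorem integral_hermiteT_mul (κ l : ℕ →₀ ℕ) :
    ∫ y, hermiteT κ y * hermiteT l y ∂gammaU = if κ = l then 1 else 0 := by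
  simp only [hermiteT_eq]
  have : ∀ y, (Real.sqrt (multiFactorial κ))⁻¹ * hermiteProd κ y *
      ((Real.sqrt (multiFactorial l))⁻¹ * hermiteProd l y) =
      ((Real.sqrt (multiFactorial κ))⁻¹ * (Real.sqrt (multiFactorial l))⁻¹) *
        (hermiteProd κ y * hermiteProd l y) := fun y => by ring
  simp only [this]
  rw [integral_const_mul, integral_hermiteProd_mul]
  split_ifs with h
  · subst h
    rw [← mul_inv, Real.mul_self_sqrt (multiFactorial_pos κ).le,
      inv_mul_cancel₀ (multiFactorial_pos κ).ne']
  · rw [mul_zero]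

variable {V : Type*} [NormedAddCommGroup V] [InnerProductSpace ℝ V]

theorem integrable_hermiteT_smul (κ : ℕ →₀ ℕ) {F : (ℕ → ℝ) → V} (hF : MemLp F 2 gammaU) :
    Integrable (fun y => hermiteT κ y • F y) gammaU :=
  (hF.smul (memLp_hermiteT κ (r := 2) (by simp))).integrable le_rfl

theorem memLp_hermiteT_smul_const (ν : ℕ →₀ ℕ) (v : V) :
    MemLp (fun y => hermiteT ν y • v) 2 gammaU :=
  (memLp_const v (p := ⊤)).smul (memLp_hermiteT ν (r := 2) (by simp))

variable [CompleteSpace V]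

theorem integral_hermiteT_smul_hermiteT_smul (κ l : ℕ →₀ ℕ) (v : V) :
    ∫ y, hermiteT κ y • hermiteT l y • v ∂gammaU = if κ = l then v else 0 := by
  simp only [smul_smul]
  rw [integral_smul_const, integral_hermiteT_mul]
  split_ifs <;> simp

/-- The embedding `v ↦ H_ν v` of `V` into `L²(U, V, γ)`, as a linear map. -/
def hermiteEmbₗ (ν : ℕ →₀ ℕ) : V →ₗ[ℝ] Lp V 2 gammaU where
  toFun v := (memLp_hermiteT_smul_const ν v).toLp _
  map_add' v w := by
    rw [← MemLp.toLp_add]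
    exact MemLp.toLp_congr _ _ (ae_of_all _ fun y => by simp)
  map_smul' c v := by
    rw [RingHom.id_apply, ← MemLp.toLp_const_smul]
    exact MemLp.toLp_congr _ _ (ae_of_all _ fun y => by simp [smul_comm c])

theorem inner_hermiteEmbₗ (ν : ℕ →₀ ℕ) (v : V) (w : Lp V 2 gammaU) :
    inner ℝ (hermiteEmbₗ ν v) w = inner ℝ v (∫ y, hermiteT ν y • w y ∂gammaU) := by
  rw [L2.inner_def, ← integral_inner (integrable_hermiteT_smul ν (Lp.memLp w))]
  refine integral_congr_ae ?_
  filter_upwards [(memLp_hermiteT_smul_const ν v).coeFn_toLp] with y hy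
  simp only [hermiteEmbₗ, LinearMap.coe_mk, AddHom.coe_mk, hy]
  rw [inner_smul_left, inner_smul_right]; simp

theorem integral_hermiteT_smul_hermiteEmbₗ (κ l : ℕ →₀ ℕ) (v : V) :
    ∫ y, hermiteT κ y • hermiteEmbₗ l v y ∂gammaU = if κ = l then v else 0 := by
  rw [← integral_hermiteT_smul_hermiteT_smul κ l v]
  refine integral_congr_ae ?_
  filter_upwards [(memLp_hermiteT_smul_const l v).coeFn_toLp] with y hy
  simp only [hermiteEmbₗ, LinearMap.coe_mk, AddHom.coe_mk, hy]

/-- The isometric embedding `v ↦ H_ν v` of `V` into `L²(U, V, γ)`. -/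
def hermiteEmb (ν : ℕ →₀ ℕ) : V →ₗᵢ[ℝ] Lp V 2 gammaU where
  toLinearMap := hermiteEmbₗ ν
  norm_map' v := by
    have : ‖hermiteEmbₗ ν v‖ ^ 2 = ‖v‖ ^ 2 := by
      rw [← real_inner_self_eq_norm_sq, inner_hermiteEmbₗ, integral_hermiteT_smul_hermiteEmbₗ,
        if_pos rfl, real_inner_self_eq_norm_sq]
    exact (sq_eq_sq₀ (norm_nonneg _) (norm_nonneg _)).1 this

/-- Continuous functionals reduce this to scalar completeness. `V` need not be separable: `w` has
almost all its values in a separable set. -/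
theorem ae_eq_zero_of_hermite_orthogonal (w : Lp V 2 gammaU)
    (h : ∀ ν, ∫ y, hermiteT ν y • w y ∂gammaU = 0) : w = 0 := by
  have hsep : ∃ t : Set V, TopologicalSpace.IsSeparable t ∧ ∀ᵐ y ∂gammaU, w y ∈ t :=
    (Lp.aestronglyMeasurable w).isSeparable_ae_range
  obtain ⟨t, ht, hwt⟩ := hsep
  have hz : w =ᵐ[gammaU] (0 : (ℕ → ℝ) → V) := by
    refine ae_eq_zero_of_forall_dual_of_isSeparable ℝ ht (fun c => ?_) hwt
    have hc : MemLp (fun y => c (w y)) 2 gammaU := c.comp_memLp' (Lp.memLp w)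
    refine ae_eq_zero_of_integral_hermiteProd_mul_eq_zero hc fun κ => ?_
    have h1 := congrArg c (h κ)
    rw [← c.integral_comp_comm (integrable_hermiteT_smul κ (Lp.memLp w)), map_zero] at h1
    simp only [hermiteT_eq, map_smul, smul_eq_mul, mul_assoc] at h1
    rw [integral_const_mul] at h1
    refine (mul_eq_zero.1 h1).resolve_left ?_
    have := Real.sqrt_pos.2 (multiFactorial_pos κ)
    positivity
  exact Lp.ext (hz.trans (Lp.coeFn_zero _ _ _).symm)

theorem isHilbertSum_hermiteEmb :
    IsHilbertSum ℝ (fun _ : ℕ →₀ ℕ => V) (hermiteEmb (V := V)) := by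
  refine IsHilbertSum.mk ?_ ?_
  · intro κ l hkl v w
    change inner ℝ (hermiteEmbₗ κ v) (hermiteEmbₗ l w) = 0
    rw [inner_hermiteEmbₗ, integral_hermiteT_smul_hermiteEmbₗ, if_neg hkl, inner_zero_right]
  · rw [top_le_iff, Submodule.topologicalClosure_eq_top_iff, Submodule.eq_bot_iff]
    intro w hw
    refine ae_eq_zero_of_hermite_orthogonal w fun ν => ?_
    have h1 : ∀ v : V, inner ℝ v (∫ y, hermiteT ν y • w y ∂gammaU) = 0 := fun v => by
      rw [← inner_hermiteEmbₗ]
      refine (Submodule.mem_orthogonal _ _).1 hw _ ?_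
      exact (le_iSup (fun i => LinearMap.range (hermiteEmb (V := V) i).toLinearMap) ν) ⟨v, rfl⟩
    exact inner_self_eq_zero.1 (h1 _)

/-- Parseval's identity for the Hermite expansion in `L²(U, V, γ)`. -/
theorem hasSum_norm_sq_hermite {w : (ℕ → ℝ) → V} (hw : MemLp w 2 gammaU) :
    HasSum (fun ν => ‖∫ y, hermiteT ν y • w y ∂gammaU‖ ^ 2) (∫ y, ‖w y‖ ^ 2 ∂gammaU) := by
  classical
  set W : Lp V 2 gammaU := hw.toLp w with hW
  have hS := isHilbertSum_hermiteEmb (V := V)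
  have hcoef : ∀ ν, hS.linearIsometryEquiv W ν = ∫ y, hermiteT ν y • w y ∂gammaU := fun ν => by
    have e1 : ∫ y, hermiteT ν y • W y ∂gammaU = ∫ y, hermiteT ν y • w y ∂gammaU :=
      integral_congr_ae (hw.coeFn_toLp.mono fun y hy => by simp only [hW, hy])
    rw [← e1]
    refine ext_inner_left ℝ fun v => ?_
    rw [← inner_hermiteEmbₗ]
    have e2 := lp.inner_single_left (𝕜 := ℝ) ν v (hS.linearIsometryEquiv W)
    rw [← e2, ← LinearIsometryEquiv.inner_map_map hS.linearIsometryEquiv.symm,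
      LinearIsometryEquiv.symm_apply_apply, hS.linearIsometryEquiv_symm_apply_single]
    rfl
  have h1 := lp.hasSum_norm (p := 2) (by simp) (hS.linearIsometryEquiv W)
  simp only [hcoef, LinearIsometryEquiv.norm_map, ENNReal.toReal_ofNat, Real.rpow_ofNat] at h1
  have e3 : ‖W‖ ^ 2 = ∫ y, ‖w y‖ ^ 2 ∂gammaU := by
    rw [norm_sq_eq_integral]
    exact integral_congr_ae (hw.coeFn_toLp.mono fun y hy => by simp only [hW, hy])
  rwa [e3] at h1

/-- Parseval for the remainder, whose Hermite coefficients are those of `w` with the ones in `Λ`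
deleted. -/
theorem hasSum_norm_sq_hermite_sub {w : (ℕ → ℝ) → V} (hw : MemLp w 2 gammaU)
    (Λ : Finset (ℕ →₀ ℕ)) :
    HasSum (fun ν => if ν ∈ Λ then 0 else ‖∫ y, hermiteT ν y • w y ∂gammaU‖ ^ 2)
      (∫ y, ‖w y - ∑ ν ∈ Λ, hermiteT ν y • ∫ z, hermiteT ν z • w z ∂gammaU‖ ^ 2 ∂gammaU) := by
  have hsum : MemLp (fun y => ∑ ν ∈ Λ, hermiteT ν y • ∫ z, hermiteT ν z • w z ∂gammaU) 2 gammaU :=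
    memLp_finsetSum _ fun ν _ => memLp_hermiteT_smul_const ν _
  have h := hasSum_norm_sq_hermite (hw.sub hsum)
  convert h using 1
  swap
  · rfl
  funext ν
  have e1 : ∫ y, hermiteT ν y • (w - fun y => ∑ l ∈ Λ, hermiteT l y •
      ∫ z, hermiteT l z • w z ∂gammaU) y ∂gammaU =
      if ν ∈ Λ then 0 else ∫ y, hermiteT ν y • w y ∂gammaU := by
    simp only [Pi.sub_apply, smul_sub]
    rw [integral_sub (integrable_hermiteT_smul ν hw) (integrable_hermiteT_smul ν hsum)]
    simp only [Finset.smul_sum]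
    rw [integral_finsetSum _ fun l _ =>
      integrable_hermiteT_smul ν (memLp_hermiteT_smul_const l _)]
    simp only [integral_hermiteT_smul_hermiteT_smul, Finset.sum_ite_eq]
    split_ifs <;> simp
  rw [e1]
  split_ifs <;> simp

end Parseval

/-! ### Best `n`-term approximation and weighted summability. -/

section BestTerm

variable {ι : Type*} {a : ι → ℝ}

/-- Stechkin's estimate for the tail of a best `n`-term approximation. -/
theorem tsum_sq_off_best_le (ha : ∀ i, 0 ≤ a i) {p : ℝ} (hp0 : 0 < p) (hp2 : p < 2)
    (hs : Summable fun i => a i ^ p) (Λ : Finset ι) [DecidablePred (· ∈ Λ)] (hn : 1 ≤ Λ.card)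
    (hbest : ∀ ν ∈ Λ, ∀ μ ∉ Λ, a μ ≤ a ν) :
    (Summable fun i => if i ∈ Λ then 0 else a i ^ 2) ∧
      ∑' i, (if i ∈ Λ then 0 else a i ^ 2) ≤
        (∑' i, a i ^ p) * ((∑' i, a i ^ p) / Λ.card) ^ (2 / p - 1) := by
  set P := ∑' i, a i ^ p with hP
  have hn0 : (0 : ℝ) < Λ.card := by exact_mod_cast hn
  have hP0 : 0 ≤ P := tsum_nonneg fun i => Real.rpow_nonneg (ha i) _
  have he : 0 ≤ 2 / p - 1 := by rw [sub_nonneg, le_div_iff₀ hp0]; linarith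
  -- An excluded value is at most each of the `n` selected ones, hence at most their average in
  -- `p`-th powers.
  have h1 : ∀ μ ∉ Λ, a μ ^ p ≤ P / Λ.card := fun μ hμ => by
    rw [le_div_iff₀ hn0, mul_comm]
    calc (Λ.card : ℝ) * a μ ^ p = ∑ _ν ∈ Λ, a μ ^ p := by rw [Finset.sum_const, nsmul_eq_mul]
      _ ≤ ∑ ν ∈ Λ, a ν ^ p :=
        Finset.sum_le_sum fun ν hν => Real.rpow_le_rpow (ha μ) (hbest ν hν μ hμ) hp0.le
      _ ≤ P := hs.sum_le_tsum _ fun i _ => Real.rpow_nonneg (ha i) _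
  have h2 : ∀ μ, (if μ ∈ Λ then 0 else a μ ^ 2) ≤ a μ ^ p * (P / Λ.card) ^ (2 / p - 1) := by
    intro μ
    split_ifs with hμ
    · have := ha μ; positivity
    · rcases (ha μ).eq_or_lt with h0 | h0
      · rw [← h0]; simp; positivity
      · have e1 : a μ ^ 2 = a μ ^ p * (a μ ^ p) ^ (2 / p - 1) := by
          rw [← Real.rpow_mul h0.le, ← Real.rpow_add h0, mul_sub, mul_div_cancel₀ _ hp0.ne', mul_one,
            add_sub_cancel, Real.rpow_ofNat]
        rw [e1]
        refine mul_le_mul_of_nonneg_left ?_ (Real.rpow_nonneg h0.le _)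
        exact Real.rpow_le_rpow (Real.rpow_nonneg h0.le _) (h1 μ hμ) he
  have h0 : ∀ μ, 0 ≤ (if μ ∈ Λ then 0 else a μ ^ 2) := fun μ => by split_ifs <;> positivity
  have hsum := Summable.of_nonneg_of_le h0 h2 (hs.mul_right _)
  refine ⟨hsum, ?_⟩
  rw [hP, ← tsum_mul_right]
  exact hsum.tsum_le_tsum h2 (hs.mul_right _)

theorem exists_best_finset [Infinite ι] (ha : ∀ i, 0 ≤ a i) (h : Tendsto a cofinite (𝓝 0)) (n : ℕ) :
    ∃ Λ : Finset ι, Λ.card = n ∧ ∀ ν ∈ Λ, ∀ μ ∉ Λ, a μ ≤ a ν := by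
  classical
  induction n with
  | zero => exact ⟨∅, by simp⟩
  | succ n ih =>
    obtain ⟨Λ, hc, hb⟩ := ih
    obtain ⟨ν₀, hν₀, hmax⟩ : ∃ ν₀, ν₀ ∉ Λ ∧ ∀ μ ∉ Λ, a μ ≤ a ν₀ := by
      -- A positive value is exceeded only finitely often, so a maximum is attained; if all
      -- remaining values vanish, any new index will do.
      by_cases hz : ∃ ν₁, ν₁ ∉ Λ ∧ 0 < a ν₁
      · obtain ⟨ν₁, h1, h2⟩ := hz
        have hfin : {ν | ν ∉ Λ ∧ a ν₁ ≤ a ν}.Finite := by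
          have := h.eventually (gt_mem_nhds h2)
          rw [Filter.eventually_cofinite] at this
          exact this.subset fun ν hν => not_lt.2 hν.2
        obtain ⟨ν₀, h3, h4⟩ := hfin.exists_maximalFor a _ ⟨ν₁, h1, le_rfl⟩
        refine ⟨ν₀, h3.1, fun μ hμ => ?_⟩
        by_contra hlt
        exact hlt (h4 (j := μ) ⟨hμ, h3.2.trans (not_le.1 hlt).le⟩ (not_le.1 hlt).le)
      · push Not at hz
        obtain ⟨ν₁, h1⟩ := Λ.exists_notMem
        exact ⟨ν₁, h1, fun μ hμ => (hz μ hμ).trans (ha _)⟩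
    refine ⟨insert ν₀ Λ, by rw [Finset.card_insert_of_notMem hν₀, hc], fun ν hν μ hμ => ?_⟩
    rw [Finset.mem_insert, not_or] at hμ
    rcases Finset.mem_insert.1 hν with rfl | hν
    · exact hmax μ hμ.2
    · exact hb ν hν μ hμ.2

/-- Weighted arithmetic–geometric mean with exponents `p/2` and `1 - p/2`; the relation between `p`
and `q` is exactly what cancels the powers of `β`. -/
theorem summable_rpow_of_weighted (ha : ∀ i, 0 ≤ a i) {β : ι → ℝ} (hβ : ∀ i, 0 < β i) {p q : ℝ}
    (hp0 : 0 < p) (hp2 : p < 2) (hq : q = 2 * p / (2 - p))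
    (h1 : Summable fun i => β i * a i ^ 2) (h2 : Summable fun i => β i ^ (-(q / 2))) :
    Summable fun i => a i ^ p := by
  refine Summable.of_nonneg_of_le (fun i => Real.rpow_nonneg (ha i) _) (fun i => ?_)
    ((h1.mul_left (p / 2)).add (h2.mul_left (1 - p / 2)))
  have h3 := Real.geom_mean_le_arith_mean2_weighted (w₁ := p / 2) (w₂ := 1 - p / 2)
    (p₁ := β i * a i ^ 2) (p₂ := β i ^ (-(q / 2))) (by linarith) (by linarith)
    (mul_nonneg (hβ i).le (sq_nonneg _)) (Real.rpow_nonneg (hβ i).le _) (by ring)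
  refine le_trans (le_of_eq ?_) h3
  have hp2' : 2 - p ≠ 0 := by linarith
  rw [Real.mul_rpow (hβ i).le (sq_nonneg _), ← Real.rpow_mul (hβ i).le, mul_right_comm,
    ← Real.rpow_add (hβ i)]
  have e1 : p / 2 + -(q / 2) * (1 - p / 2) = 0 := by rw [hq]; field_simp; ring
  have e2 : (a i ^ 2) ^ (p / 2) = a i ^ p := by
    rw [← Real.rpow_ofNat, ← Real.rpow_mul (ha i)]; congr 1; ring
  rw [e1, e2, Real.rpow_zero, one_mul]

end BestTerm

/-! ### The weights and the summability of their negative powers. -/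

section Weights

/-- The factor of the weight of `ν` in a coordinate with `ν_j = k`. -/
def weightFactor (r : ℕ) (τ : ℝ) (k : ℕ) : ℝ :=
  k.choose (min k r) * τ ^ (2 * min k r) / (min k r).factorial

theorem weightFactor_zero (r : ℕ) (τ : ℝ) : weightFactor r τ 0 = 1 := by simp [weightFactor]

theorem weightFactor_pos (r : ℕ) {τ : ℝ} (hτ : 0 < τ) (k : ℕ) : 0 < weightFactor r τ k := by
  have : 0 < k.choose (min k r) := Nat.choose_pos (min_le_left _ _)
  unfold weightFactor
  positivity

theorem pow_le_choose_min {r : ℕ} (hr : 1 ≤ r) (k : ℕ) :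
    ((k : ℝ) / r) ^ r ≤ r.factorial * k.choose (min k r) := by
  have hr0 : (0 : ℝ) < r := by exact_mod_cast hr
  have hf : (1 : ℝ) ≤ r.factorial := by exact_mod_cast Nat.one_le_iff_ne_zero.2 r.factorial_ne_zero
  rcases le_total k r with h | h
  · rw [min_eq_left h, Nat.choose_self, Nat.cast_one, mul_one]
    refine le_trans (pow_le_one₀ (by positivity) ?_) hf
    rw [div_le_one hr0]; exact_mod_cast h
  · rw [min_eq_right h]
    have h3 := Nat.pow_le_choose (α := ℝ) r k
    rw [div_le_iff₀ (by positivity), mul_comm] at h3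
    refine le_trans ?_ h3
    refine pow_le_pow_left₀ (by positivity) ?_ _
    rw [div_le_iff₀ hr0]
    have : k ≤ (k + 1 - r) * r := by
      obtain ⟨s, rfl⟩ := Nat.exists_eq_add_of_le h
      have : r + s + 1 - r = s + 1 := by omega
      rw [this]; nlinarith
    exact_mod_cast this

/-- For `k ≥ 1` the exponent `2 min(k, r)` is at least `2`. One factor `τ²` is kept for summability
in `j`, the other factors are bounded below through `l`, and the binomial supplies `k^r`. -/
theorem weightFactor_lower_bound {r : ℕ} (hr : 1 ≤ r) {l τ : ℝ} (hl0 : 0 < l) (hl1 : l ≤ 1)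
    (hlτ : l ≤ τ) {k : ℕ} (hk : 1 ≤ k) :
    l ^ (2 * (r - 1)) / ((r : ℝ) ^ r * (r.factorial : ℝ) ^ 2) * (k : ℝ) ^ r * τ ^ 2 ≤
      weightFactor r τ k := by
  have hτ : 0 < τ := hl0.trans_le hlτ
  have hr0 : (0 : ℝ) < r := by exact_mod_cast hr
  have h1 := pow_le_choose_min hr k
  set s := min k r with hs
  have hs1 : 1 ≤ s := le_min hk hr
  have hsr : s ≤ r := min_le_right _ _
  have h2 : l ^ (2 * (r - 1)) * τ ^ 2 ≤ τ ^ (2 * s) := by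
    have e : 2 * s = 2 * (s - 1) + 2 := by omega
    rw [e, pow_add]
    refine mul_le_mul_of_nonneg_right ?_ (by positivity)
    calc l ^ (2 * (r - 1)) ≤ l ^ (2 * (s - 1)) :=
          pow_le_pow_of_le_one hl0.le hl1 (by omega)
      _ ≤ τ ^ (2 * (s - 1)) := pow_le_pow_left₀ hl0.le hlτ _
  have hsf : (s.factorial : ℝ) ≤ r.factorial := by exact_mod_cast Nat.factorial_le hsr
  have hs0 : (0 : ℝ) < s.factorial := by exact_mod_cast s.factorial_pos
  have hr1 : (0 : ℝ) < r.factorial := by exact_mod_cast r.factorial_pos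
  unfold weightFactor
  rw [← hs, le_div_iff₀ hs0]
  have h3 : (k : ℝ) ^ r / (r ^ r * r.factorial) ≤ k.choose s := by
    rw [div_le_iff₀ (by positivity)]
    rw [div_pow, div_le_iff₀ (by positivity)] at h1
    linarith
  calc _ = ((k : ℝ) ^ r / (r ^ r * r.factorial)) * (l ^ (2 * (r - 1)) * τ ^ 2) *
        (s.factorial / r.factorial) := by field_simp
    _ ≤ k.choose s * τ ^ (2 * s) * 1 := by
        refine mul_le_mul (mul_le_mul h3 h2 (by positivity) (by positivity)) ?_ (by positivity)
          (by positivity)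
        rwa [div_le_one hr1]
    _ = _ := by ring

/-- The weight of the Hermite coefficient with index `ν`. -/
def weight (r : ℕ) (τ : ℕ → ℝ) (ν : ℕ →₀ ℕ) : ℝ := ν.prod fun j k => weightFactor r (τ j) k

theorem weight_pos (r : ℕ) {τ : ℕ → ℝ} (hτ : ∀ j, 0 < τ j) (ν : ℕ →₀ ℕ) : 0 < weight r τ ν :=
  Finset.prod_pos fun j _ => weightFactor_pos r (hτ j) _

/-- The sum is bounded by a product of one-coordinate sums, each at most `1 + C τ_j^(-q) ≤ exp(C
τ_j^(-q))`. Here `rq/2 > 1` handles the sum over `k`, and the summability of `τ_j^(-q)` handles the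
product over `j`. -/
theorem summable_weight_rpow {r : ℕ} (hr : 1 ≤ r) {τ : ℕ → ℝ} {l q : ℝ} (hl0 : 0 < l) (hl1 : l ≤ 1)
    (hlτ : ∀ j, l ≤ τ j) (hq : 0 < q) (hrq : 1 < r * q / 2) (hτ : Summable fun j => τ j ^ (-q)) :
    Summable fun ν => weight r τ ν ^ (-(q / 2)) := by
  have hτ0 : ∀ j, 0 < τ j := fun j => hl0.trans_le (hlτ j)
  have hr0 : (0 : ℝ) < r := by exact_mod_cast hr
  have hr1 : (0 : ℝ) < r.factorial := by exact_mod_cast r.factorial_pos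
  set c := l ^ (2 * (r - 1)) / ((r : ℝ) ^ r * (r.factorial : ℝ) ^ 2) with hc
  have hc0 : 0 < c := by positivity
  have hz : Summable fun k : ℕ => (k : ℝ) ^ (-(r * q / 2)) := Real.summable_nat_rpow.2 (by linarith)
  set Z := ∑' k : ℕ, (k : ℝ) ^ (-(r * q / 2)) with hZ
  let g : ℕ → ℕ → ℝ := fun j k => weightFactor r (τ j) k ^ (-(q / 2))
  have hprod : ∀ ν : ℕ →₀ ℕ, weight r τ ν ^ (-(q / 2)) = ν.prod g := fun ν => by
    unfold weight Finsupp.prod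
    rw [Real.finsetProd_rpow _ _ fun j _ => (weightFactor_pos r (hτ0 j) _).le]
  have hg : ∀ j k, 1 ≤ k →
      g j k ≤ c ^ (-(q / 2)) * τ j ^ (-q) * (k : ℝ) ^ (-(r * q / 2)) := by
    intro j k hk
    have hk0 : (0 : ℝ) < k := by exact_mod_cast hk
    have h1 := weightFactor_lower_bound hr hl0 hl1 (hlτ j) hk
    have h2 := Real.rpow_le_rpow_of_nonpos (z := -(q / 2)) (by have := hτ0 j; positivity) h1
      (by linarith)
    refine h2.trans (le_of_eq ?_)
    rw [Real.mul_rpow (by positivity) (by positivity), Real.mul_rpow hc0.le (by positivity),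
      ← Real.rpow_natCast (k : ℝ) r, ← Real.rpow_mul hk0.le, ← Real.rpow_ofNat (τ j) 2,
      ← Real.rpow_mul (hτ0 j).le]
    have e1 : (r : ℝ) * -(q / 2) = -(r * q / 2) := by ring
    have e2 : (2 : ℝ) * -(q / 2) = -q := by ring
    rw [e1, e2]; ring
  have hsum : ∀ j N, ∑ k ∈ Finset.range N, g j k ≤
      Real.exp (c ^ (-(q / 2)) * Z * τ j ^ (-q)) := by
    intro j N
    have hA : 0 ≤ c ^ (-(q / 2)) * τ j ^ (-q) := by have := hτ0 j; positivity
    have h1 : ∀ k, g j k ≤ (if k = 0 then 1 else 0) +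
        c ^ (-(q / 2)) * τ j ^ (-q) * (k : ℝ) ^ (-(r * q / 2)) := by
      intro k
      rcases Nat.eq_zero_or_pos k with rfl | hk
      · simp only [g, weightFactor_zero, Real.one_rpow, if_true]
        have : (0 : ℝ) ≤ ((0 : ℕ) : ℝ) ^ (-(r * q / 2)) := by positivity
        nlinarith [mul_nonneg hA this]
      · rw [if_neg hk.ne', zero_add]; exact hg j k hk
    calc ∑ k ∈ Finset.range N, g j k ≤ ∑ k ∈ Finset.range N, ((if k = 0 then 1 else 0) +
          c ^ (-(q / 2)) * τ j ^ (-q) * (k : ℝ) ^ (-(r * q / 2))) :=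
          Finset.sum_le_sum fun k _ => h1 k
      _ ≤ 1 + c ^ (-(q / 2)) * τ j ^ (-q) * Z := by
          rw [Finset.sum_add_distrib, ← Finset.mul_sum]
          refine add_le_add ?_ (mul_le_mul_of_nonneg_left ?_ hA)
          · rw [Finset.sum_ite_eq']; split_ifs <;> norm_num
          · exact hz.sum_le_tsum _ fun k _ => by positivity
      _ ≤ Real.exp (c ^ (-(q / 2)) * Z * τ j ^ (-q)) := by
          have := Real.add_one_le_exp (c ^ (-(q / 2)) * Z * τ j ^ (-q))
          linarith
  have hZ0 : 0 ≤ Z := tsum_nonneg fun k => by positivity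
  simp only [hprod]
  refine summable_of_sum_le (c := Real.exp (c ^ (-(q / 2)) * Z * ∑' j, τ j ^ (-q)))
    (fun ν => Finset.prod_nonneg fun j _ => Real.rpow_nonneg (weightFactor_pos r (hτ0 j) _).le _)
    fun T => ?_
  refine sum_prod_le_of_sum_range_le T g (fun j => by simp [g, weightFactor_zero])
    (fun j k => Real.rpow_nonneg (weightFactor_pos r (hτ0 j) _).le _) _ hsum fun N => ?_
  rw [← Finset.mul_sum]
  refine mul_le_mul_of_nonneg_left ?_ (by positivity)
  exact hτ.sum_le_tsum _ fun j _ => Real.rpow_nonneg (hτ0 j).le _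

end Weights

/-! ### Capped multi-indices and the weight identity. -/

section MultiPow

/-- `τ^μ = ∏_j τ_j^{μ_j}`. -/
def multiPow (τ : ℕ → ℝ) (μ : ℕ →₀ ℕ) : ℝ := μ.prod fun j k => τ j ^ k

theorem multiPow_add_single (τ : ℕ → ℝ) (μ : ℕ →₀ ℕ) (j : ℕ) :
    multiPow τ (μ + Finsupp.single j 1) = τ j * multiPow τ μ := by
  obtain ⟨P, h1, h2⟩ := prod_add_single_eq (fun j k => τ j ^ k) (by simp) μ j
  unfold multiPow
  rw [h1, h2, pow_succ]; ring

/-- The componentwise minimum of `ν` and `r`. -/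
def cap (r : ℕ) (ν : ℕ →₀ ℕ) : ℕ →₀ ℕ := ν.mapRange (fun k => min k r) (Nat.zero_min r)

theorem cap_le (r : ℕ) (ν : ℕ →₀ ℕ) : cap r ν ≤ ν := fun j => by
  simp [cap]

/-- The weight is designed for this identity: it balances the normalizations of `H_ν` and `H_{ν -
cap r ν}` against the factor `τ^μ/μ!` in the Taylor coefficient with `μ = cap r ν`. -/
theorem weight_mul_eq (r : ℕ) (τ : ℕ → ℝ) (ν : ℕ →₀ ℕ) :
    weight r τ ν * (multiFactorial (ν - cap r ν) * multiFactorial (cap r ν) ^ 2) =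
      multiFactorial ν * multiPow τ (cap r ν) ^ 2 := by
  have h1 : (cap r ν).support ⊆ ν.support := Finsupp.support_mono (cap_le r ν)
  have h2 : (ν - cap r ν).support ⊆ ν.support := Finsupp.support_mono tsub_le_self
  unfold weight multiFactorial multiPow
  rw [Finsupp.prod_of_support_subset _ h1 _ (by simp), Finsupp.prod_of_support_subset _ h2 _
    (by simp), Finsupp.prod_of_support_subset _ h1 _ (by simp)]
  unfold Finsupp.prod
  simp only [← Finset.prod_pow, ← Finset.prod_mul_distrib]
  refine Finset.prod_congr rfl fun j _ => ?_
  have e : (cap r ν) j = min (ν j) r := rfl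
  rw [Finsupp.tsub_apply, e]
  unfold weightFactor
  have h3 := Nat.choose_mul_factorial_mul_factorial (min_le_left (ν j) r)
  rw [← h3]
  push_cast
  have : ((min (ν j) r).factorial : ℝ) ≠ 0 := by positivity
  field_simp
  rw [← pow_mul, mul_comm 2]

end MultiPow

/-! ### Taylor coefficients in `L²(U, V, γ)` and the weighted Hermite sum. -/

section Taylor

variable {α : Type*} [MeasurableSpace α] {m : Measure α} {E V : Type*} [NormedAddCommGroup E]
  [InnerProductSpace ℝ E] [CompleteSpace E] [NormedAddCommGroup V] [InnerProductSpace ℝ V]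
  [CompleteSpace V] (G : V →L[ℝ] Lp E 2 m) (ψ : ℕ → Lp ℝ ∞ m) (τ : ℕ → ℝ) (F : V)

/-- The scaled Taylor coefficient `τ^μ ∂^μ u(y) / μ!` of the solution map `u`. -/
def solTaylor (μ : ℕ →₀ ℕ) (y : ℕ → ℝ) : V :=
  taylorCoeff (coeffOp G fun j => τ j • ψ j) F μ (logField ψ y)

variable {G ψ τ F} {M : ℕ} {q Cp K : ℝ}
  (hCp : 0 < Cp) (hG : ∀ v, ‖v‖ ≤ Cp * ‖G v‖)
  (hM : ∀ᵐ x ∂m, {j : ℕ | ψ j x ≠ 0}.encard ≤ (M : ℕ∞)) (hq : 0 < q)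

include hCp hG hM hq in
-- A change `t - s` of `y_j` moves `b` by `(t - s)/τ_j` times the scaled direction `τ_j ψ_j`, which
-- accounts for the division by `τ_j`.
theorem hasDerivAt_solTaylor_update (hτ : ∀ j, 0 < τ j) (μ : ℕ →₀ ℕ) (j : ℕ) {y : ℕ → ℝ}
    (hy : y ∈ goodSet ψ q) (s : ℝ) :
    HasDerivAt (fun s => solTaylor G ψ τ F μ (Function.update y j s))
      ((((μ j : ℝ) + 1) / τ j) •
        solTaylor G ψ τ F (μ + Finsupp.single j 1) (Function.update y j s)) s := by
  have h1 := hasDerivAt_taylorCoeff (F := F) (A := coeffOp G fun j => τ j • ψ j)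
    (differentiable_coeffOp G _) (isUnit_coeffOp_zero G hCp hG _) (h := τ j • ψ j) (j := j)
    (fun α b => hasDerivAt_coeffOp G (fun j => τ j • ψ j) α b j) μ
    (logField ψ (Function.update y j s))
  have h2 : HasDerivAt (fun t : ℝ => (t - s) / τ j) (1 / τ j) s :=
    ((hasDerivAt_id s).sub_const s).div_const _
  have h0 : (fun t : ℝ => (t - s) / τ j) s = 0 := by simp
  rw [← h0] at h1
  have h3 := h1.scomp s h2
  rw [smul_smul] at h3
  have e : (1 / τ j) * ((μ j : ℝ) + 1) = ((μ j : ℝ) + 1) / τ j := by ring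
  rw [e] at h3
  refine h3.congr_of_eventuallyEq (Eventually.of_forall fun t => ?_)
  simp only [Function.comp_apply, solTaylor]
  rw [smul_smul, div_mul_cancel₀ _ (hτ j).ne', logField_update hM hq hy, logField_update hM hq hy,
    add_assoc, ← add_smul]
  congr 3
  ring

variable (hψ : Summable fun j => ‖ψ j‖ ^ q)
  (hK : Real.exp K < 2)
  (hψK : ∀ᵐ x ∂m, ∀ N, ∑ j ∈ Finset.range N, |(τ j • ψ j : Lp ℝ ∞ m) x| ≤ K)

include hCp hG hM hq hψ in
theorem aestronglyMeasurable_solTaylor (μ : ℕ →₀ ℕ) :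
    AEStronglyMeasurable (solTaylor G ψ τ F μ) gammaU :=
  (differentiable_taylorCoeff (differentiable_coeffOp G _)
    (isUnit_coeffOp_zero G hCp hG _) μ).continuous.comp_aestronglyMeasurable
    (aestronglyMeasurable_logField hM hq hψ)

include hCp hG hM hq hψ hK hψK

theorem memLp_solTaylor (μ : ℕ →₀ ℕ) : MemLp (solTaylor G ψ τ F μ) 2 gammaU := by
  have hm := aestronglyMeasurable_solTaylor (τ := τ) (F := F) hCp hG hM hq hψ μ
  refine (memLp_two_iff_integrable_sq_norm hm).2 ?_
  refine ((integrable_exp_norm_logField hM hq hψ zero_le_two).const_mul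
    ((Cp ^ 2 * ‖F‖ / (2 - Real.exp K)) ^ 2)).mono' (hm.norm.pow 2) (ae_of_all _ fun y => ?_)
  rw [Real.norm_of_nonneg (sq_nonneg _)]
  have h := sum_norm_sq_taylorCoeff_le G hCp hG (fun j => τ j • ψ j) hK hψK F (logField ψ y)
    (Finset.Iic μ) fun ν hν κ hκ => Finset.mem_Iic.2 (hκ.trans (Finset.mem_Iic.1 hν))
  refine le_trans ?_ h
  exact Finset.single_le_sum
    (f := fun μ => ‖taylorCoeff (coeffOp G fun j => τ j • ψ j) F μ (logField ψ y)‖ ^ 2)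
    (fun _ _ => sq_nonneg _) (Finset.mem_Iic.2 le_rfl)

theorem sum_integral_norm_sq_solTaylor_le (T : Finset (ℕ →₀ ℕ)) :
    ∑ μ ∈ T, ∫ y, ‖solTaylor G ψ τ F μ y‖ ^ 2 ∂gammaU ≤
      (Cp ^ 2 * ‖F‖ / (2 - Real.exp K)) ^ 2 * ∫ y, Real.exp (2 * ‖logField ψ y‖) ∂gammaU := by
  classical
  have hi : ∀ μ, Integrable (fun y => ‖solTaylor G ψ τ F μ y‖ ^ 2) gammaU := fun μ =>
    (memLp_two_iff_integrable_sq_norm (aestronglyMeasurable_solTaylor hCp hG hM hq hψ μ)).1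
      (memLp_solTaylor hCp hG hM hq hψ hK hψK μ)
  rw [← integral_finsetSum _ fun μ _ => hi μ, ← integral_const_mul]
  refine integral_mono (integrable_finsetSum _ fun μ _ => hi μ)
    ((integrable_exp_norm_logField hM hq hψ zero_le_two).const_mul _) fun y => ?_
  have h := sum_norm_sq_taylorCoeff_le G hCp hG (fun j => τ j • ψ j) hK hψK F (logField ψ y)
    -- The pointwise bound needs a downward closed index set, so `T` is enlarged to its lower
    -- closure; the bound does not depend on that set.
    (T.biUnion Finset.Iic) fun ν hν κ hκ => by
      obtain ⟨μ, hμ, h⟩ := Finset.mem_biUnion.1 hν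
      exact Finset.mem_biUnion.2 ⟨μ, hμ, Finset.mem_Iic.2 (hκ.trans (Finset.mem_Iic.1 h))⟩
  refine le_trans (Finset.sum_le_sum_of_subset_of_nonneg (fun μ hμ => ?_)
    fun _ _ _ => sq_nonneg _) h
  exact Finset.mem_biUnion.2 ⟨μ, hμ, Finset.mem_Iic.2 le_rfl⟩

theorem integral_hermiteProd_smul_solTaylor (hτ : ∀ j, 0 < τ j) (μ κ : ℕ →₀ ℕ) :
    multiFactorial μ • ∫ y, hermiteProd κ y • solTaylor G ψ τ F μ y ∂gammaU =
      multiPow τ μ • ∫ y, hermiteProd (κ + μ) y • solTaylor G ψ τ F 0 y ∂gammaU := by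
  have hL := memLp_solTaylor (F := F) hCp hG hM hq hψ hK hψK
  induction μ using multiIndex_induction generalizing κ with
  | h0 => simp [multiFactorial, multiPow]
  | h1 μ j ih =>
    have h := integral_hermiteProd_smul_deriv κ j (hL μ)
      ((hL (μ + Finsupp.single j 1)).const_smul (((μ j : ℝ) + 1) / τ j))
      ((ae_mem_goodSet hq hψ).mono fun y hy s =>
        hasDerivAt_solTaylor_update hCp hG hM hq hτ μ j hy s)
    simp only [Pi.smul_apply, smul_comm _ (((μ j : ℝ) + 1) / τ j)] at h
    rw [integral_smul] at h
    have h2 : ((μ j : ℝ) + 1) • ∫ y, hermiteProd κ y •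
        solTaylor G ψ τ F (μ + Finsupp.single j 1) y ∂gammaU =
        τ j • ∫ y, hermiteProd (κ + Finsupp.single j 1) y • solTaylor G ψ τ F μ y ∂gammaU := by
      rw [← h, smul_smul, mul_div_cancel₀ _ (hτ j).ne']
    rw [multiFactorial_add_single, multiPow_add_single, mul_comm, mul_smul, h2,
      smul_comm, ih, smul_smul, add_assoc, add_comm (Finsupp.single j 1) μ]

theorem weight_mul_norm_sq_eq (hτ : ∀ j, 0 < τ j) (r : ℕ) (ν : ℕ →₀ ℕ) :
    weight r τ ν * ‖∫ y, hermiteT ν y • solTaylor G ψ τ F 0 y ∂gammaU‖ ^ 2 =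
      ‖∫ y, hermiteT (ν - cap r ν) y • solTaylor G ψ τ F (cap r ν) y ∂gammaU‖ ^ 2 := by
  have h := congrArg (fun v => ‖v‖ ^ 2) <|
    integral_hermiteProd_smul_solTaylor (F := F) hCp hG hM hq hψ hK hψK hτ (cap r ν) (ν - cap r ν)
  rw [tsub_add_cancel_of_le (cap_le r ν)] at h
  simp only [norm_smul, mul_pow, Real.norm_eq_abs, sq_abs] at h
  have e : ∀ (κ : ℕ →₀ ℕ) (f : (ℕ → ℝ) → V), ‖∫ y, hermiteT κ y • f y ∂gammaU‖ ^ 2 =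
      (multiFactorial κ)⁻¹ * ‖∫ y, hermiteProd κ y • f y ∂gammaU‖ ^ 2 := fun κ f => by
    simp only [hermiteT_eq, mul_smul]
    rw [integral_smul, norm_smul, mul_pow, Real.norm_eq_abs, sq_abs, inv_pow,
      Real.sq_sqrt (multiFactorial_pos κ).le]
  rw [e, e]
  have hw := weight_mul_eq r τ ν
  have p1 := multiFactorial_pos ν
  have p2 := multiFactorial_pos (cap r ν)
  have p3 := multiFactorial_pos (ν - cap r ν)
  set X := ‖∫ y, hermiteProd ν y • solTaylor G ψ τ F 0 y ∂gammaU‖ ^ 2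
  set Y := ‖∫ y, hermiteProd (ν - cap r ν) y • solTaylor G ψ τ F (cap r ν) y ∂gammaU‖ ^ 2
  have h4 : weight r τ ν * (multiFactorial ν)⁻¹ * multiFactorial (ν - cap r ν) *
      multiFactorial (cap r ν) ^ 2 = multiPow τ (cap r ν) ^ 2 := by
    field_simp; linarith
  have h5 : weight r τ ν * ((multiFactorial ν)⁻¹ * X) * (multiFactorial (ν - cap r ν) *
      multiFactorial (cap r ν) ^ 2) = multiFactorial (cap r ν) ^ 2 * Y := by
    rw [h, ← h4]; ring
  rw [eq_inv_mul_iff_mul_eq₀ p3.ne']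
  have p4 : multiFactorial (cap r ν) ^ 2 ≠ 0 := by positivity
  refine mul_right_cancel₀ p4 ?_
  linarith

/-- Group the `ν` by `μ = cap r ν`. Within a group `ν ↦ ν - μ` is injective, so Parseval bounds its
contribution by the squared `L²` norm of the Taylor coefficient `μ`, and these are summable over
`μ`. -/
theorem summable_weight_mul_norm_sq (hτ : ∀ j, 0 < τ j) (r : ℕ) :
    Summable fun ν =>
      weight r τ ν * ‖∫ y, hermiteT ν y • solTaylor G ψ τ F 0 y ∂gammaU‖ ^ 2 := by
  classical
  refine summable_of_sum_le (c := (Cp ^ 2 * ‖F‖ / (2 - Real.exp K)) ^ 2 *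
    ∫ y, Real.exp (2 * ‖logField ψ y‖) ∂gammaU)
    (fun ν => mul_nonneg (weight_pos r hτ ν).le (sq_nonneg _)) fun S => ?_
  simp only [weight_mul_norm_sq_eq hCp hG hM hq hψ hK hψK hτ]
  rw [← Finset.sum_fiberwise_of_maps_to (t := S.image (cap r)) (g := cap r)
    fun ν hν => Finset.mem_image_of_mem _ hν]
  refine le_trans (Finset.sum_le_sum fun μ _ => ?_)
    (sum_integral_norm_sq_solTaylor_le (F := F) hCp hG hM hq hψ hK hψK (S.image (cap r)))
  have hinj : Set.InjOn (fun ν : ℕ →₀ ℕ => ν - μ) (S.filter fun ν => cap r ν = μ) := by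
    intro ν hν ν' hν' h
    have e1 := (Finset.mem_filter.1 hν).2
    have e2 := (Finset.mem_filter.1 hν').2
    have l1 := tsub_add_cancel_of_le (e1 ▸ cap_le r ν : μ ≤ ν)
    have l2 := tsub_add_cancel_of_le (e2 ▸ cap_le r ν' : μ ≤ ν')
    rw [← l1, ← l2]
    exact congrArg (· + μ) h
  calc _ = ∑ ν ∈ S.filter fun ν => cap r ν = μ,
        ‖∫ y, hermiteT (ν - μ) y • solTaylor G ψ τ F μ y ∂gammaU‖ ^ 2 :=
        Finset.sum_congr rfl fun ν hν => by rw [(Finset.mem_filter.1 hν).2]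
    _ = ∑ κ ∈ (S.filter fun ν => cap r ν = μ).image fun ν => ν - μ,
        ‖∫ y, hermiteT κ y • solTaylor G ψ τ F μ y ∂gammaU‖ ^ 2 :=
        (Finset.sum_image
          (f := fun κ => ‖∫ y, hermiteT κ y • solTaylor G ψ τ F μ y ∂gammaU‖ ^ 2) hinj).symm
    _ ≤ _ := sum_le_hasSum _ (fun _ _ => sq_nonneg _)
        (hasSum_norm_sq_hermite (memLp_solTaylor hCp hG hM hq hψ hK hψK μ))

end Taylor

/-! ### Choice of the scaling factors. -/

section Scaling

variable {α : Type*} [MeasurableSpace α] {m : Measure α} {ψ : ℕ → Lp ℝ ∞ m} {M : ℕ} {q : ℝ}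

/-- Scaling factors `τ` for which `∑_j τ_j |ψ_j| ≤ 1/2` and `(τ_j⁻¹) ∈ ℓ^q`. -/
theorem exists_scaling (hM : ∀ᵐ x ∂m, {j : ℕ | ψ j x ≠ 0}.encard ≤ (M : ℕ∞)) (hq : 0 < q)
    (hψ : Summable fun j => ‖ψ j‖ ^ q) :
    ∃ (τ : ℕ → ℝ) (l : ℝ), 0 < l ∧ l ≤ 1 ∧ (∀ j, l ≤ τ j) ∧ (Summable fun j => τ j ^ (-q)) ∧
      ∀ᵐ x ∂m, ∀ N, ∑ j ∈ Finset.range N, |(τ j • ψ j : Lp ℝ ∞ m) x| ≤ 1 / 2 := by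
  -- The geometric floor keeps `σ_j` positive when `ψ_j = 0` without destroying `ℓ^q` summability.
  set σ : ℕ → ℝ := fun j => max ‖ψ j‖ ((1 / 2) ^ j) with hσ
  have hσ0 : ∀ j, 0 < σ j := fun j => lt_max_of_lt_right (by positivity)
  have hgeom : Summable fun j : ℕ => (((1 : ℝ) / 2) ^ j) ^ q := by
    have : ∀ j : ℕ, (((1 : ℝ) / 2) ^ j) ^ q = ((1 / 2 : ℝ) ^ q) ^ j := fun j => by
      rw [← Real.rpow_natCast, ← Real.rpow_natCast, ← Real.rpow_mul (by norm_num),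
        ← Real.rpow_mul (by norm_num), mul_comm]
    simp only [this]
    exact summable_geometric_of_lt_one (by positivity)
      (Real.rpow_lt_one (by norm_num) (by norm_num) hq)
  have hσs : Summable fun j => σ j ^ q := by
    refine Summable.of_nonneg_of_le (fun j => Real.rpow_nonneg (hσ0 j).le _) (fun j => ?_)
      (hψ.add hgeom)
    rcases max_cases ‖ψ j‖ (((1 : ℝ) / 2) ^ j) with h | h
    · simp only [hσ, h.1]
      exact le_add_of_nonneg_right (by positivity)
    · simp only [hσ, h.1]
      exact le_add_of_nonneg_left (by positivity)
  set B := (∑' j, σ j ^ q) ^ q⁻¹ with hB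
  have hσB : ∀ j, σ j ≤ B := fun j =>
    (Real.le_rpow_inv_iff_of_pos (hσ0 j).le
      (tsum_nonneg fun j => Real.rpow_nonneg (hσ0 j).le _) hq).2
      (hσs.le_tsum j fun i _ => Real.rpow_nonneg (hσ0 i).le _)
  have hB0 : 0 < B := (hσ0 0).trans_le (hσB 0)
  -- With `τ_j = c/σ_j` each `τ_j ‖ψ_j‖` is at most `c`, and `M c ≤ 1/2`; using `M + 1` avoids
  -- dividing by zero.
  set c : ℝ := 1 / (2 * (M + 1)) with hc
  have hc0 : 0 < c := by positivity
  refine ⟨fun j => c / σ j, min 1 (c / B), lt_min one_pos (by positivity), min_le_left _ _,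
    fun j => (min_le_right _ _).trans (div_le_div_of_nonneg_left hc0.le (hσ0 j) (hσB j)), ?_, ?_⟩
  · refine (hσs.mul_left (c ^ (-q))).congr fun j => ?_
    rw [Real.div_rpow hc0.le (hσ0 j).le, Real.rpow_neg (hσ0 j).le, div_inv_eq_mul]
  · filter_upwards [ae_sum_abs_le hM, ae_all_iff.2 fun j => Lp.coeFn_smul (c / σ j) (ψ j)]
      with x hx h2 N
    have h3 := hx (fun j => c / σ j) (Finset.range N) c hc0.le fun j _ => by
      rw [abs_of_pos (div_pos hc0 (hσ0 j)), div_mul_eq_mul_div, div_le_iff₀ (hσ0 j)]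
      exact mul_le_mul_of_nonneg_left (le_max_left _ _) hc0.le
    simp only [h2, Pi.smul_apply, smul_eq_mul]
    refine h3.trans ?_
    rw [hc, mul_one_div, div_le_div_iff₀ (by positivity) (by norm_num)]
    nlinarith

end Scaling

theorem exp_half_lt_two : Real.exp (1 / 2) < 2 := by
  have h := Real.exp_one_lt_d9
  have h2 : Real.exp (1 / 2) ^ 2 = Real.exp 1 := by rw [← Real.exp_nat_mul]; norm_num
  nlinarith [Real.exp_pos (1 / 2)]

/-! ### Application to the Dirichlet problem on `D`. -/

section Dirichlet

variable {d : ℕ} {D : Set (Space d)}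

instance : CompleteSpace (H10 D) :=
  (Submodule.isClosed_topologicalClosure _).completeSpace_coe

variable (D) in
/-- The weak gradient as a continuous linear map. -/
def gradL : H10 D →L[ℝ] Lp (Space d) 2 (vol D) :=
  (WithLp.sndL 2 ℝ _ _).comp (H10 D).subtypeL

theorem isWeakSolution_iff (ψ : ℕ → LInfty D) (b : LInfty D) (f : StrongDual ℝ (H10 D))
    (v : H10 D) : IsWeakSolution b f v ↔
      coeffOp (gradL D) ψ 0 b v = (InnerProductSpace.toDual ℝ (H10 D)).symm f := by
  have h : ∀ w : H10 D, inner ℝ (coeffOp (gradL D) ψ 0 b v) w =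
      ∫ x, Real.exp (b x) * inner ℝ (grad v x) (grad w x) ∂(vol D) := fun w =>
    inner_coeffOp_zero (gradL D) ψ b v w
  constructor
  · intro hv
    refine ext_inner_right ℝ fun w => ?_
    rw [h, hv, InnerProductSpace.toDual_symm_apply]
  · intro hv w
    rw [← h, hv, InnerProductSpace.toDual_symm_apply]

theorem existsUnique_isWeakSolution (hd : 1 ≤ d) (hD : Bornology.IsBounded D) (b : LInfty D)
    (f : StrongDual ℝ (H10 D)) : ∃! v : H10 D, IsWeakSolution b f v := by
  obtain ⟨C, hC, hP⟩ := exists_poincare_const hd hD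
  have hU := isUnit_coeffOp_zero (gradL D) hC hP (fun _ => 0) b
  simp only [isWeakSolution_iff fun _ => 0]
  set A := coeffOp (gradL D) (fun _ => 0) 0 b
  refine ⟨Ring.inverse A ((InnerProductSpace.toDual ℝ (H10 D)).symm f), ?_, fun v hv => ?_⟩
  · simp only
    rw [← mul_apply_eq_comp, Ring.mul_inverse_cancel _ hU]; rfl
  · rw [← hv, ← mul_apply_eq_comp, Ring.inverse_mul_cancel _ hU]; rfl

theorem isWeakSolution_taylorCoeff_zero (hd : 1 ≤ d) (hD : Bornology.IsBounded D)
    (ψ : ℕ → LInfty D) (b : LInfty D) (f : StrongDual ℝ (H10 D)) :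
    IsWeakSolution b f (taylorCoeff (coeffOp (gradL D) ψ)
      ((InnerProductSpace.toDual ℝ (H10 D)).symm f) 0 b) := by
  obtain ⟨C, hC, hP⟩ := exists_poincare_const hd hD
  rw [isWeakSolution_iff ψ]
  have := sum_taylorCoeff (A := coeffOp (gradL D) ψ)
    (F := (InnerProductSpace.toDual ℝ (H10 D)).symm f)
    (isUnit_coeffOp_zero (gradL D) hC hP ψ b) 0
  simpa using this

variable {ψ : ℕ → LInfty D} {M : ℕ} {q : ℝ}

theorem isLogCoefficient_logField
    (hM : ∀ᵐ x ∂(vol D), {j : ℕ | ψ j x ≠ 0}.encard ≤ (M : ℕ∞)) (hq : 0 < q) {y : ℕ → ℝ}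
    (hy : y ∈ goodSet ψ q) : IsLogCoefficient ψ y (logField ψ y) :=
  (summable_of_mem_goodSet hM hq hy).hasSum.tendsto_sum_nat

/-- The zeroth Taylor coefficient is the solution itself, whatever `τ` is; uniqueness of limits and
of weak solutions identifies it with any given solution map. -/
theorem ae_eq_solTaylor (hd : 1 ≤ d) (hD : Bornology.IsBounded D)
    (hM : ∀ᵐ x ∂(vol D), {j : ℕ | ψ j x ≠ 0}.encard ≤ (M : ℕ∞)) (hq : 0 < q)
    (hψ : Summable fun j => ‖ψ j‖ ^ q) (τ : ℕ → ℝ) {f : StrongDual ℝ (H10 D)}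
    {u : (ℕ → ℝ) → H10 D} (hu : IsSolutionMap ψ f u) :
    u =ᵐ[gammaU] solTaylor (gradL D) ψ τ ((InnerProductSpace.toDual ℝ (H10 D)).symm f) 0 := by
  filter_upwards [hu, ae_mem_goodSet hq hψ] with y ⟨b, hb, hw⟩ hy
  have e := tendsto_nhds_unique hb (isLogCoefficient_logField hM hq hy)
  subst e
  exact (existsUnique_isWeakSolution hd hD _ f).unique hw
    (isWeakSolution_taylorCoeff_zero hd hD _ _ f)

/-- The solution map is square integrable with `ℓ^p`-summable Hermite coefficients. -/
theorem memLp_and_summable_of_isSolutionMap (hd : 1 ≤ d) (hD : Bornology.IsBounded D)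
    (hM : ∀ᵐ x ∂(vol D), {j : ℕ | ψ j x ≠ 0}.encard ≤ (M : ℕ∞)) {p : ℝ} (hp0 : 0 < p)
    (hp2 : p < 2) (hpq : q = 2 * p / (2 - p)) (hψ : Summable fun j => ‖ψ j‖ ^ q)
    {f : StrongDual ℝ (H10 D)} {u : (ℕ → ℝ) → H10 D} (hu : IsSolutionMap ψ f u) :
    MemLp u 2 gammaU ∧ Summable fun ν => ‖hermiteCoeff u ν‖ ^ p := by
  have hq : 0 < q := by rw [hpq]; exact div_pos (by linarith) (by linarith)
  obtain ⟨C, hC, hP⟩ := exists_poincare_const hd hD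
  obtain ⟨τ, l, hl0, hl1, hlτ, hτs, hψK⟩ := exists_scaling hM hq hψ
  have hae := ae_eq_solTaylor hd hD hM hq hψ τ hu
  have hτ : ∀ j, 0 < τ j := fun j => hl0.trans_le (hlτ j)
  have hP' : ∀ v, ‖v‖ ≤ C * ‖gradL D v‖ := hP
  generalize (InnerProductSpace.toDual ℝ (H10 D)).symm f = F at hae
  refine ⟨(memLp_solTaylor hC hP' hM hq hψ exp_half_lt_two hψK 0).ae_eq hae.symm, ?_⟩
  -- The cap `r` is chosen so that `∑_k k^(-rq/2)` converges.
  obtain ⟨r, hr⟩ := exists_nat_gt (2 / q)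
  have hrq : 1 < r * q / 2 := by
    rw [div_lt_iff₀ hq] at hr; linarith
  have hr1 : 1 ≤ r := by
    have : (0 : ℝ) < r := lt_trans (by positivity) hr
    exact_mod_cast this
  have h1 := summable_weight_mul_norm_sq (F := F) hC hP' hM hq hψ exp_half_lt_two hψK hτ r
  have hcoef : ∀ ν, hermiteCoeff u ν =
      ∫ y, hermiteT ν y • solTaylor (gradL D) ψ τ F 0 y ∂gammaU := fun ν =>
    integral_congr_ae (hae.mono fun y hy => by simp only [hy])
  have h2 : Summable fun ν => weight r τ ν * ‖hermiteCoeff u ν‖ ^ 2 :=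
    h1.congr fun ν => by rw [hcoef]
  exact summable_rpow_of_weighted (fun ν => norm_nonneg _) (weight_pos r hτ) hp0 hp2 hpq h2
    (summable_weight_rpow hr1 hl0 hl1 hlτ hq hrq hτs)

/-- The truncation error in terms of the Hermite coefficients outside of `Λ`. -/
theorem normL2UV_sub_hermiteTrunc_le {C : ℝ} (hC : 0 < C) (hP : ∀ v : H10 D, ‖v‖ ≤ C * normV v)
    {u : (ℕ → ℝ) → H10 D} (hu : MemLp u 2 gammaU) (Λ : Finset (ℕ →₀ ℕ)) {R : ℝ}
    (hs : Summable fun ν => if ν ∈ Λ then 0 else normV (hermiteCoeff u ν) ^ 2)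
    (hR0 : 0 ≤ R) (hR : ∑' ν, (if ν ∈ Λ then 0 else normV (hermiteCoeff u ν) ^ 2) ≤ R ^ 2) :
    normL2UV (fun y => u y - hermiteTrunc u Λ y) ≤ ENNReal.ofReal (C * R) := by
  have h1 := hasSum_norm_sq_hermite_sub hu Λ
  have h2 : ∫ y, ‖u y - hermiteTrunc u Λ y‖ ^ 2 ∂gammaU ≤ (C * R) ^ 2 := by
    have h3 : ∫ y, ‖u y - hermiteTrunc u Λ y‖ ^ 2 ∂gammaU ≤
        C ^ 2 * ∑' ν, (if ν ∈ Λ then 0 else normV (hermiteCoeff u ν) ^ 2) := by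
      refine hasSum_le (fun ν => ?_) h1 (hs.hasSum.mul_left (C ^ 2))
      split_ifs
      · simp
      · rw [← mul_pow]
        exact pow_le_pow_left₀ (norm_nonneg _) (hP _) 2
    rw [mul_pow]
    exact h3.trans (mul_le_mul_of_nonneg_left hR (by positivity))
  have hw : MemLp (fun y => u y - hermiteTrunc u Λ y) 2 gammaU :=
    hu.sub (memLp_finsetSum _ fun ν _ => memLp_hermiteT_smul_const ν _)
  have h4 : normL2UV (fun y => u y - hermiteTrunc u Λ y) ≤
      eLpNorm (fun y => u y - hermiteTrunc u Λ y) 2 gammaU :=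
    eLpNorm_mono fun y => by
      exact (Real.norm_of_nonneg (norm_nonneg _)).le.trans (normV_le_norm _)
  refine h4.trans ?_
  rw [hw.eLpNorm_eq_integral_rpow_norm (by simp) (by simp)]
  refine ENNReal.ofReal_le_ofReal ?_
  simp only [ENNReal.toReal_ofNat, Real.rpow_two]
  rw [← Real.sqrt_sq (by positivity : 0 ≤ C * R), Real.sqrt_eq_rpow, one_div]
  exact Real.rpow_le_rpow (integral_nonneg fun y => sq_nonneg _) h2 (by norm_num)

end Dirichlet

end Lognormal

end

/-! ### The main theorem. -/

theorem corollary6p1 {d : ℕ} (hd : 1 ≤ d) (D : Set (Lognormal.Space d))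
    (hDopen : IsOpen D) (hDbdd : Bornology.IsBounded D)
    (f : StrongDual ℝ (Lognormal.H10 D))
    (ψ : ℕ → Lognormal.LInfty D) (hψ : Lognormal.FinitelyOverlapping ψ)
    (p q : ℝ) (hp0 : 0 < p) (hp2 : p < 2) (hq : q = 2 * p / (2 - p))
    (hsum : Summable fun j : ℕ => ‖ψ j‖ ^ q) :
    -- almost surely the coefficient is defined and the solution exists and is unique
    (∀ᵐ y ∂Lognormal.gammaU, ∃ b : Lognormal.LInfty D, Lognormal.IsLogCoefficient ψ y b ∧
      ∃! v : Lognormal.H10 D, Lognormal.IsWeakSolution b f v) ∧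
    1 / q = 1 / p - 1 / 2 ∧
    ∀ u : (ℕ → ℝ) → Lognormal.H10 D, Lognormal.IsSolutionMap ψ f u →
      MemLp u 2 Lognormal.gammaU ∧
      (Summable fun ν : ℕ →₀ ℕ => Lognormal.normV (Lognormal.hermiteCoeff u ν) ^ p) ∧
      (∀ n : ℕ, ∃ Λ : Finset (ℕ →₀ ℕ), Lognormal.IsBestIndexSet u n Λ) ∧
      ∃ C : ℝ, ∀ n : ℕ, 1 ≤ n → ∀ Λ : Finset (ℕ →₀ ℕ), Lognormal.IsBestIndexSet u n Λ →
        Lognormal.normL2UV (fun y => u y - Lognormal.hermiteTrunc u Λ y) ≤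
          ENNReal.ofReal (C * (n : ℝ) ^ (-(1 / q))) := by
  obtain ⟨M, hM⟩ := hψ
  have hq0 : 0 < q := by rw [hq]; exact div_pos (by linarith) (by linarith)
  have hpq : 1 / q = 1 / p - 1 / 2 := by
    have : 2 - p ≠ 0 := by linarith
    rw [hq]; field_simp
  refine ⟨?_, hpq, fun u hu => ?_⟩
  · filter_upwards [Lognormal.ae_mem_goodSet hq0 hsum] with y hy
    exact ⟨_, Lognormal.isLogCoefficient_logField hM hq0 hy,
      Lognormal.existsUnique_isWeakSolution hd hDbdd _ f⟩
  obtain ⟨C, hC, hP⟩ := Lognormal.exists_poincare_const hd hDbdd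
  obtain ⟨hL, hS⟩ :=
    Lognormal.memLp_and_summable_of_isSolutionMap hd hDbdd hM hp0 hp2 hq hsum hu
  have hn0 : ∀ ν, 0 ≤ Lognormal.normV (Lognormal.hermiteCoeff u ν) := fun ν => norm_nonneg _
  have hSV : Summable fun ν => Lognormal.normV (Lognormal.hermiteCoeff u ν) ^ p :=
    Summable.of_nonneg_of_le (fun ν => Real.rpow_nonneg (hn0 ν) _)
      (fun ν => Real.rpow_le_rpow (hn0 ν) (Lognormal.normV_le_norm _) hp0.le) hS
  refine ⟨hL, hSV, fun n => ?_, ?_⟩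
  · refine Lognormal.exists_best_finset hn0 ?_ n
    have h := hSV.tendsto_cofinite_zero.rpow_const (p := p⁻¹) (Or.inr (by positivity))
    rw [Real.zero_rpow (by positivity)] at h
    exact h.congr fun ν => Real.rpow_rpow_inv (hn0 ν) hp0.ne'
  set P := ∑' ν, Lognormal.normV (Lognormal.hermiteCoeff u ν) ^ p with hPdef
  have hP0 : 0 ≤ P := tsum_nonneg fun ν => Real.rpow_nonneg (hn0 ν) _
  -- The Poincaré constant times the `ℓ^p` quasi-norm of the coefficients. Stechkin bounds the
  -- squared tail by `P (P/n)^(2/p - 1)`, which equals `(P^(1/p) n^(-1/q))²`.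
  refine ⟨C * P ^ (1 / p), fun n hn Λ hΛ => ?_⟩
  obtain ⟨h1, h2⟩ := Lognormal.tsum_sq_off_best_le hn0 hp0 hp2 hSV Λ (by rw [hΛ.1]; exact hn) hΛ.2
  have hn' : (0 : ℝ) < n := by exact_mod_cast hn
  rw [mul_assoc]
  refine Lognormal.normL2UV_sub_hermiteTrunc_le hC hP hL Λ h1 (by positivity) (h2.trans ?_)
  rw [hΛ.1, ← hPdef, mul_pow, Real.div_rpow hP0 hn'.le, ← Real.rpow_natCast (P ^ (1 / p)),
    ← Real.rpow_natCast ((n : ℝ) ^ (-(1 / q))), ← Real.rpow_mul hP0, ← Real.rpow_mul hn'.le, hpq,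
    ← mul_div_assoc]
  have e1 : P * P ^ (2 / p - 1) = P ^ (1 / p * ((2 : ℕ) : ℝ)) := by
    rcases hP0.eq_or_lt with h | h
    · have : 1 / p * ((2 : ℕ) : ℝ) ≠ 0 := by simp [hp0.ne']
      rw [← h, zero_mul, Real.zero_rpow this]
    · conv_lhs => rw [← Real.rpow_one_add' hP0 (by
        have : 0 < 2 / p := by positivity
        linarith)]
      congr 1; push_cast; ring
  have e2 : (n : ℝ) ^ (-(1 / p - 1 / 2) * ((2 : ℕ) : ℝ)) = ((n : ℝ) ^ (2 / p - 1))⁻¹ := by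
    rw [← Real.rpow_neg hn'.le]
    congr 1; push_cast; ring
  rw [e1, e2, div_eq_mul_inv]
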